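/- Let $G$ be a locally compact (Hausdorff) group with a fixed left Haar measure $dx$, and let $\omega:G\to(0,\infty)$ be a weight, i.e. a continuous function with $\omega(xy)\le\omega(x)\omega(y)$ for all $x,y\in G$. Let $L^1(G,\omega)$ be the Banach algebra of (classes of) measurable functions $f:G\to\mathbb C$ with $\|f\|_\omega=\int_G|f(x)|\,\omega(x)\,dx<\infty$, with the convolution product $(f*g)(x)=\int_G f(y)g(y^{-1}x)\,dy$. For a locally compact space $X$ with a Radon measure and a function $w:X\to(0,\infty)$, let $L^\infty(X,1/w)$ be the space of locally measurable functions $\varphi:X\to\mathbb C$ such that $|\varphi|/w$ is bounded locally almost everywhere (that is, almost everywhere on every compact set), modulo equality locally almost everywhere, with norm $\operatorname{ess\,sup}|\varphi|/w$. The space $L^\infty(G,1/\omega)$ is identified with the dual of $L^1(G,\omega)$ by $\langle g,\varphi\rangle=\int_G g(x)\varphi(x)\,dx$, and is an $L^1(G,\omega)$-bimodule with the dual actions $\langle h,f\cdot\varphi\rangle=\langle h*f,\varphi\rangle$ and $\langle h,\varphi\cdot g\rangle=\langle g*h,\varphi\rangle$. A bounded derivation is a bounded linear map $D:L^1(G,\omega)\to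 L^\infty(G,1/\omega)$ with $D(f*g)=f\cdot D(g)+D(f)\cdot g$ for all $f,g$. Put $(\omega\times\omega)(x,y)=\omega(x)\omega(y)$, and let $G\times G$ and $G\times G\times G$ carry the product Haar (Radon) measures. (a) For every bounded derivation $D:L^1(G,\omega)\to L^\infty(G,1/\omega)$ there exists $\alpha\in L^\infty\bigl(G\times G,\tfrac1{\omega\times\omega}\bigr)$, unique up to equality locally almost everywhere, such that $$\langle g,D(f)\rangle=\iint_{G\times G}\alpha(x,y)f(x)g(y)\,dx\,dy\qquad(f,g\in L^1(G,\omega)),\tag{1}$$ the integrals being absolutely convergent, and this $\alpha$ satisfies $$\alpha(xy,z)=\alpha(x,yz)+\alpha(y,zx)\qquad\text{for locally almost every }(x,y,z)\in G\times G\times G.\tag{2}$$ (b) Conversely, for every $\alpha\in L^\infty\bigl(G\times G,\tfrac1{\omega\times\omega}\bigr)$ satisfying (2) there is exactly one bounded derivation $D:L^1(G,\omega)\to L^\infty(G,1/\omega)$ satisfying (1), the integrals in (1) being absolutely convergent. -/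

import Mathlib

open MeasureTheory Filter Topology
open scoped ENNReal CompactlySupported

namespace Beurling

section LocallyAE

variable {X : Type*} [TopologicalSpace X] {m : MeasurableSpace X}

/-- The filter of locally almost everywhere true properties: a property holds locally almost
everywhere if it holds almost everywhere on each compact set. -/
noncomputable def locAE (ν : Measure X) : Filter X :=
  ⨆ (K : Set X) (_ : IsCompact K), ae (ν.restrict K)

theorem eventually_locAE {ν : Measure X} {p : X → Prop} :
    (∀ᶠ x in locAE ν, p x) ↔ ∀ K : Set X, IsCompact K → ∀ᵐ x ∂(ν.restrict K), p x := by
  simp [locAE, Filter.eventually_iSup]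

/-- Local measurability: measurability, up to null sets, on each compact set. -/
def LocMeasurable (ν : Measure X) (f : X → ℂ) : Prop :=
  ∀ K : Set X, IsCompact K → AEStronglyMeasurable f (ν.restrict K)

/-- `f` (represents an element which) belongs to `L^∞(X, 1/w)`, for a positive function `w`:
`f` is locally measurable, and `|f| / w` is bounded locally almost everywhere. -/
def MemLInftyInv (ν : Measure X) (w : X → ℝ) (f : X → ℂ) : Prop :=
  LocMeasurable ν f ∧ ∃ C : ℝ, ∀ᶠ x in locAE ν, ‖f x‖ ≤ C * w x

/-- The constants `C ≥ 0` with `|f| ≤ C w` locally almost everywhere. -/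
def boundSet (ν : Measure X) (w : X → ℝ) (φ : Germ (locAE ν) ℂ) : Set ℝ :=
  {C | 0 ≤ C ∧ ∃ f : X → ℂ, (f : Germ (locAE ν) ℂ) = φ ∧ ∀ᶠ x in locAE ν, ‖f x‖ ≤ C * w x}

theorem mem_boundSet_coe {ν : Measure X} {w : X → ℝ} {f : X → ℂ} {C : ℝ} :
    C ∈ boundSet ν w (f : Germ (locAE ν) ℂ) ↔
      0 ≤ C ∧ ∀ᶠ x in locAE ν, ‖f x‖ ≤ C * w x := by
  constructor
  · rintro ⟨h0, g, hg, hC⟩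
    refine ⟨h0, ?_⟩
    filter_upwards [Germ.coe_eq.1 hg, hC] with x h1 h2
    rwa [← h1]
  · rintro ⟨h0, hC⟩
    exact ⟨h0, f, rfl, hC⟩

end LocallyAE

section LInfty

variable {X : Type*} [TopologicalSpace X] [MeasurableSpace X]

/-- The space `L^∞(X, 1/w)` of classes, modulo equality locally almost everywhere, of functions
`f` for which `f / w` is locally measurable and bounded locally almost everywhere. -/
def lInftyInv (ν : Measure X) (w : X → ℝ) (_hw : ∀ x, 0 < w x) :
    Submodule ℂ (Germ (locAE ν) ℂ) where
  carrier := {φ | ∃ f : X → ℂ, MemLInftyInv ν w f ∧ (f : Germ (locAE ν) ℂ) = φ}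
  zero_mem' := ⟨0, ⟨fun _ _ => aestronglyMeasurable_zero, 0, by simp⟩, rfl⟩
  add_mem' := by
    rintro _ _ ⟨f, ⟨hf, C, hC⟩, rfl⟩ ⟨g, ⟨hg, C', hC'⟩, rfl⟩
    refine ⟨f + g, ⟨fun K hK => (hf K hK).add (hg K hK), C + C', ?_⟩, rfl⟩
    filter_upwards [hC, hC'] with x h1 h2
    rw [add_mul]
    exact (norm_add_le _ _).trans (add_le_add h1 h2)
  smul_mem' := by
    rintro c _ ⟨f, ⟨hf, C, hC⟩, rfl⟩
    refine ⟨c • f, ⟨fun K hK => (hf K hK).const_smul c, ‖c‖ * C, ?_⟩, rfl⟩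
    filter_upwards [hC] with x h1
    rw [Pi.smul_apply, norm_smul, mul_assoc]
    exact mul_le_mul_of_nonneg_left h1 (norm_nonneg _)

variable {ν : Measure X} {w : X → ℝ} {hw : ∀ x, 0 < w x}

/-- A function representing an element of `L^∞(X, 1/w)`. -/
noncomputable def rep (φ : lInftyInv ν w hw) : X → ℂ := φ.2.choose

theorem memLInftyInv_rep (φ : lInftyInv ν w hw) : MemLInftyInv ν w (rep φ) := φ.2.choose_spec.1

theorem coe_rep (φ : lInftyInv ν w hw) :
    (rep φ : Germ (locAE ν) ℂ) = (φ : Germ (locAE ν) ℂ) := φ.2.choose_spec.2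

/-- The norm of `L^∞(X, 1/w)`: the (local) essential supremum of `|φ| / w`. -/
noncomputable instance : Norm (lInftyInv ν w hw) :=
  ⟨fun φ => sInf (boundSet ν w (φ : Germ (locAE ν) ℂ))⟩

theorem norm_def (φ : lInftyInv ν w hw) :
    ‖φ‖ = sInf (boundSet ν w (φ : Germ (locAE ν) ℂ)) := rfl

theorem norm_le_of_bound (φ : lInftyInv ν w hw) {C : ℝ} (h0 : 0 ≤ C)
    (hC : ∀ᶠ x in locAE ν, ‖rep φ x‖ ≤ C * w x) : ‖φ‖ ≤ C := by
  rw [norm_def, ← coe_rep]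
  exact csInf_le ⟨0, fun _ h => h.1⟩ (mem_boundSet_coe.2 ⟨h0, hC⟩)

theorem norm_nonneg' (φ : lInftyInv ν w hw) : 0 ≤ ‖φ‖ :=
  Real.sInf_nonneg fun _ h => h.1

instance : CountableInterFilter (locAE ν) := by
  refine ⟨fun S hS h => ?_⟩
  have h' : ∀ᶠ x in locAE ν, x ∈ ⋂₀ S := by
    refine eventually_locAE.2 fun K hK => ?_
    exact (countable_sInter_mem hS).2 fun s hs => eventually_locAE.1 (h s hs) K hK
  exact h'

theorem rep_le_norm (φ : lInftyInv ν w hw) :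
    ∀ᶠ x in locAE ν, ‖rep φ x‖ ≤ ‖φ‖ * w x := by
  have hne : (boundSet ν w (rep φ : Germ (locAE ν) ℂ)).Nonempty := by
    obtain ⟨_, C, hC⟩ := memLInftyInv_rep φ
    refine ⟨max C 0, mem_boundSet_coe.2 ⟨le_max_right _ _, ?_⟩⟩
    filter_upwards [hC] with x hx
    exact hx.trans (mul_le_mul_of_nonneg_right (le_max_left _ _) (hw x).le)
  have key : ∀ n : ℕ, ∀ᶠ x in locAE ν, ‖rep φ x‖ ≤ (‖φ‖ + 1 / ((n : ℝ) + 1)) * w x := by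
    intro n
    have hlt : sInf (boundSet ν w (rep φ : Germ (locAE ν) ℂ)) < ‖φ‖ + 1 / ((n : ℝ) + 1) := by
      rw [coe_rep, ← norm_def]
      have : (0 : ℝ) < 1 / ((n : ℝ) + 1) := by positivity
      linarith
    obtain ⟨C, hC, hlt⟩ := exists_lt_of_csInf_lt hne hlt
    filter_upwards [(mem_boundSet_coe.1 hC).2] with x hx
    exact hx.trans (mul_le_mul_of_nonneg_right hlt.le (hw x).le)
  filter_upwards [eventually_countable_forall.2 key] with x hx
  have hlim : Tendsto (fun n : ℕ => (‖φ‖ + 1 / ((n : ℝ) + 1)) * w x) atTop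
      (𝓝 ((‖φ‖ + 0) * w x)) :=
    (tendsto_const_nhds.add tendsto_one_div_add_atTop_nhds_zero_nat).mul_const _
  rw [add_zero] at hlim
  exact ge_of_tendsto' hlim hx

theorem rep_smul (c : ℂ) (φ : lInftyInv ν w hw) : rep (c • φ) =ᶠ[locAE ν] c • rep φ := by
  apply Germ.coe_eq.1
  rw [Germ.coe_smul, coe_rep, coe_rep]
  rfl

theorem rep_add (φ ψ : lInftyInv ν w hw) : rep (φ + ψ) =ᶠ[locAE ν] rep φ + rep ψ := by
  apply Germ.coe_eq.1
  rw [Germ.coe_add, coe_rep, coe_rep, coe_rep]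
  rfl

theorem norm_smul_le' (c : ℂ) (φ : lInftyInv ν w hw) : ‖c • φ‖ ≤ ‖c‖ * ‖φ‖ := by
  refine norm_le_of_bound _ (mul_nonneg (norm_nonneg _) (norm_nonneg' _)) ?_
  filter_upwards [rep_smul c φ, rep_le_norm φ] with x h1 h2
  rw [h1, Pi.smul_apply, norm_smul, mul_assoc]
  exact mul_le_mul_of_nonneg_left h2 (norm_nonneg _)

theorem normedCore (ν : Measure X) (w : X → ℝ) (hw : ∀ x, 0 < w x) :
    NormedSpace.Core ℂ (lInftyInv ν w hw) where
  norm_nonneg := norm_nonneg'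
  norm_smul c φ := by
    refine le_antisymm (norm_smul_le' c φ) ?_
    rcases eq_or_ne c 0 with rfl | hc
    · simpa using norm_nonneg' _
    · have h := norm_smul_le' c⁻¹ (c • φ)
      rw [smul_smul, inv_mul_cancel₀ hc, one_smul, norm_inv] at h
      have hc' : 0 < ‖c‖ := norm_pos_iff.2 hc
      calc ‖c‖ * ‖φ‖ ≤ ‖c‖ * (‖c‖⁻¹ * ‖c • φ‖) := mul_le_mul_of_nonneg_left h hc'.le
        _ = ‖c • φ‖ := by rw [← mul_assoc, mul_inv_cancel₀ hc'.ne', one_mul]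
  norm_triangle φ ψ := by
    refine norm_le_of_bound _ (add_nonneg (norm_nonneg' _) (norm_nonneg' _)) ?_
    filter_upwards [rep_add φ ψ, rep_le_norm φ, rep_le_norm ψ] with x h1 h2 h3
    rw [h1, Pi.add_apply, add_mul]
    exact (norm_add_le _ _).trans (add_le_add h2 h3)
  norm_eq_zero_iff φ := by
    constructor
    · intro h
      apply Subtype.ext
      rw [← coe_rep φ]
      refine Germ.coe_eq.2 ?_
      filter_upwards [rep_le_norm φ] with x hx
      rw [h, zero_mul] at hx
      simpa using hx
    · rintro rfl
      refine le_antisymm (norm_le_of_bound _ le_rfl ?_) (norm_nonneg' _)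
      have h0 : rep (0 : lInftyInv ν w hw) =ᶠ[locAE ν] (0 : X → ℂ) := by
        apply Germ.coe_eq.1
        rw [coe_rep]
        rfl
      filter_upwards [h0] with x hx
      simp [hx]

noncomputable instance : NormedAddCommGroup (lInftyInv ν w hw) :=
  NormedAddCommGroup.ofCore (normedCore ν w hw)

noncomputable instance : NormedSpace ℂ (lInftyInv ν w hw) :=
  NormedSpace.ofCore (normedCore ν w hw)

end LInfty

section RadonProduct

set_option linter.unusedSectionVars false

variable {X Y : Type*} [TopologicalSpace X] [TopologicalSpace Y]
  [T2Space X] [T2Space Y] [LocallyCompactSpace X] [LocallyCompactSpace Y]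
  [MeasurableSpace X] [BorelSpace X] [MeasurableSpace Y] [BorelSpace Y]

theorem continuous_slice (ν : Measure Y) [IsFiniteMeasureOnCompacts ν] (F : C_c(X × Y, ℝ)) :
    Continuous fun x => ∫ y, F (x, y) ∂ν := by
  rw [← continuousOn_univ]
  refine continuousOn_integral_of_compact_support (f := fun x y => F (x, y))
    (k := Prod.snd '' tsupport F) (F.hasCompactSupport.image continuous_snd) ?_ ?_
  · exact (map_continuous F).continuousOn
  · intro x y _ hy
    by_contra h
    exact hy ⟨(x, y), subset_tsupport _ h, rfl⟩

theorem hasCompactSupport_slice (ν : Measure Y) (F : C_c(X × Y, ℝ)) :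
    HasCompactSupport fun x => ∫ y, F (x, y) ∂ν := by
  refine HasCompactSupport.intro (K := Prod.fst '' tsupport F)
    (F.hasCompactSupport.image continuous_fst) ?_
  intro x hx
  have : ∀ y, F (x, y) = 0 := fun y => by
    by_contra h
    exact hx ⟨(x, y), subset_tsupport _ h, rfl⟩
  simp [this]

theorem integrable_slice (ν : Measure Y) [IsFiniteMeasureOnCompacts ν] (F : C_c(X × Y, ℝ))
    (x : X) : Integrable (fun y => F (x, y)) ν := by
  refine Continuous.integrable_of_hasCompactSupport
    ((map_continuous F).comp (Continuous.prodMk_right x)) ?_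
  refine HasCompactSupport.intro (K := Prod.snd '' tsupport F)
    (F.hasCompactSupport.image continuous_snd) ?_
  intro y hy
  by_contra h
  exact hy ⟨(x, y), subset_tsupport _ h, rfl⟩

/-- The positive linear functional `F ↦ ∫∫ F(x, y) dν(y) dμ(x)` on `C_c(X × Y)`. -/
noncomputable def prodFunctional (μ : Measure X) (ν : Measure Y)
    [IsFiniteMeasureOnCompacts μ] [IsFiniteMeasureOnCompacts ν] : C_c(X × Y, ℝ) →ₚ[ℝ] ℝ :=
  PositiveLinearMap.mk₀
    { toFun := fun F => ∫ x, ∫ y, F (x, y) ∂ν ∂μ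
      map_add' := by
        intro F F'
        have h : ∀ x, ∫ y, (F + F') (x, y) ∂ν = (∫ y, F (x, y) ∂ν) + ∫ y, F' (x, y) ∂ν :=
          fun x => integral_add (integrable_slice ν F x) (integrable_slice ν F' x)
        simp_rw [h]
        exact integral_add
          ((continuous_slice ν F).integrable_of_hasCompactSupport (hasCompactSupport_slice ν F))
          ((continuous_slice ν F').integrable_of_hasCompactSupport (hasCompactSupport_slice ν F'))
      map_smul' := by
        intro c F
        simp [integral_const_mul] }
    (fun F hF => integral_nonneg fun x => integral_nonneg fun y => hF (x, y))

/-- The Radon product of two Radon measures, as a Borel measure on `X × Y`: the regular Borel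
measure with `∫ F = ∫∫ F(x, y) dν(y) dμ(x)` for continuous compactly supported `F`.
(For spaces that are not second countable the Borel `σ`-algebra of `X × Y` may be larger than the
product `σ`-algebra, which is why it is given explicitly.) -/
noncomputable def radonProd (μ : Measure X) (ν : Measure Y)
    [IsFiniteMeasureOnCompacts μ] [IsFiniteMeasureOnCompacts ν] :
    @Measure (X × Y) (borel (X × Y)) :=
  letI : MeasurableSpace (X × Y) := borel (X × Y)
  haveI : BorelSpace (X × Y) := ⟨rfl⟩
  RealRMK.rieszMeasure (prodFunctional μ ν)

theorem regular_radonProd (μ : Measure X) (ν : Measure Y)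
    [IsFiniteMeasureOnCompacts μ] [IsFiniteMeasureOnCompacts ν] :
    @Measure.Regular (X × Y) (borel (X × Y)) _ (radonProd μ ν) :=
  letI : MeasurableSpace (X × Y) := borel (X × Y)
  haveI : BorelSpace (X × Y) := ⟨rfl⟩
  RealRMK.regular_rieszMeasure (prodFunctional μ ν)

theorem integral_radonProd (μ : Measure X) (ν : Measure Y)
    [IsFiniteMeasureOnCompacts μ] [IsFiniteMeasureOnCompacts ν] (F : C_c(X × Y, ℝ)) :
    ∫ p, F p ∂(radonProd μ ν) = ∫ x, ∫ y, F (x, y) ∂ν ∂μ :=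
  letI : MeasurableSpace (X × Y) := borel (X × Y)
  haveI : BorelSpace (X × Y) := ⟨rfl⟩
  RealRMK.integral_rieszMeasure (prodFunctional μ ν) F

end RadonProduct

section Algebra

variable {G : Type*} [Group G] [TopologicalSpace G] [IsTopologicalGroup G]
  [LocallyCompactSpace G] [T2Space G] [MeasurableSpace G] [BorelSpace G]

/-- A (continuous) weight: a continuous, positive, submultiplicative function. -/
structure IsWeight (ω : G → ℝ) : Prop where
  continuous : Continuous ω
  pos : ∀ x, 0 < ω x
  submul : ∀ x y, ω (x * y) ≤ ω x * ω y

/-- The Banach space `L¹(G, ω)`, with norm `∫ |f(x)| ω(x) dx`. -/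
abbrev L1 (μ : Measure G) (ω : G → ℝ) : Type _ :=
  Lp ℂ 1 (μ.withDensity fun x => ENNReal.ofReal (ω x))

/-- The convolution `(f * g)(x) = ∫ f(y) g(y⁻¹ x) dy`. -/
noncomputable def conv (μ : Measure G) (f g : G → ℂ) (x : G) : ℂ :=
  ∫ y, f y * g (y⁻¹ * x) ∂μ

open Classical in
/-- The convolution product of `L¹(G, ω)`. For a weight `ω` and a left Haar measure `μ` the
convolution of two elements of `L¹(G, ω)` always belongs to `L¹(G, ω)`, so that the second
alternative does not occur. -/
noncomputable def mulL1 (μ : Measure G) (ω : G → ℝ) (f g : L1 μ ω) : L1 μ ω :=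
  if h : MemLp (conv μ f g) 1 (μ.withDensity fun x => ENNReal.ofReal (ω x)) then h.toLp else 0

/-- The space `L^∞(G, 1/ω)`. -/
abbrev LInf (μ : Measure G) (ω : G → ℝ) (hω : IsWeight ω) : Type _ :=
  lInftyInv μ ω hω.pos

/-- The duality `⟨g, φ⟩ = ∫ g(x) φ(x) dx` between `L¹(G, ω)` and `L^∞(G, 1/ω)`. -/
noncomputable def pairing {μ : Measure G} {ω : G → ℝ} {hω : IsWeight ω}
    (g : L1 μ ω) (φ : LInf μ ω hω) : ℂ :=
  ∫ x, g x * rep φ x ∂μ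

/-- `D(f * g) = f · D(g) + D(f) · g`, an identity in `L^∞(G, 1/ω) = L¹(G, ω)^*` with the dual
module actions `⟨h, f · φ⟩ = ⟨h * f, φ⟩` and `⟨h, φ · g⟩ = ⟨g * h, φ⟩`. -/
def IsDerivation {μ : Measure G} {ω : G → ℝ} {hω : IsWeight ω}
    (D : L1 μ ω →L[ℂ] LInf μ ω hω) : Prop :=
  ∀ f g h : L1 μ ω, pairing h (D (mulL1 μ ω f g)) =
    pairing (mulL1 μ ω h f) (D g) + pairing (mulL1 μ ω g h) (D f)

/-- The left Haar measure of `G × G`, on its Borel sets. -/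
noncomputable def haar2 (μ : Measure G) [IsFiniteMeasureOnCompacts μ] :
    @Measure (G × G) (borel (G × G)) :=
  radonProd μ μ

/-- The left Haar measure of `G × G × G`, on its Borel sets. -/
noncomputable def haar3 (μ : Measure G) [IsFiniteMeasureOnCompacts μ] :
    @Measure (G × G × G) (borel (G × G × G)) :=
  letI : MeasurableSpace (G × G) := borel (G × G)
  haveI : BorelSpace (G × G) := ⟨rfl⟩
  haveI : Measure.Regular (haar2 μ) := regular_radonProd μ μ
  radonProd μ (haar2 μ)

/-- The weight `ω × ω` on `G × G`. -/
def weight2 (ω : G → ℝ) (p : G × G) : ℝ := ω p.1 * ω p.2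

/-- `α(xy, z) = α(x, yz) + α(y, zx)` locally almost everywhere on `G × G × G`. -/
def IsCyclicCocycle (μ : Measure G) [IsFiniteMeasureOnCompacts μ] (α : G × G → ℂ) : Prop :=
  ∀ᶠ p : G × G × G in locAE (haar3 μ),
    α (p.1 * p.2.1, p.2.2) = α (p.1, p.2.1 * p.2.2) + α (p.2.1, p.2.2 * p.1)

/-- `⟨g, D(f)⟩ = ∬ α(x, y) f(x) g(y) dx dy` for all `f, g ∈ L¹(G, ω)`, the integrals being
absolutely convergent. -/
def Represents {μ : Measure G} [IsFiniteMeasureOnCompacts μ] {ω : G → ℝ} {hω : IsWeight ω}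
    (α : G × G → ℂ) (D : L1 μ ω →L[ℂ] LInf μ ω hω) : Prop :=
  ∀ f g : L1 μ ω,
    Integrable (fun p : G × G => α p * f p.1 * g p.2) (haar2 μ) ∧
    pairing g (D f) = ∫ p, α p * f p.1 * g p.2 ∂(haar2 μ)

end Algebra

end Beurling

/-! A bounded operator `D` from L¹(G, ω) to its dual is a bounded bilinear form (f, g) ↦ ⟨g, D f⟩.
Such a form should be integration against a kernel α with |α| ≤ ‖D‖ (ω × ω), because L¹ ⊗ L¹ is
dense in L¹ of the product. Writing u = xy in a convolution and using left invariance, the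
derivation identity for f, g tested on h becomes the vanishing of the integral of α(xy, z) - α(x,
yz) - α(y, zx) against f(x) g(y) h(z). Hence `D` is a derivation if and only if this defect is
locally almost everywhere zero. Submultiplicativity of ω makes all these integrals absolutely
convergent.

The difficulty is that G need not be σ-compact and that the Borel sets of G × G need not be
generated by rectangles. Three devices deal with it.

Fubini: for the Radon product, measures of sections are integrated correctly on open sets by
τ-additivity (`lintegral_iSup_of_directed_lowerSemicontinuous`), then on Borel sets inside finite
rectangles by induction over the σ-algebra, then inside σ-finite open rectangles
(`IsRadonProd.tonelli`). Any countable family in L¹(G, ω) lives on one open σ-compact subgroup S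
(`L1.exists_subgroup`), so every computation takes place on S × S or S × S × S, in particular
`BoundedOn2.integral_cocycleDefect`.

Existence of α: on a relatively compact rectangle, (A, B) ↦ ⟨1_B, D 1_A⟩ is a bimeasure dominated by
the weighted product measure. A weak L² limit of its averages over finite partitions is a bounded
density (`exists_density_of_bimeasure`). The local densities are glued along a Borel partition of
which every σ-compact set meets countably many members (`exists_kernel`).

Uniqueness and the cocycle identity: open rectangles with compact closure form an intersection
stable basis, and a locally integrable function with zero integral over each of its members vanishes
locally almost everywhere, by regularity (`ae_eq_zero_of_forall_basis`). -/

namespace Beurling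

/-! ### τ-additivity of regular measures. -/

section Tau

variable {X : Type*} [TopologicalSpace X] [MeasurableSpace X] [BorelSpace X]

/-- `τ`-additivity of a regular measure on directed families of lower semicontinuous functions. -/
theorem lintegral_iSup_of_directed_lowerSemicontinuous (μ : Measure X) [μ.Regular]
    {ι : Type*} [Nonempty ι] (h : ι → X → ℝ≥0∞) (hc : ∀ i, LowerSemicontinuous (h i))
    (hd : ∀ i j, ∃ k, h i ≤ h k ∧ h j ≤ h k) :
    ∫⁻ x, ⨆ i, h i x ∂μ = ⨆ i, ∫⁻ x, h i x ∂μ := by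
  refine le_antisymm ?_ (iSup_lintegral_le _)
  set S := ⨆ i, ∫⁻ x, h i x ∂μ with hS
  rcases eq_or_ne S ∞ with hS' | hStop
  · rw [hS']; exact le_top
  have hm : ∀ i, Measurable (h i) := fun i => (hc i).measurable
  choose d hd1 hd2 using hd
  obtain ⟨u, -, hu, hui⟩ := exists_seq_tendsto_sSup
    (S := Set.range fun i => ∫⁻ x, h i x ∂μ) (Set.range_nonempty _) (OrderTop.bddAbove _)
  choose i hi using hui
  -- Directedness turns a sequence whose integrals tend to the supremum `S` into an increasing one;
  -- its limit `g` has integral `S`.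
  let j : ℕ → ι := fun n => Nat.rec (i 0) (fun n a => d a (i (n + 1))) n
  have hj : ∀ n, h (j n) ≤ h (j (n + 1)) := fun n => hd1 _ _
  have hij : ∀ n, h (i n) ≤ h (j n) := by
    intro n
    cases n with
    | zero => exact le_rfl
    | succ n => exact hd2 _ _
  have hjmono : Monotone fun n => h (j n) := monotone_nat_of_le_succ hj
  let g : X → ℝ≥0∞ := fun x => ⨆ n, h (j n) x
  have hgm : Measurable g := Measurable.iSup fun n => hm _
  have hgS : ∫⁻ x, g x ∂μ = S := by
    apply le_antisymm
    · rw [lintegral_iSup (fun n => hm _) hjmono]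
      exact iSup_le fun n => le_iSup (fun i => ∫⁻ x, h i x ∂μ) (j n)
    · refine le_of_tendsto' hu fun n => ?_
      rw [← hi n]
      exact lintegral_mono fun x => (hij n x).trans (le_iSup (fun n => h (j n) x) n)
  -- Joining `h k` to the sequence cannot push the integral above the finite value `S`, so it
  -- changes `g` only on a null set.
  have hle : ∀ k, ∀ᵐ x ∂μ, h k x ≤ g x := by
    intro k
    have hsup : ∫⁻ x, (⨆ n, max (h (j n) x) (h k x)) ∂μ ≤ S := by
      rw [lintegral_iSup (fun n => (hm _).max (hm _))
        (fun a b hab x => max_le_max (hjmono hab x) le_rfl)]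
      refine iSup_le fun n => ?_
      refine le_trans (lintegral_mono fun x => ?_)
        (le_iSup (fun i => ∫⁻ x, h i x ∂μ) (d (j n) k))
      exact max_le (hd1 _ _ x) (hd2 _ _ x)
    have hae := ae_eq_of_ae_le_of_lintegral_le (μ := μ) (f := g)
      (g := fun x => ⨆ n, max (h (j n) x) (h k x))
      (Eventually.of_forall fun x => iSup_mono fun n => le_max_left _ _)
      (by rw [hgS]; exact hStop) (Measurable.iSup fun n => (hm _).max (hm _)).aemeasurable
      (by rw [hgS]; exact hsup)
    filter_upwards [hae] with x hx
    rw [hx]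
    exact (le_max_right _ _).trans (le_iSup (fun n => max (h (j n) x) (h k x)) 0)
  -- The null set in `hle` depends on `k`, and there may be uncountably many `k`. The level sets
  -- avoid this: `O` is a directed union of open sets, so a compact subset of `O` lies in a single
  -- one of them, and inner regularity bounds the measure of `O` by that of the level set of `g`.
  have hlevel : ∀ t : ℝ≥0∞, t ≠ 0 → t ≠ ∞ → ∀ᵐ x ∂μ, t < (⨆ i, h i x) → t < g x := by
    intro t ht0 ht
    let O : Set X := {x | t < ⨆ i, h i x}
    have hOeq : O = ⋃ i, {x | t < h i x} := by
      ext x; simp [O, lt_iSup_iff]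
    have hopen : ∀ i, IsOpen {x | t < h i x} := fun i =>
      lowerSemicontinuous_iff_isOpen_preimage.1 (hc i) t
    have hOo : IsOpen O := by rw [hOeq]; exact isOpen_iUnion hopen
    have hgmeas : MeasurableSet {x | t < g x} := measurableSet_lt measurable_const hgm
    have hOle : μ O ≤ μ {x | t < g x} := by
      rw [hOo.measure_eq_iSup_isCompact]
      refine iSup₂_le fun K hKO => iSup_le fun hK => ?_
      rw [hOeq] at hKO
      have hdir : Directed (· ⊆ ·) fun i => {x | t < h i x} := fun a b =>
        ⟨d a b, fun x hx => lt_of_lt_of_le hx (hd1 a b x), fun x hx =>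
          lt_of_lt_of_le hx (hd2 a b x)⟩
      obtain ⟨k, hk⟩ := hK.elim_directed_cover _ hopen hKO hdir
      refine measure_mono_ae ?_
      filter_upwards [hle k] with x hx hxK
      exact lt_of_lt_of_le (hk hxK) hx
    have hgO : {x | t < g x} ⊆ O := fun x hx =>
      lt_of_lt_of_le hx (iSup_le fun n => le_iSup (fun i => h i x) (j n))
    have hfin : μ {x | t < g x} ≠ ∞ := by
      refine ne_top_of_le_ne_top ?_ (meas_ge_le_lintegral_div hgm.aemeasurable ht0 ht |>.trans'
        (measure_mono fun x (hx : t < g x) => hx.le))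
      rw [hgS]
      exact ENNReal.div_ne_top hStop ht0
    have hdiff : μ (O \ {x | t < g x}) = 0 := by
      rw [measure_sdiff hgO hgmeas.nullMeasurableSet hfin]
      exact tsub_eq_zero_of_le hOle
    filter_upwards [measure_eq_zero_iff_ae_notMem.1 hdiff] with x hx hxO
    by_contra hcon
    exact hx ⟨hxO, hcon⟩
  have hfinal : ∀ᵐ x ∂μ, (⨆ i, h i x) ≤ g x := by
    have : ∀ᵐ x ∂μ, ∀ q : {q : ℚ // 0 < q}, ENNReal.ofReal (q : ℚ) < (⨆ i, h i x) →
        ENNReal.ofReal (q : ℚ) < g x := by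
      refine ae_all_iff.2 fun q => hlevel _ ?_ ENNReal.ofReal_ne_top
      have : (0 : ℝ) < (q : ℚ) := by exact_mod_cast q.2
      simpa using this
    filter_upwards [this] with x hx
    by_contra! hlt
    obtain ⟨q, hq0, h1, h2⟩ := ENNReal.lt_iff_exists_rat_btwn.1 hlt
    rcases hq0.eq_or_lt with rfl | hq
    · simp at h1
    · exact lt_asymm h1 (hx ⟨q, hq⟩ h2)
  exact (lintegral_mono_ae hfinal).trans hgS.le

end Tau

/-! ### Products with their Borel σ-algebra, as a separate type so that the product σ-algebra is not
inferred. -/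

/-- The product of two topological spaces, with its Borel `σ`-algebra. -/
def BP (X Y : Type*) : Type _ := X × Y

namespace BP

set_option linter.unusedSectionVars false

variable {X Y : Type*} [TopologicalSpace X] [TopologicalSpace Y]

instance : TopologicalSpace (BP X Y) := inferInstanceAs (TopologicalSpace (X × Y))
instance : MeasurableSpace (BP X Y) := borel (X × Y)
instance : BorelSpace (BP X Y) := ⟨rfl⟩
instance [T2Space X] [T2Space Y] : T2Space (BP X Y) := inferInstanceAs (T2Space (X × Y))
instance [LocallyCompactSpace X] [LocallyCompactSpace Y] : LocallyCompactSpace (BP X Y) :=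
  inferInstanceAs (LocallyCompactSpace (X × Y))

/-- A pair, as a point of `BP X Y`. -/
def mk (x : X) (y : Y) : BP X Y := (x, y)

@[simp] theorem mk_fst (x : X) (y : Y) : (mk x y).1 = x := rfl
@[simp] theorem mk_snd (x : X) (y : Y) : (mk x y).2 = y := rfl

theorem continuous_fst : Continuous (fun p : BP X Y => p.1) := _root_.continuous_fst (X := X) (Y := Y)
theorem continuous_snd : Continuous (fun p : BP X Y => p.2) := _root_.continuous_snd (X := X) (Y := Y)
theorem continuous_mk {Z : Type*} [TopologicalSpace Z] {f : Z → X} {g : Z → Y}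
    (hf : Continuous f) (hg : Continuous g) : Continuous fun z => mk (f z) (g z) := hf.prodMk hg

theorem measurable_fst [MeasurableSpace X] [BorelSpace X] : Measurable (fun p : BP X Y => p.1) :=
  continuous_fst.measurable
theorem measurable_snd [MeasurableSpace Y] [BorelSpace Y] : Measurable (fun p : BP X Y => p.2) :=
  continuous_snd.measurable
theorem measurable_mk_left [MeasurableSpace Y] [BorelSpace Y] (x : X) :
    Measurable (fun y : Y => mk x y) := (continuous_mk continuous_const continuous_id).measurable

/-- The rectangle `S × T`. -/
def rect (S : Set X) (T : Set Y) : Set (BP X Y) := {p | p.1 ∈ S ∧ p.2 ∈ T}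

theorem isOpen_rect {S : Set X} {T : Set Y} (hS : IsOpen S) (hT : IsOpen T) : IsOpen (rect S T) :=
  (hS.preimage continuous_fst).inter (hT.preimage continuous_snd)

theorem measurableSet_rect [MeasurableSpace X] [BorelSpace X] [MeasurableSpace Y] [BorelSpace Y]
    {S : Set X} {T : Set Y} (hS : MeasurableSet S)
    (hT : MeasurableSet T) : MeasurableSet (rect S T) :=
  (measurable_fst hS).inter (measurable_snd hT)

theorem isCompact_rect {S : Set X} {T : Set Y} (hS : IsCompact S) (hT : IsCompact T) :
    IsCompact (rect S T) := hS.prod hT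

end BP

/-- `ρ` is the product of `μ` and `ν` on all Borel sets of the product space, in the sense that
its value on a Borel set is obtained by integrating the measures of the sections. -/
structure Tonelli {X Y : Type*} [TopologicalSpace X] [TopologicalSpace Y]
    [MeasurableSpace X] [MeasurableSpace Y]
    (μ : Measure X) (ν : Measure Y) (ρ : Measure (BP X Y)) : Prop where
  aemeasurable_section : ∀ E, MeasurableSet E → AEMeasurable (fun x => ν {y | BP.mk x y ∈ E}) μ
  measure_eq : ∀ E, MeasurableSet E → ρ E = ∫⁻ x, ν {y | BP.mk x y ∈ E} ∂μ

/-! ### Tonelli's theorem for Radon products. -/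

section RadonTonelli

set_option linter.unusedSectionVars false

variable {X Y : Type*} [TopologicalSpace X] [TopologicalSpace Y]
  [T2Space X] [T2Space Y] [LocallyCompactSpace X] [LocallyCompactSpace Y]
  [MeasurableSpace X] [BorelSpace X] [MeasurableSpace Y] [BorelSpace Y]

/-- `ρ` integrates continuous compactly supported functions as iterated integrals. -/
def IsRadonProd (μ : Measure X) (ν : Measure Y) (ρ : Measure (BP X Y)) : Prop :=
  ∀ F : BP X Y → ℝ, Continuous F → HasCompactSupport F →
    ∫ p, F p ∂ρ = ∫ x, ∫ y, F (BP.mk x y) ∂ν ∂μ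

/-- Continuous compactly supported functions between zero and the indicator function of `E`. -/
def Below {Z : Type*} [TopologicalSpace Z] (E : Set Z) : Type _ :=
  {F : Z → ℝ // Continuous F ∧ HasCompactSupport F ∧ (∀ p, 0 ≤ F p) ∧
    (∀ p, F p ≤ 1) ∧ ∀ p ∉ E, F p = 0}

theorem Below.ofReal_le {Z : Type*} [TopologicalSpace Z] {E : Set Z} (F : Below E) (p : Z) :
    ENNReal.ofReal (F.1 p) ≤ E.indicator 1 p := by
  by_cases hp : p ∈ E
  · simpa [hp] using F.2.2.2.2.1 p
  · simp [hp, F.2.2.2.2.2 p hp]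

theorem Below.exists_one {Z : Type*} [TopologicalSpace Z] [T2Space Z] [LocallyCompactSpace Z]
    {E C : Set Z} (hE : IsOpen E) (hC : IsCompact C) (hCE : C ⊆ E) :
    ∃ F : Below E, ∀ p ∈ C, F.1 p = 1 := by
  obtain ⟨f, h1, h0, hs, hf⟩ := exists_continuous_one_zero_of_isCompact hC hE.isClosed_compl
    (Set.disjoint_left.2 fun x hx hx' => hx' (hCE hx))
  exact ⟨⟨f, f.continuous, hs, fun p => (hf p).1, fun p => (hf p).2, fun p hp => h0 hp⟩,
    fun p hp => h1 hp⟩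

instance {Z : Type*} [TopologicalSpace Z] (E : Set Z) : Nonempty (Below E) :=
  ⟨⟨0, continuous_zero, HasCompactSupport.zero, fun _ => le_rfl, fun _ => zero_le_one,
    fun _ _ => rfl⟩⟩

theorem Below.directed {Z : Type*} [TopologicalSpace Z] [R1Space Z] {E : Set Z} (F F' : Below E) :
    ∃ F'' : Below E, F.1 ≤ F''.1 ∧ F'.1 ≤ F''.1 := by
  refine ⟨⟨fun p => max (F.1 p) (F'.1 p), F.2.1.max F'.2.1, ?_, fun p => ?_, fun p => ?_,
    fun p hp => ?_⟩, fun p => le_max_left _ _, fun p => le_max_right _ _⟩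
  · refine HasCompactSupport.intro (F.2.2.1.isCompact.union F'.2.2.1.isCompact) fun x hx => ?_
    have h1 : F.1 x = 0 := image_eq_zero_of_notMem_tsupport fun h => hx (Or.inl h)
    have h2 : F'.1 x = 0 := image_eq_zero_of_notMem_tsupport fun h => hx (Or.inr h)
    simp [h1, h2]
  · exact le_max_of_le_left (F.2.2.2.1 p)
  · exact max_le (F.2.2.2.2.1 p) (F'.2.2.2.2.1 p)
  · simp [F.2.2.2.2.2 p hp, F'.2.2.2.2.2 p hp]

/-- Inner regularity: a compact subset of the preimage has compact image in `E`, and some member of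
`Below E` equals one on that image. The map `j` is `BP.mk x` for sections and the identity for the
whole product, so that both measures become suprema over the same family. -/
theorem iSup_lintegral_below {Z W : Type*} [TopologicalSpace Z] [TopologicalSpace W] [T2Space W]
    [LocallyCompactSpace W] [MeasurableSpace Z] [BorelSpace Z] (ν : Measure Z) [ν.Regular]
    {E : Set W} (hE : IsOpen E) {j : Z → W} (hj : Continuous j) :
    ⨆ F : Below E, ∫⁻ z, ENNReal.ofReal (F.1 (j z)) ∂ν = ν (j ⁻¹' E) := by
  have hm : MeasurableSet (j ⁻¹' E) := (hE.preimage hj).measurableSet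
  apply le_antisymm
  · refine iSup_le fun F => ?_
    rw [← lintegral_indicator_one hm]
    exact lintegral_mono fun z => F.ofReal_le (j z)
  · rw [(hE.preimage hj).measure_eq_iSup_isCompact]
    refine iSup₂_le fun K hKO => iSup_le fun hK => ?_
    obtain ⟨F, hF⟩ := Below.exists_one hE (hK.image hj) (Set.image_subset_iff.2 hKO)
    refine le_trans ?_ (le_iSup _ F)
    rw [← setLIntegral_one]
    calc ∫⁻ z in K, 1 ∂ν ≤ ∫⁻ z in K, ENNReal.ofReal (F.1 (j z)) ∂ν := by
          refine setLIntegral_mono ?_ fun z hz => ?_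
          · exact (F.2.1.comp hj).measurable.ennreal_ofReal
          · simp [hF _ (Set.mem_image_of_mem j hz)]
      _ ≤ _ := setLIntegral_le_lintegral _ _

variable {μ : Measure X} {ν : Measure Y} {ρ : Measure (BP X Y)}

theorem continuous_lintegral_slice [ν.Regular] {F : BP X Y → ℝ} (hF : Continuous F)
    (hc : HasCompactSupport F) (h0 : ∀ p, 0 ≤ F p) :
    Continuous fun x => ∫⁻ y, ENNReal.ofReal (F (BP.mk x y)) ∂ν := by
  let F' : C_c(X × Y, ℝ) := ⟨⟨F, hF⟩, hc⟩
  have h : ∀ x, ∫⁻ y, ENNReal.ofReal (F (BP.mk x y)) ∂ν =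
      ENNReal.ofReal (∫ y, F (BP.mk x y) ∂ν) := fun x =>
    (ofReal_integral_eq_lintegral_ofReal (integrable_slice ν F' x)
      (Eventually.of_forall fun y => h0 _)).symm
  simp_rw [h]
  exact ENNReal.continuous_ofReal.comp (continuous_slice ν F')

theorem IsRadonProd.lintegral_eq [μ.Regular] [ν.Regular] [ρ.Regular] (h : IsRadonProd μ ν ρ)
    {F : BP X Y → ℝ} (hF : Continuous F) (hc : HasCompactSupport F) (h0 : ∀ p, 0 ≤ F p) :
    ∫⁻ p, ENNReal.ofReal (F p) ∂ρ = ∫⁻ x, ∫⁻ y, ENNReal.ofReal (F (BP.mk x y)) ∂ν ∂μ := by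
  let F' : C_c(X × Y, ℝ) := ⟨⟨F, hF⟩, hc⟩
  have h1 : ∀ x, ∫⁻ y, ENNReal.ofReal (F (BP.mk x y)) ∂ν =
      ENNReal.ofReal (∫ y, F (BP.mk x y) ∂ν) := fun x =>
    (ofReal_integral_eq_lintegral_ofReal (integrable_slice ν F' x)
      (Eventually.of_forall fun y => h0 _)).symm
  simp_rw [h1]
  rw [← ofReal_integral_eq_lintegral_ofReal (hF.integrable_of_hasCompactSupport hc)
    (Eventually.of_forall h0), h F hF hc]
  refine ofReal_integral_eq_lintegral_ofReal
    ((continuous_slice ν F').integrable_of_hasCompactSupport (hasCompactSupport_slice ν F'))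
    (Eventually.of_forall fun x => integral_nonneg fun y => h0 _)

/-- An uncountable supremum of continuous functions of x is still lower semicontinuous. -/
theorem measurable_section_of_isOpen [ν.Regular] {E : Set (BP X Y)} (hE : IsOpen E) :
    Measurable fun x => ν {y | BP.mk x y ∈ E} := by
  have h : ∀ x, ν {y | BP.mk x y ∈ E} =
      ⨆ F : Below E, ∫⁻ y, ENNReal.ofReal (F.1 (BP.mk x y)) ∂ν := fun x =>
    (iSup_lintegral_below ν hE (j := BP.mk x) (BP.continuous_mk continuous_const continuous_id)).symm
  simp_rw [h]
  refine LowerSemicontinuous.measurable (lowerSemicontinuous_iSup fun F => ?_)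
  exact (continuous_lintegral_slice F.2.1 F.2.2.1 F.2.2.2.1).lowerSemicontinuous

/-- τ-additivity moves the supremum over the directed family `Below E` through the outer integral;
each member obeys the iterated integral formula. -/
theorem IsRadonProd.measure_isOpen [μ.Regular] [ν.Regular] [ρ.Regular] (h : IsRadonProd μ ν ρ)
    {E : Set (BP X Y)} (hE : IsOpen E) : ρ E = ∫⁻ x, ν {y | BP.mk x y ∈ E} ∂μ := by
  have h1 : ∀ x, ν {y | BP.mk x y ∈ E} =
      ⨆ F : Below E, ∫⁻ y, ENNReal.ofReal (F.1 (BP.mk x y)) ∂ν := fun x =>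
    (iSup_lintegral_below ν hE (j := BP.mk x) (BP.continuous_mk continuous_const continuous_id)).symm
  simp_rw [h1]
  rw [lintegral_iSup_of_directed_lowerSemicontinuous μ, ← Set.preimage_id (s := E),
    ← iSup_lintegral_below ρ hE continuous_id]
  · exact iSup_congr fun F => h.lintegral_eq F.2.1 F.2.2.1 F.2.2.2.1
  · exact fun F => (continuous_lintegral_slice F.2.1 F.2.2.1 F.2.2.2.1).lowerSemicontinuous
  · intro F F'
    obtain ⟨F'', h1, h2⟩ := F.directed F'
    exact ⟨F'', fun x => lintegral_mono fun y => ENNReal.ofReal_le_ofReal (h1 _),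
      fun x => lintegral_mono fun y => ENNReal.ofReal_le_ofReal (h2 _)⟩

theorem BP.measurable_section {E : Set (BP X Y)} (hE : MeasurableSet E) (x : X) :
    MeasurableSet {y | BP.mk x y ∈ E} := BP.measurable_mk_left x hE

/-- The sections of a radon product restricted to an open rectangle of finite measure. -/
theorem IsRadonProd.tonelli_of_finite [μ.Regular] [ν.Regular] [ρ.Regular] (h : IsRadonProd μ ν ρ)
    {V : Set X} {W : Set Y} (hV : IsOpen V) (hW : IsOpen W) (hV' : μ V ≠ ∞) (hW' : ν W ≠ ∞) :
    Tonelli (μ.restrict V) (ν.restrict W) (ρ.restrict (BP.rect V W)) := by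
  have hfinV : IsFiniteMeasure (μ.restrict V) := isFiniteMeasure_restrict.2 hV'
  have hfinW : IsFiniteMeasure (ν.restrict W) := isFiniteMeasure_restrict.2 hW'
  have hopen : ∀ E : Set (BP X Y), IsOpen E →
      AEMeasurable (fun x => ν.restrict W {y | BP.mk x y ∈ E}) (μ.restrict V) ∧
      ρ.restrict (BP.rect V W) E = ∫⁻ x in V, ν.restrict W {y | BP.mk x y ∈ E} ∂μ := by
    intro E hE
    have hEo : IsOpen (E ∩ BP.rect V W) := hE.inter (BP.isOpen_rect hV hW)
    have hsec : ∀ x ∈ V, ν.restrict W {y | BP.mk x y ∈ E} =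
        ν {y | BP.mk x y ∈ E ∩ BP.rect V W} := by
      intro x hx
      rw [Measure.restrict_apply (BP.measurable_section hE.measurableSet x)]
      congr 1
      ext y
      simp [BP.rect, hx]
    constructor
    · refine (measurable_section_of_isOpen (ν := ν) hEo).aemeasurable.congr ?_
      filter_upwards [ae_restrict_mem hV.measurableSet] with x hx
      exact (hsec x hx).symm
    · rw [Measure.restrict_apply hE.measurableSet, h.measure_isOpen hEo,
        setLIntegral_congr_fun hV.measurableSet hsec, ← lintegral_indicator hV.measurableSet]
      refine lintegral_congr fun x => ?_
      by_cases hx : x ∈ V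
      · simp [hx]
      · simp [hx, BP.rect]
  have hfin : IsFiniteMeasure (ρ.restrict (BP.rect V W)) := by
    refine ⟨?_⟩
    rw [(hopen Set.univ isOpen_univ).2]
    simp only [Set.mem_univ, Set.ofPred_true]
    rw [lintegral_const]
    exact ENNReal.mul_lt_top (measure_lt_top _ _) (measure_lt_top _ _)
  have main : ∀ E : Set (BP X Y), MeasurableSet E →
      AEMeasurable (fun x => ν.restrict W {y | BP.mk x y ∈ E}) (μ.restrict V) ∧
      ρ.restrict (BP.rect V W) E = ∫⁻ x in V, ν.restrict W {y | BP.mk x y ∈ E} ∂μ := by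
    intro E hE
    -- Complements are where finiteness of the measures is needed: section measures are subtracted
    -- under the integral.
    induction E, hE using MeasurableSet.induction_on_open with
    | isOpen U hU => exact hopen U hU
    | compl s hs ih =>
      have hsec : ∀ x, ν.restrict W {y | BP.mk x y ∈ sᶜ} =
          ν.restrict W Set.univ - ν.restrict W {y | BP.mk x y ∈ s} := fun x =>
        measure_compl (BP.measurable_section hs x) (measure_ne_top _ _)
      simp_rw [hsec]
      refine ⟨aemeasurable_const.sub ih.1, ?_⟩
      have hlt : ∫⁻ x in V, ν.restrict W {y | BP.mk x y ∈ s} ∂μ ≠ ∞ := by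
        rw [← ih.2]; exact measure_ne_top _ _
      rw [lintegral_sub' ih.1 hlt (Eventually.of_forall fun x => measure_mono (Set.subset_univ _)),
        measure_compl hs (measure_ne_top _ _), ← ih.2, (hopen Set.univ isOpen_univ).2]
      rfl
    | iUnion f hd hf ih =>
      have hsec : ∀ x, ν.restrict W {y | BP.mk x y ∈ ⋃ i, f i} =
          ∑' i, ν.restrict W {y | BP.mk x y ∈ f i} := by
        intro x
        rw [← measure_iUnion]
        · congr 1
          ext y
          simp
        · intro i j hij
          exact Set.disjoint_left.2 fun y h1 h2 => Set.disjoint_left.1 (hd hij) h1 h2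
        · exact fun i => BP.measurable_section (hf i) x
      simp_rw [hsec]
      refine ⟨AEMeasurable.tsum fun i => (ih i).1, ?_⟩
      rw [measure_iUnion hd hf, lintegral_tsum fun i => (ih i).1]
      exact tsum_congr fun i => (ih i).2
  exact ⟨fun E hE => (main E hE).1, fun E hE => (main E hE).2⟩

/-- An open set which is a countable increasing union of open sets of finite measure. -/
def SigmaFiniteOpen (μ : Measure X) (S : Set X) : Prop :=
  ∃ V : ℕ → Set X, Monotone V ∧ (∀ n, IsOpen (V n)) ∧ (∀ n, μ (V n) ≠ ∞) ∧ ⋃ n, V n = S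

theorem SigmaFiniteOpen.isOpen {S : Set X} (h : SigmaFiniteOpen μ S) : IsOpen S := by
  obtain ⟨V, -, ho, -, rfl⟩ := h
  exact isOpen_iUnion ho

/-- Monotone convergence along the two exhaustions; the double index (m, n) is dominated by the
diagonal index max m n. -/
theorem IsRadonProd.tonelli [μ.Regular] [ν.Regular] [ρ.Regular] (h : IsRadonProd μ ν ρ)
    {S : Set X} {T : Set Y} (hS : SigmaFiniteOpen μ S) (hT : SigmaFiniteOpen ν T) :
    Tonelli (μ.restrict S) (ν.restrict T) (ρ.restrict (BP.rect S T)) := by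
  obtain ⟨V, hVm, hVo, hVf, rfl⟩ := hS
  obtain ⟨W, hWm, hWo, hWf, rfl⟩ := hT
  have hVW : ∀ m n, Tonelli (μ.restrict (V m)) (ν.restrict (W n)) (ρ.restrict (BP.rect (V m) (W n))) :=
    fun m n => h.tonelli_of_finite (hVo m) (hWo n) (hVf m) (hWf n)
  have hsec : ∀ E : Set (BP X Y), MeasurableSet E → ∀ x,
      ν.restrict (⋃ n, W n) {y | BP.mk x y ∈ E} = ⨆ n, ν.restrict (W n) {y | BP.mk x y ∈ E} := by
    intro E hE x
    exact Measure.restrict_iUnion_apply_eq_iSup hWm.directed_le (BP.measurable_section hE x)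
  refine ⟨fun E hE => ?_, fun E hE => ?_⟩
  · simp_rw [hsec E hE]
    refine AEMeasurable.iSup fun n => (aemeasurable_iUnion_iff).2 fun m => ?_
    exact (hVW m n).aemeasurable_section E hE
  · have hmeas : ∀ n, AEMeasurable (fun x => ν.restrict (W n) {y | BP.mk x y ∈ E})
        (μ.restrict (⋃ n, V n)) := fun n =>
      (aemeasurable_iUnion_iff).2 fun m => (hVW m n).aemeasurable_section E hE
    simp_rw [hsec E hE]
    have hrect : BP.rect (⋃ n, V n) (⋃ n, W n) = ⋃ n, BP.rect (V n) (W n) := by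
      ext p
      simp only [BP.rect, Set.mem_iUnion, Set.mem_ofPred_eq]
      constructor
      · rintro ⟨⟨m, hm⟩, n, hn⟩
        exact ⟨max m n, hVm (le_max_left _ _) hm, hWm (le_max_right _ _) hn⟩
      · rintro ⟨n, h1, h2⟩
        exact ⟨⟨n, h1⟩, n, h2⟩
    have hrm : Monotone fun n => BP.rect (V n) (W n) := fun a b hab p hp =>
      ⟨hVm hab hp.1, hWm hab hp.2⟩
    rw [hrect, Measure.restrict_iUnion_apply_eq_iSup hrm.directed_le hE, lintegral_iSup' hmeas]
    · apply le_antisymm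
      · refine iSup_le fun n => ?_
        rw [(hVW n n).measure_eq E hE]
        refine le_trans ?_ (le_iSup _ n)
        exact lintegral_mono' (Measure.restrict_mono (Set.subset_iUnion V n) le_rfl) le_rfl
      · refine iSup_le fun n => ?_
        have hmono : Monotone fun m => μ.restrict (V m) := fun a b hab =>
          Measure.restrict_mono (hVm hab) le_rfl
        rw [← lintegral_indicator (MeasurableSet.iUnion fun n => (hVo n).measurableSet)]
        have hind : ∀ x, (⋃ n, V n).indicator (fun x => ν.restrict (W n) {y | BP.mk x y ∈ E}) x =
            ⨆ m, (V m).indicator (fun x => ν.restrict (W n) {y | BP.mk x y ∈ E}) x := fun x =>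
          Set.indicator_iUnion_apply (by simp) _ _ _
        simp_rw [hind]
        rw [lintegral_iSup']
        · refine iSup_le fun m => ?_
          rw [lintegral_indicator (hVo m).measurableSet]
          refine le_trans ?_ (le_iSup _ (max m n))
          rw [(hVW _ _).measure_eq E hE]
          exact lintegral_mono' (hmono (le_max_left _ _))
            fun x => Measure.restrict_mono (hWm (le_max_right _ _)) le_rfl _
        · exact fun m => (aemeasurable_indicator_iff (hVo m).measurableSet).2
            ((hVW m n).aemeasurable_section E hE)
        · exact Eventually.of_forall fun x a b hab =>
            Set.indicator_le_indicator_of_subset (hVm hab) (fun _ => bot_le) x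
    · exact Eventually.of_forall fun x a b hab => Measure.restrict_mono (hWm hab) le_rfl _

end RadonTonelli

/-! ### Exchanging the factors. -/

section SwapProd

set_option linter.unusedSectionVars false

variable {X Y : Type*} [TopologicalSpace X] [TopologicalSpace Y]

/-- The coordinate swap, as a homeomorphism. -/
def BP.swap (X Y : Type*) [TopologicalSpace X] [TopologicalSpace Y] : BP X Y ≃ₜ BP Y X :=
  Homeomorph.prodComm X Y

@[simp] theorem BP.swap_mk (x : X) (y : Y) : BP.swap X Y (BP.mk x y) = BP.mk y x := rfl

theorem BP.measurable_swap : Measurable (BP.swap X Y) := (BP.swap X Y).continuous.measurable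

variable [T2Space X] [T2Space Y] [LocallyCompactSpace X] [LocallyCompactSpace Y]
  [MeasurableSpace X] [BorelSpace X] [MeasurableSpace Y] [BorelSpace Y]
  {μ : Measure X} {ν : Measure Y} {ρ : Measure (BP X Y)}

/-- For continuous compactly supported integrands the order of integration can be exchanged without
σ-finiteness. -/
theorem IsRadonProd.map_swap [μ.Regular] [ν.Regular] (h : IsRadonProd μ ν ρ) :
    IsRadonProd ν μ (ρ.map (BP.swap X Y)) := by
  intro F hF hc
  have he : MeasurableEmbedding (BP.swap X Y) := (BP.swap X Y).measurableEmbedding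
  refine (he.integral_map F).trans ((h _ (hF.comp (BP.swap X Y).continuous)
    (hc.comp_homeomorph (BP.swap X Y))).trans ?_)
  exact integral_integral_swap_of_hasCompactSupport (f := fun x y => F (BP.mk y x))
    (hF.comp (BP.swap X Y).continuous) (hc.comp_homeomorph (BP.swap X Y))

theorem IsRadonProd.tonelli_swap [μ.Regular] [ν.Regular] [ρ.Regular] (h : IsRadonProd μ ν ρ)
    {S : Set X} {T : Set Y} (hS : SigmaFiniteOpen μ S) (hT : SigmaFiniteOpen ν T) :
    Tonelli (ν.restrict T) (μ.restrict S) ((ρ.restrict (BP.rect S T)).map (BP.swap X Y)) := by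
  have hreg : (ρ.map (BP.swap X Y)).Regular := Measure.Regular.map (BP.swap X Y)
  have h1 := h.map_swap.tonelli hT hS
  rw [Measure.restrict_map BP.measurable_swap
    (BP.isOpen_rect hT.isOpen hS.isOpen).measurableSet] at h1
  have h2 : BP.swap X Y ⁻¹' BP.rect T S = BP.rect S T := by
    ext p
    exact and_comm
  rwa [h2] at h1

end SwapProd

/-! ### Fubini's theorem for measures satisfying `Tonelli`. -/

namespace Tonelli

set_option linter.unusedSectionVars false

variable {X Y : Type*} [TopologicalSpace X] [TopologicalSpace Y]
  [MeasurableSpace X] [BorelSpace X] [MeasurableSpace Y] [BorelSpace Y]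
  {μ : Measure X} {ν : Measure Y} {ρ : Measure (BP X Y)}

theorem ae (h : Tonelli μ ν ρ) {P : BP X Y → Prop} (hP : ∀ᵐ p ∂ρ, P p) :
    ∀ᵐ x ∂μ, ∀ᵐ y ∂ν, P (BP.mk x y) := by
  obtain ⟨N, hPN, hN, hN0⟩ := exists_measurable_superset_of_null (ae_iff.1 hP)
  rw [h.measure_eq N hN, lintegral_eq_zero_iff' (h.aemeasurable_section N hN)] at hN0
  filter_upwards [hN0] with x hx
  filter_upwards [measure_eq_zero_iff_ae_notMem.1 hx] with y hy
  by_contra hcon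
  exact hy (hPN hcon)

theorem measure_eq_zero (h : Tonelli μ ν ρ) {N : Set (BP X Y)} (hN : MeasurableSet N)
    (h0 : ∀ᵐ x ∂μ, ν {y | BP.mk x y ∈ N} = 0) : ρ N = 0 := by
  rw [h.measure_eq N hN, lintegral_eq_zero_iff' (h.aemeasurable_section N hN)]
  exact h0

theorem quasiMeasurePreserving_fst (h : Tonelli μ ν ρ) :
    Measure.QuasiMeasurePreserving (fun p : BP X Y => p.1) ρ μ := by
  refine ⟨BP.measurable_fst, Measure.AbsolutelyContinuous.mk fun s hs h0 => ?_⟩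
  rw [Measure.map_apply BP.measurable_fst hs]
  refine h.measure_eq_zero (BP.measurable_fst hs) ?_
  filter_upwards [measure_eq_zero_iff_ae_notMem.1 h0] with x hx
  simp [hx]

theorem quasiMeasurePreserving_snd (h : Tonelli μ ν ρ) :
    Measure.QuasiMeasurePreserving (fun p : BP X Y => p.2) ρ ν := by
  refine ⟨BP.measurable_snd, Measure.AbsolutelyContinuous.mk fun s hs h0 => ?_⟩
  rw [Measure.map_apply BP.measurable_snd hs]
  exact h.measure_eq_zero (BP.measurable_snd hs) (Eventually.of_forall fun x => h0)

/-- Measurability and the formula share one induction, because the sum and limit steps for the outer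
integral need the inner integrals to be measurable. -/
theorem lintegral_aux (h : Tonelli μ ν ρ) {F : BP X Y → ℝ≥0∞} (hF : Measurable F) :
    AEMeasurable (fun x => ∫⁻ y, F (BP.mk x y) ∂ν) μ ∧
      ∫⁻ p, F p ∂ρ = ∫⁻ x, ∫⁻ y, F (BP.mk x y) ∂ν ∂μ := by
  refine Measurable.ennreal_induction (motive := fun F : BP X Y → ℝ≥0∞ =>
    AEMeasurable (fun x => ∫⁻ y, F (BP.mk x y) ∂ν) μ ∧
      ∫⁻ p, F p ∂ρ = ∫⁻ x, ∫⁻ y, F (BP.mk x y) ∂ν ∂μ) ?_ ?_ ?_ hF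
  · intro c s hs
    have hsec : ∀ x, ∫⁻ y, s.indicator (fun _ => c) (BP.mk x y) ∂ν = c * ν {y | BP.mk x y ∈ s} := by
      intro x
      exact lintegral_indicator_const (BP.measurable_mk_left x hs) c
    simp_rw [hsec]
    refine ⟨(h.aemeasurable_section s hs).const_mul c, ?_⟩
    rw [lintegral_indicator_const hs, lintegral_const_mul'' _ (h.aemeasurable_section s hs),
      h.measure_eq s hs]
  · intro f g _ hf hg ihf ihg
    have hsec : ∀ x, ∫⁻ y, (f + g) (BP.mk x y) ∂ν =
        ∫⁻ y, f (BP.mk x y) ∂ν + ∫⁻ y, g (BP.mk x y) ∂ν := fun x =>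
      lintegral_add_left (hf.comp (BP.measurable_mk_left x)) _
    simp_rw [hsec]
    refine ⟨ihf.1.add ihg.1, ?_⟩
    rw [lintegral_add_left' ihf.1, ← ihf.2, ← ihg.2]
    exact lintegral_add_left hf _
  · intro f hf hm ih
    have hsec : ∀ x, ∫⁻ y, ⨆ n, f n (BP.mk x y) ∂ν = ⨆ n, ∫⁻ y, f n (BP.mk x y) ∂ν := by
      intro x
      exact lintegral_iSup (fun n => (hf n).comp (BP.measurable_mk_left x))
        fun a b hab y => hm hab _
    simp_rw [hsec]
    refine ⟨AEMeasurable.iSup fun n => (ih n).1, ?_⟩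
    rw [lintegral_iSup' (fun n => (ih n).1)
      (Eventually.of_forall fun x a b hab => lintegral_mono fun y => hm hab _)]
    rw [lintegral_iSup hf hm]
    exact iSup_congr fun n => (ih n).2

theorem aemeasurable_lintegral (h : Tonelli μ ν ρ) {F : BP X Y → ℝ≥0∞} (hF : Measurable F) :
    AEMeasurable (fun x => ∫⁻ y, F (BP.mk x y) ∂ν) μ := (h.lintegral_aux hF).1

theorem lintegral_eq (h : Tonelli μ ν ρ) {F : BP X Y → ℝ≥0∞} (hF : Measurable F) :
    ∫⁻ p, F p ∂ρ = ∫⁻ x, ∫⁻ y, F (BP.mk x y) ∂ν ∂μ := (h.lintegral_aux hF).2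

/-- The inner integral is almost everywhere a difference of two lower Lebesgue integrals, to which
`lintegral_aux` applies; this is the source of its measurability in x. -/
theorem fubini_real_aux (h : Tonelli μ ν ρ) {F : BP X Y → ℝ} (hF : Integrable F ρ)
    (hm : Measurable F) :
    (∀ᵐ x ∂μ, Integrable (fun y => F (BP.mk x y)) ν) ∧
      Integrable (fun x => ∫ y, F (BP.mk x y) ∂ν) μ ∧
      ∫ p, F p ∂ρ = ∫ x, ∫ y, F (BP.mk x y) ∂ν ∂μ := by
  have hfin : ∫⁻ x, ∫⁻ y, ‖F (BP.mk x y)‖ₑ ∂ν ∂μ ≠ ∞ := by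
    rw [← h.lintegral_eq hm.enorm]
    exact hF.2.ne
  have hint : ∀ᵐ x ∂μ, Integrable (fun y => F (BP.mk x y)) ν := by
    filter_upwards [ae_lt_top' (h.aemeasurable_lintegral hm.enorm) hfin] with x hx
    exact ⟨(hm.comp (BP.measurable_mk_left x)).aestronglyMeasurable, hx⟩
  have hpos : Measurable fun p => ENNReal.ofReal (F p) := hm.ennreal_ofReal
  have hneg : Measurable fun p => ENNReal.ofReal (-F p) := hm.neg.ennreal_ofReal
  have ha := h.aemeasurable_lintegral hpos
  have hb := h.aemeasurable_lintegral hneg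
  have hle1 : ∀ x, ∫⁻ y, ENNReal.ofReal (F (BP.mk x y)) ∂ν ≤ ∫⁻ y, ‖F (BP.mk x y)‖ₑ ∂ν :=
    fun x => lintegral_mono fun y => Real.ofReal_le_enorm _
  have hle2 : ∀ x, ∫⁻ y, ENNReal.ofReal (-F (BP.mk x y)) ∂ν ≤ ∫⁻ y, ‖F (BP.mk x y)‖ₑ ∂ν :=
    fun x => lintegral_mono fun y => by
      rw [← enorm_neg]; exact Real.ofReal_le_enorm _
  have ha' : ∫⁻ x, ∫⁻ y, ENNReal.ofReal (F (BP.mk x y)) ∂ν ∂μ ≠ ∞ :=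
    ne_top_of_le_ne_top hfin (lintegral_mono hle1)
  have hb' : ∫⁻ x, ∫⁻ y, ENNReal.ofReal (-F (BP.mk x y)) ∂ν ∂μ ≠ ∞ :=
    ne_top_of_le_ne_top hfin (lintegral_mono hle2)
  have heq : (fun x => ∫ y, F (BP.mk x y) ∂ν) =ᵐ[μ] fun x =>
      (∫⁻ y, ENNReal.ofReal (F (BP.mk x y)) ∂ν).toReal -
        (∫⁻ y, ENNReal.ofReal (-F (BP.mk x y)) ∂ν).toReal := by
    filter_upwards [hint] with x hx
    exact integral_eq_lintegral_pos_part_sub_lintegral_neg_part hx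
  have ia := integrable_toReal_of_lintegral_ne_top ha ha'
  have ib := integrable_toReal_of_lintegral_ne_top hb hb'
  refine ⟨hint, (ia.sub ib).congr heq.symm, ?_⟩
  rw [integral_congr_ae heq, integral_sub ia ib,
    integral_toReal ha (ae_lt_top' ha ha'), integral_toReal hb (ae_lt_top' hb hb'),
    integral_eq_lintegral_pos_part_sub_lintegral_neg_part hF, h.lintegral_eq hpos,
    h.lintegral_eq hneg]

theorem fubini_aux (h : Tonelli μ ν ρ) {F : BP X Y → ℂ} (hF : Integrable F ρ)
    (hm : Measurable F) :
    (∀ᵐ x ∂μ, Integrable (fun y => F (BP.mk x y)) ν) ∧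
      Integrable (fun x => ∫ y, F (BP.mk x y) ∂ν) μ ∧
      ∫ p, F p ∂ρ = ∫ x, ∫ y, F (BP.mk x y) ∂ν ∂μ := by
  obtain ⟨r1, r2, r3⟩ := h.fubini_real_aux hF.re (Complex.measurable_re.comp hm)
  obtain ⟨i1, i2, i3⟩ := h.fubini_real_aux hF.im (Complex.measurable_im.comp hm)
  have hint : ∀ᵐ x ∂μ, Integrable (fun y => F (BP.mk x y)) ν := by
    filter_upwards [r1, i1] with x h1 h2
    exact Integrable.re_im_iff.1 ⟨h1, h2⟩
  have heq : (fun x => ∫ y, F (BP.mk x y) ∂ν) =ᵐ[μ] fun x =>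
      ((∫ y, RCLike.re (F (BP.mk x y)) ∂ν : ℝ) : ℂ) +
        ((∫ y, RCLike.im (F (BP.mk x y)) ∂ν : ℝ) : ℂ) * Complex.I := by
    filter_upwards [hint] with x hx
    exact (integral_re_add_im hx).symm
  refine ⟨hint, (r2.ofReal.add (i2.ofReal.mul_const _)).congr heq.symm, ?_⟩
  rw [integral_congr_ae heq, integral_add r2.ofReal (i2.ofReal.mul_const _), integral_mul_const,
    integral_complex_ofReal, integral_complex_ofReal, ← r3, ← i3]
  exact (integral_re_add_im hF).symm

theorem fubini (h : Tonelli μ ν ρ) {F : BP X Y → ℂ} (hF : Integrable F ρ) :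
    (∀ᵐ x ∂μ, Integrable (fun y => F (BP.mk x y)) ν) ∧
      Integrable (fun x => ∫ y, F (BP.mk x y) ∂ν) μ ∧
      ∫ p, F p ∂ρ = ∫ x, ∫ y, F (BP.mk x y) ∂ν ∂μ := by
  obtain ⟨F', hF'm, hFF'⟩ := hF.1
  obtain ⟨h1, h2, h3⟩ := h.fubini_aux (hF.congr hFF') hF'm.measurable
  have hs := h.ae hFF'
  have heq : (fun x => ∫ y, F (BP.mk x y) ∂ν) =ᵐ[μ] fun x => ∫ y, F' (BP.mk x y) ∂ν := by
    filter_upwards [hs] with x hx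
    exact integral_congr_ae hx
  refine ⟨?_, h2.congr heq.symm, ?_⟩
  · filter_upwards [h1, hs] with x hx1 hx2
    exact hx1.congr (EventuallyEq.symm hx2)
  · rw [integral_congr_ae hFF', integral_congr_ae heq, h3]

theorem integrable_integral (h : Tonelli μ ν ρ) {F : BP X Y → ℂ} (hF : Integrable F ρ) :
    Integrable (fun x => ∫ y, F (BP.mk x y) ∂ν) μ := (h.fubini hF).2.1

theorem integral_eq (h : Tonelli μ ν ρ) {F : BP X Y → ℂ} (hF : Integrable F ρ) :
    ∫ p, F p ∂ρ = ∫ x, ∫ y, F (BP.mk x y) ∂ν ∂μ := (h.fubini hF).2.2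

theorem lintegral_mul (h : Tonelli μ ν ρ) {f : X → ℝ≥0∞} {g : Y → ℝ≥0∞}
    (hf : Measurable f) (hg : Measurable g) :
    ∫⁻ p, f p.1 * g p.2 ∂ρ = (∫⁻ x, f x ∂μ) * ∫⁻ y, g y ∂ν := by
  rw [h.lintegral_eq (F := fun p => f p.1 * g p.2)
    ((hf.comp BP.measurable_fst).mul (hg.comp BP.measurable_snd))]
  simp only [BP.mk_fst, BP.mk_snd]
  simp_rw [lintegral_const_mul _ hg]
  exact lintegral_mul_const _ hf

/-- Almost everywhere strong measurability of the sections of an almost everywhere strongly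
measurable function. -/
theorem aestronglyMeasurable_section (h : Tonelli μ ν ρ) {F : BP X Y → ℂ}
    (hF : AEStronglyMeasurable F ρ) :
    ∀ᵐ x ∂μ, AEStronglyMeasurable (fun y => F (BP.mk x y)) ν := by
  obtain ⟨F', hF'm, hFF'⟩ := hF
  filter_upwards [h.ae hFF'] with x hx
  exact ⟨_, (hF'm.measurable.comp (BP.measurable_mk_left x)).stronglyMeasurable, hx⟩

end Tonelli

/-! ### Functions with vanishing integrals over a basis of the topology. -/

section Uniqueness

variable {Z : Type*} [TopologicalSpace Z] [MeasurableSpace Z] [BorelSpace Z] {ρ : Measure Z}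

/-- Inclusion-exclusion by induction on the number of sets. The new set meets the old union in the
union of the `B a ∩ B i`, again members of `𝓑`; the induction hypothesis is thus used for another
family, which is why `B` is quantified last. -/
theorem setIntegral_biUnion_eq_zero {𝓑 : Set (Set Z)} (hopen : ∀ B ∈ 𝓑, IsOpen B)
    (hinter : ∀ A ∈ 𝓑, ∀ B ∈ 𝓑, A ∩ B ∈ 𝓑) {γ : Z → ℂ}
    (hint : ∀ B ∈ 𝓑, IntegrableOn γ B ρ) (h0 : ∀ B ∈ 𝓑, ∫ z in B, γ z ∂ρ = 0)
    {ι : Type*} (t : Finset ι) : ∀ (B : ι → Set Z), (∀ i ∈ t, B i ∈ 𝓑) →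
      ∫ z in ⋃ i ∈ t, B i, γ z ∂ρ = 0 := by
  classical
  induction t using Finset.induction_on with
  | empty => simp
  | insert a t _ ih =>
    intro B hB
    have hBt : ∀ i ∈ t, B i ∈ 𝓑 := fun i hi => hB i (Finset.mem_insert_of_mem hi)
    have hBa : B a ∈ 𝓑 := hB a (Finset.mem_insert_self a t)
    have hRm : MeasurableSet (⋃ i ∈ t, B i) :=
      t.measurableSet_biUnion fun i hi => (hopen _ (hBt i hi)).measurableSet
    have hRint : IntegrableOn γ (⋃ i ∈ t, B i) ρ :=
      integrableOn_finset_iUnion.2 fun i hi => hint _ (hBt i hi)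
    have h1 : ∫ z in B a ∩ ⋃ i ∈ t, B i, γ z ∂ρ = 0 := by
      rw [Set.inter_iUnion₂]
      exact ih (fun i => B a ∩ B i) fun i hi => hinter _ hBa _ (hBt i hi)
    have h2 := integral_inter_add_sdiff (s := B a) hRm (hint _ hBa)
    rw [h1, h0 _ hBa, zero_add] at h2
    rw [Finset.set_biUnion_insert, Set.union_comm, ← Set.union_sdiff_self,
      setIntegral_union Set.disjoint_sdiff_right ((hopen _ hBa).measurableSet.diff hRm) hRint
        ((hint _ hBa).mono_set Set.sdiff_subset), h2, ih B hBt, add_zero]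

/-- A locally integrable function whose integrals over the members of an intersection stable basis
of the topology vanish is locally almost everywhere zero. -/
theorem ae_eq_zero_of_forall_basis [T2Space Z] [LocallyCompactSpace Z] [ρ.Regular]
    {𝓑 : Set (Set Z)} (hbasis : TopologicalSpace.IsTopologicalBasis 𝓑)
    (hinter : ∀ A ∈ 𝓑, ∀ B ∈ 𝓑, A ∩ B ∈ 𝓑) {γ : Z → ℂ}
    (hint : ∀ B ∈ 𝓑, IntegrableOn γ B ρ) (h0 : ∀ B ∈ 𝓑, ∫ z in B, γ z ∂ρ = 0) :
    ∀ᶠ z in locAE ρ, γ z = 0 := by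
  have hopen : ∀ B ∈ 𝓑, IsOpen B := fun B hB => hbasis.isOpen hB
  have hcover : ∀ C U : Set Z, IsCompact C → IsOpen U → C ⊆ U →
      ∃ (t : Finset Z) (B : Z → Set Z), (∀ i ∈ t, B i ∈ 𝓑) ∧ (C ⊆ ⋃ i ∈ t, B i) ∧
        ⋃ i ∈ t, B i ⊆ U := by
    intro C U hC hU hCU
    have hx : ∀ x : Z, ∃ B : Set Z, x ∈ C → B ∈ 𝓑 ∧ x ∈ B ∧ B ⊆ U := by
      intro x
      by_cases hx : x ∈ C
      · obtain ⟨B, hB, hxB, hBU⟩ := hbasis.exists_subset_of_mem_open (hCU hx) hU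
        exact ⟨B, fun _ => ⟨hB, hxB, hBU⟩⟩
      · exact ⟨∅, fun h => absurd h hx⟩
    choose B hB using hx
    obtain ⟨t, ht, hCt⟩ := hC.elim_nhds_subcover B
      fun x hx => (hopen _ (hB x hx).1).mem_nhds (hB x hx).2.1
    exact ⟨t, B, fun i hi => (hB i (ht i hi)).1, hCt,
      Set.iUnion₂_subset fun i hi => (hB i (ht i hi)).2.2⟩
  -- Outer regularity gives an open `U ⊇ C` of almost the same measure, and a finite union `R` of
  -- basis sets fits between `C` and `U`. The integral over `R` is zero, and that over `R \ C` is
  -- small by absolute continuity of the integral, inside a fixed `R0` where γ is integrable.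
  have hcomp : ∀ C : Set Z, IsCompact C → IntegrableOn γ C ρ ∧ ∫ z in C, γ z ∂ρ = 0 := by
    intro C hC
    obtain ⟨t0, B0, hB0, hC0, -⟩ := hcover C Set.univ hC isOpen_univ (Set.subset_univ _)
    set R0 := ⋃ i ∈ t0, B0 i with hR0
    have hR0o : IsOpen R0 := isOpen_biUnion fun i hi => hopen _ (hB0 i hi)
    have hR0int : IntegrableOn γ R0 ρ :=
      integrableOn_finset_iUnion.2 fun i hi => hint _ (hB0 i hi)
    refine ⟨hR0int.mono_set hC0, ?_⟩
    rw [← norm_le_zero_iff]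
    refine le_of_forall_pos_le_add fun ε hε => ?_
    obtain ⟨δ, hδ, hδ'⟩ := exists_pos_setLIntegral_lt_of_measure_lt
      (μ := ρ.restrict R0) (f := fun z => ‖γ z‖ₑ) hR0int.2.ne
      (ε := ENNReal.ofReal ε) (by simpa using hε)
    obtain ⟨U, hCU, hUo, hU⟩ := hC.exists_isOpen_lt_add (μ := ρ) hδ.ne'
    obtain ⟨t, B, hB, hCR, hRU⟩ := hcover C (U ∩ R0) hC (hUo.inter hR0o)
      (Set.subset_inter hCU hC0)
    set R := ⋃ i ∈ t, B i with hR
    have hRm : MeasurableSet R := (isOpen_biUnion fun i hi => hopen _ (hB i hi)).measurableSet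
    have hCm := hC.measurableSet
    have hR0' : ∫ z in R, γ z ∂ρ = 0 := setIntegral_biUnion_eq_zero hopen hinter hint h0 t B hB
    have hRint : IntegrableOn γ R ρ := hR0int.mono_set (hRU.trans Set.inter_subset_right)
    have hsplit := integral_inter_add_sdiff (s := R) hCm hRint
    rw [Set.inter_eq_self_of_subset_right hCR, hR0'] at hsplit
    rw [eq_neg_of_add_eq_zero_left hsplit, norm_neg, zero_add]
    refine (norm_integral_le_lintegral_norm _).trans ?_
    refine ENNReal.toReal_le_of_le_ofReal hε.le ?_
    have hsmall : ρ.restrict R0 (R \ C) < δ := by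
      refine (Measure.restrict_apply_le _ _).trans_lt ?_
      refine (measure_mono (Set.sdiff_subset_sdiff_left (hRU.trans Set.inter_subset_left))).trans_lt ?_
      rw [measure_sdiff hCU hCm.nullMeasurableSet hC.measure_ne_top]
      exact ENNReal.sub_lt_of_lt_add (measure_mono hCU) (by rwa [add_comm])
    have hlt := (hδ' _ hsmall).le
    rw [Measure.restrict_restrict (hRm.diff hCm), Set.inter_eq_self_of_subset_left
      (Set.sdiff_subset.trans (hRU.trans Set.inter_subset_right))] at hlt
    simpa only [ofReal_norm] using hlt
  refine eventually_locAE.2 fun K hK => ?_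
  refine ae_eq_zero_of_forall_setIntegral_isClosed_eq_zero (hcomp K hK).1 fun s hs => ?_
  rw [Measure.restrict_restrict hs.measurableSet]
  exact (hcomp _ (hK.inter_left hs)).2

end Uniqueness

/-! ### Weak limits of uniformly bounded functions. -/

section WeakLimit

variable {Z : Type*} [MeasurableSpace Z] {ρ : Measure Z} [IsFiniteMeasure ρ]

/-- For each scalar c the hypothesis gives Re (c f) ≤ ‖c‖ C almost everywhere. A countable dense set
of scalars has a common null set, continuity extends the bound to all c, and c = conj (f z) gives
the norm. Where f vanishes, c = 1 shows C ≥ 0. -/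
theorem ae_norm_le_of_forall_setIntegral_le {f : Z → ℂ} (hf : Integrable f ρ) {C : ℝ}
    (h : ∀ E, MeasurableSet E → ‖∫ z in E, f z ∂ρ‖ ≤ C * ρ.real E) :
    ∀ᵐ z ∂ρ, ‖f z‖ ≤ C := by
  have hc : ∀ c : ℂ, ∀ᵐ z ∂ρ, (c * f z).re ≤ ‖c‖ * C := by
    intro c
    refine ae_le_of_forall_setIntegral_le (hf.const_mul c).re (integrable_const _)
      fun E hE _ => ?_
    have h1 : ∫ z in E, (c * f z).re ∂ρ = (c * ∫ z in E, f z ∂ρ).re := by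
      rw [← integral_const_mul]
      exact integral_re (hf.const_mul c).integrableOn
    rw [setIntegral_const, smul_eq_mul]
    refine h1.le.trans ((Complex.re_le_norm _).trans ?_)
    rw [norm_mul]
    calc ‖c‖ * ‖∫ z in E, f z ∂ρ‖ ≤ ‖c‖ * (C * ρ.real E) :=
          mul_le_mul_of_nonneg_left (h E hE) (norm_nonneg c)
      _ = ρ.real E * (‖c‖ * C) := by ring
  filter_upwards [ae_all_iff.2 fun n => hc (TopologicalSpace.denseSeq ℂ n)] with z hz
  have hall : ∀ c : ℂ, (c * f z).re ≤ ‖c‖ * C := by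
    have hclosed : IsClosed {c : ℂ | (c * f z).re ≤ ‖c‖ * C} :=
      isClosed_le (by fun_prop) (by fun_prop)
    intro c
    have hsub : Set.range (TopologicalSpace.denseSeq ℂ) ⊆ {c : ℂ | (c * f z).re ≤ ‖c‖ * C} := by
      rintro _ ⟨n, rfl⟩
      exact hz n
    exact hclosed.closure_subset_iff.2 hsub (TopologicalSpace.denseRange_denseSeq ℂ c)
  have h1 := hall (starRingEnd ℂ (f z))
  rw [← Complex.normSq_eq_conj_mul_self, Complex.ofReal_re, Complex.normSq_eq_norm_sq,
    RCLike.norm_conj, sq] at h1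
  rcases (norm_nonneg (f z)).eq_or_lt with h0 | h0
  · have h2 := hall 1
    rw [norm_eq_zero.1 h0.symm] at h2 ⊢
    simpa using h2
  · exact le_of_mul_le_mul_left h1 h0

/-- Uniformly bounded functions on a finite measure space have a weak limit along any filter. -/
theorem exists_weak_limit {ι : Type*} (l : Filter ι) [l.NeBot] {a : ι → Z → ℂ} {C : ℝ}
    (hC : 0 ≤ C) (ha : ∀ i, Measurable (a i)) (hb : ∀ i z, ‖a i z‖ ≤ C) :
    ∃ α : Z → ℂ, Measurable α ∧ (∀ z, ‖α z‖ ≤ C) ∧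
      ∀ E, MeasurableSet E → ∀ c, Tendsto (fun i => ∫ z in E, a i z ∂ρ) l (𝓝 c) →
        ∫ z in E, α z ∂ρ = c := by
  have hmem : ∀ i, MemLp (a i) 2 ρ := fun i =>
    MemLp.of_bound (ha i).aestronglyMeasurable C (Eventually.of_forall (hb i))
  let v : ι → Lp ℂ 2 ρ := fun i => (hmem i).toLp
  have hvle : ∀ i, ‖v i‖ ≤ (ρ.real Set.univ) ^ ((2 : ℝ≥0∞).toReal)⁻¹ * C := by
    intro i
    refine Lp.norm_le_of_ae_bound hC ?_
    filter_upwards [(hmem i).coeFn_toLp] with z hz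
    rw [hz]
    exact hb i z
  -- As ρ is finite, the functions lie in a ball of L². Banach-Alaoglu gives a limit along an
  -- ultrafilter finer than `l`, and the Riesz representation turns it into a function.
  let Φ : ι → WeakDual ℂ (Lp ℂ 2 ρ) := fun i => StrongDual.toWeakDual (innerSL ℂ (v i))
  let U : Ultrafilter ι := Ultrafilter.of l
  set M := (ρ.real Set.univ) ^ ((2 : ℝ≥0∞).toReal)⁻¹ * C with hM
  obtain ⟨Ψ, -, hΨ⟩ := (WeakDual.isCompact_closedBall (0 : StrongDual ℂ (Lp ℂ 2 ρ)) M).ultrafilter_le_nhds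
    (U.map Φ) (by
      refine le_principal_iff.2 (Eventually.of_forall (f := (U : Filter ι)) fun i => ?_)
      simp only [Set.mem_preimage, mem_closedBall_zero_iff]
      refine le_trans ?_ (hvle i)
      exact (innerSL_apply_norm (𝕜 := ℂ) (v i)).le)
  have hlim : ∀ F : Lp ℂ 2 ρ, Tendsto (fun i => inner ℂ (v i) F) U (𝓝 (Ψ F)) := fun F =>
    ((WeakDual.eval_continuous F).tendsto Ψ).comp (show Tendsto Φ U (𝓝 Ψ) from hΨ)
  let w : Lp ℂ 2 ρ := (InnerProductSpace.toDual ℂ (Lp ℂ 2 ρ)).symm (WeakDual.toStrongDual Ψ)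
  have hw : ∀ F : Lp ℂ 2 ρ, inner ℂ w F = Ψ F := fun F =>
    InnerProductSpace.toDual_symm_apply
  have hE : ∀ E, MeasurableSet E →
      Tendsto (fun i => ∫ z in E, a i z ∂ρ) U (𝓝 (∫ z in E, w z ∂ρ)) := by
    intro E hE
    have h1 := hlim (indicatorConstLp 2 hE (measure_ne_top ρ E) (1 : ℂ))
    rw [← hw] at h1
    -- The inner product is conjugate linear on the left; conjugation turns its value at an
    -- indicator function into the integral of `a i`.
    have h2 := (Complex.continuous_conj.tendsto _).comp h1
    simp only [Function.comp_def, inner_conj_symm, L2.inner_indicatorConstLp_one] at h2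
    refine h2.congr fun i => ?_
    exact setIntegral_congr_ae hE ((hmem i).coeFn_toLp.mono fun z hz _ => hz)
  have hwint : Integrable w ρ := (Lp.memLp w).integrable (by norm_num)
  have hwC : ∀ᵐ z ∂ρ, ‖w z‖ ≤ C := by
    refine ae_norm_le_of_forall_setIntegral_le hwint fun E hEm => ?_
    refine le_of_tendsto (hE E hEm).norm (Eventually.of_forall fun i => ?_)
    exact norm_setIntegral_le_of_norm_le_const (measure_lt_top ρ E) fun z _ => hb i z
  have hwm : Measurable w := (Lp.stronglyMeasurable w).measurable
  have hset : MeasurableSet {z | ‖w z‖ ≤ C} := measurableSet_le hwm.norm measurable_const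
  -- Truncation replaces the almost everywhere bound by one that holds everywhere.
  refine ⟨{z | ‖w z‖ ≤ C}.indicator w, hwm.indicator hset, fun z => ?_, fun E hEm c hc => ?_⟩
  · by_cases hz : ‖w z‖ ≤ C
    · rwa [Set.indicator_of_mem (by exact hz)]
    · rw [Set.indicator_of_notMem (by exact hz), norm_zero]; exact hC
  · have h1 : ∫ z in E, {z | ‖w z‖ ≤ C}.indicator w z ∂ρ = ∫ z in E, w z ∂ρ := by
      refine setIntegral_congr_ae hEm ?_
      filter_upwards [hwC] with z hz _
      exact Set.indicator_of_mem (by exact hz) _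
    rw [h1]
    exact tendsto_nhds_unique (hE E hEm) (hc.mono_left (Ultrafilter.of_le l))

end WeakLimit

/-! ### Densities of dominated bimeasures. -/

section Bimeasure

set_option linter.unusedSectionVars false

variable {X : Type*} [MeasurableSpace X]

/-- The atom of the finite family `s` of sets on which exactly the members in `c` hold. -/
def atomOf (s c : Finset (Set X)) : Set X := {x | ∀ A ∈ s, x ∈ A ↔ A ∈ c}

theorem measurableSet_atomOf {s : Finset (Set X)} (hs : ∀ A ∈ s, MeasurableSet A)
    (c : Finset (Set X)) : MeasurableSet (atomOf s c) := by
  classical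
  have : atomOf s c = ⋂ A ∈ s, if A ∈ c then A else Aᶜ := by
    ext x
    simp only [atomOf, Set.mem_ofPred_eq, Set.mem_iInter]
    refine forall₂_congr fun A _ => ?_
    by_cases h : A ∈ c <;> simp [h]
  rw [this]
  refine s.measurableSet_biInter fun A hA => ?_
  split_ifs
  · exact hs A hA
  · exact (hs A hA).compl

theorem disjoint_atomOf {s c d : Finset (Set X)} (hc : c ⊆ s) (hd : d ⊆ s) (hcd : c ≠ d) :
    Disjoint (atomOf s c) (atomOf s d) := by
  refine Set.disjoint_left.2 fun x h1 h2 => hcd ?_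
  ext A
  by_cases hA : A ∈ s
  · exact (h1 A hA).symm.trans (h2 A hA)
  · exact ⟨fun h => absurd (hc h) hA, fun h => absurd (hd h) hA⟩

open Classical in
theorem eq_biUnion_atomOf {s : Finset (Set X)} {A : Set X} (hA : A ∈ s) :
    A = ⋃ c ∈ s.powerset.filter (A ∈ ·), atomOf s c := by
  ext x
  simp only [Set.mem_iUnion, Finset.mem_filter, Finset.mem_powerset, exists_prop]
  constructor
  · intro hx
    refine ⟨s.filter (x ∈ ·), ⟨Finset.filter_subset _ _, by simp [hA, hx]⟩, fun B hB => ?_⟩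
    simp [hB]
  · rintro ⟨c, ⟨-, hAc⟩, hx⟩
    exact (hx A hA).2 hAc

theorem finitelyAdditive_biUnion {m : Set X → ℂ}
    (hm : ∀ A B, MeasurableSet A → MeasurableSet B → Disjoint A B → m (A ∪ B) = m A + m B)
    {ι : Type*} (t : Finset ι) {f : ι → Set X} (hf : ∀ i ∈ t, MeasurableSet (f i))
    (hd : ∀ i ∈ t, ∀ j ∈ t, i ≠ j → Disjoint (f i) (f j)) :
    m (⋃ i ∈ t, f i) = ∑ i ∈ t, m (f i) := by
  classical
  induction t using Finset.induction_on with
  | empty =>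
    have h := hm ∅ ∅ MeasurableSet.empty MeasurableSet.empty (Set.disjoint_empty _)
    rw [Set.union_empty] at h
    simpa using h
  | insert a t ha ih =>
    rw [Finset.set_biUnion_insert, Finset.sum_insert ha, hm,
      ih (fun i hi => hf i (Finset.mem_insert_of_mem hi))
        fun i hi j hj => hd i (Finset.mem_insert_of_mem hi) j (Finset.mem_insert_of_mem hj)]
    · exact hf a (Finset.mem_insert_self a t)
    · exact t.measurableSet_biUnion fun i hi => hf i (Finset.mem_insert_of_mem hi)
    · refine Set.disjoint_iUnion₂_right.2 fun i hi => ?_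
      exact hd a (Finset.mem_insert_self a t) i (Finset.mem_insert_of_mem hi)
        fun h => ha (h ▸ hi)

open Classical in
theorem atomOf_inter {s c : Finset (Set X)} {A : Set X} (hA : A ∈ s) :
    A ∩ atomOf s c = if A ∈ c then atomOf s c else ∅ := by
  split_ifs with h
  · exact Set.inter_eq_self_of_subset_right fun x hx => (hx A hA).2 h
  · exact Set.eq_empty_of_forall_notMem fun x hx => h ((hx.2 A hA).1 hx.1)

variable {Y Z : Type*} [MeasurableSpace Y] [MeasurableSpace Z] {μ : Measure X} {ν : Measure Y}
  {ρ : Measure Z} [IsFiniteMeasure μ] [IsFiniteMeasure ν] [IsFiniteMeasure ρ]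
  {p : Z → X} {q : Z → Y} {b : Set X → Set Y → ℂ} {C : ℝ}

/-- The step function with the averages of a bimeasure on the atoms of two finite families. -/
noncomputable def stepAverage (μ : Measure X) (ν : Measure Y) (p : Z → X) (q : Z → Y)
    (b : Set X → Set Y → ℂ) (s : Finset (Set X)) (t : Finset (Set Y)) (z : Z) : ℂ :=
  ∑ i ∈ s.powerset ×ˢ t.powerset, (p ⁻¹' atomOf s i.1 ∩ q ⁻¹' atomOf t i.2).indicator
    (fun _ => b (atomOf s i.1) (atomOf t i.2) /
      ((μ.real (atomOf s i.1) * ν.real (atomOf t i.2) : ℝ) : ℂ)) z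

theorem measurable_stepAverage (hp : Measurable p) (hq : Measurable q)
    {s : Finset (Set X)} {t : Finset (Set Y)} (hs : ∀ A ∈ s, MeasurableSet A)
    (ht : ∀ B ∈ t, MeasurableSet B) : Measurable (stepAverage μ ν p q b s t) :=
  Finset.measurable_fun_sum _ fun i _ => measurable_const.indicator
    ((hp (measurableSet_atomOf hs i.1)).inter (hq (measurableSet_atomOf ht i.2)))

/-- Only one summand survives at z: the atoms indexed by those members of `s` and `t` that contain
`p z` and `q z`. Null atoms do no harm, since division by zero gives zero. -/
theorem norm_stepAverage_le (hC : 0 ≤ C)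
    (hb : ∀ A B, MeasurableSet A → MeasurableSet B → ‖b A B‖ ≤ C * (μ.real A * ν.real B))
    {s : Finset (Set X)} {t : Finset (Set Y)} (hs : ∀ A ∈ s, MeasurableSet A)
    (ht : ∀ B ∈ t, MeasurableSet B) (z : Z) : ‖stepAverage μ ν p q b s t z‖ ≤ C := by
  classical
  rw [stepAverage, Finset.sum_eq_single (s.filter (p z ∈ ·), t.filter (q z ∈ ·))]
  · refine (norm_indicator_le_norm_self _ _).trans ?_
    have hnn : 0 ≤ μ.real (atomOf s (s.filter (p z ∈ ·))) * ν.real (atomOf t (t.filter (q z ∈ ·))) :=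
      by positivity
    rw [norm_div, Complex.norm_real, Real.norm_of_nonneg hnn]
    exact div_le_of_le_mul₀ hnn hC (hb _ _ (measurableSet_atomOf hs _) (measurableSet_atomOf ht _))
  · rintro ⟨c, d⟩ hcd hne
    refine Set.indicator_of_notMem ?_ _
    rintro ⟨h1, h2⟩
    rw [Finset.mem_product, Finset.mem_powerset, Finset.mem_powerset] at hcd
    refine hne (Prod.ext ?_ ?_)
    · ext A
      simp only [Finset.mem_filter]
      exact ⟨fun h => ⟨hcd.1 h, (h1 A (hcd.1 h)).2 h⟩, fun h => (h1 A h.1).1 h.2⟩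
    · ext A
      simp only [Finset.mem_filter]
      exact ⟨fun h => ⟨hcd.2 h, (h2 A (hcd.2 h)).2 h⟩, fun h => (h2 A h.1).1 h.2⟩
  · intro h
    exact absurd (Finset.mem_product.2 ⟨Finset.mem_powerset.2 (Finset.filter_subset _ _),
      Finset.mem_powerset.2 (Finset.filter_subset _ _)⟩) h

/-- The normalisation makes the integral over a rectangle of atoms equal to `b` there. Members of
the two families are disjoint unions of atoms, so additivity in each variable gives the rest. -/
theorem setIntegral_stepAverage (hp : Measurable p) (hq : Measurable q)
    (hρ : ∀ A B, MeasurableSet A → MeasurableSet B → ρ (p ⁻¹' A ∩ q ⁻¹' B) = μ A * ν B)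
    (hadd₁ : ∀ A A' B, MeasurableSet A → MeasurableSet A' → MeasurableSet B → Disjoint A A' →
      b (A ∪ A') B = b A B + b A' B)
    (hadd₂ : ∀ A B B', MeasurableSet A → MeasurableSet B → MeasurableSet B' → Disjoint B B' →
      b A (B ∪ B') = b A B + b A B')
    (hb : ∀ A B, MeasurableSet A → MeasurableSet B → ‖b A B‖ ≤ C * (μ.real A * ν.real B))
    {s : Finset (Set X)} {t : Finset (Set Y)} (hs : ∀ A ∈ s, MeasurableSet A)
    (ht : ∀ B ∈ t, MeasurableSet B) {A : Set X} {B : Set Y} (hA : A ∈ s) (hB : B ∈ t) :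
    ∫ z in p ⁻¹' A ∩ q ⁻¹' B, stepAverage μ ν p q b s t z ∂ρ = b A B := by
  classical
  have hmi : ∀ i : Finset (Set X) × Finset (Set Y),
      MeasurableSet (p ⁻¹' atomOf s i.1 ∩ q ⁻¹' atomOf t i.2) := fun i =>
    (hp (measurableSet_atomOf hs i.1)).inter (hq (measurableSet_atomOf ht i.2))
  -- On a null rectangle the quotient is zero by convention, and the domination forces `b` to vanish
  -- as well.
  have hkey : ∀ c d, b (atomOf s c) (atomOf t d) /
      ((μ.real (atomOf s c) * ν.real (atomOf t d) : ℝ) : ℂ) *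
      ((μ.real (atomOf s c) * ν.real (atomOf t d) : ℝ) : ℂ) = b (atomOf s c) (atomOf t d) := by
    intro c d
    by_cases h0 : μ.real (atomOf s c) * ν.real (atomOf t d) = 0
    · have h1 := hb _ _ (measurableSet_atomOf hs c) (measurableSet_atomOf ht d)
      rw [h0, mul_zero, norm_le_zero_iff] at h1
      rw [h1]; simp
    · exact div_mul_cancel₀ _ (by exact_mod_cast h0)
  have hterm : ∀ i : Finset (Set X) × Finset (Set Y),
      ∫ z in p ⁻¹' A ∩ q ⁻¹' B, (p ⁻¹' atomOf s i.1 ∩ q ⁻¹' atomOf t i.2).indicator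
        (fun _ => b (atomOf s i.1) (atomOf t i.2) /
          ((μ.real (atomOf s i.1) * ν.real (atomOf t i.2) : ℝ) : ℂ)) z ∂ρ =
      if A ∈ i.1 ∧ B ∈ i.2 then b (atomOf s i.1) (atomOf t i.2) else 0 := by
    rintro ⟨c, d⟩
    have hset : p ⁻¹' A ∩ q ⁻¹' B ∩ (p ⁻¹' atomOf s c ∩ q ⁻¹' atomOf t d) =
        p ⁻¹' (A ∩ atomOf s c) ∩ q ⁻¹' (B ∩ atomOf t d) := by
      ext z; simp only [Set.mem_inter_iff, Set.mem_preimage]; tauto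
    rw [setIntegral_indicator (hmi _), setIntegral_const, hset, atomOf_inter hA, atomOf_inter hB]
    by_cases h1 : A ∈ c
    · by_cases h2 : B ∈ d
      · simp only [h1, h2, if_true, and_self]
        rw [measureReal_def, hρ _ _ (measurableSet_atomOf hs c) (measurableSet_atomOf ht d),
          ENNReal.toReal_mul, Complex.real_smul, mul_comm]
        exact hkey c d
      · simp [h2]
    · simp [h1]
  unfold stepAverage
  rw [integral_finsetSum]
  · simp_rw [hterm]
    rw [← Finset.sum_filter, Finset.filter_product (A ∈ ·) (B ∈ ·), Finset.sum_product]
    have hdisj₁ := fun (c : Finset (Set X)) (hc : c ∈ s.powerset.filter (A ∈ ·)) d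
        (hd : d ∈ s.powerset.filter (A ∈ ·)) (hcd : c ≠ d) =>
      disjoint_atomOf (Finset.mem_powerset.1 (Finset.mem_filter.1 hc).1)
        (Finset.mem_powerset.1 (Finset.mem_filter.1 hd).1) hcd
    have hdisj₂ := fun (c : Finset (Set Y)) (hc : c ∈ t.powerset.filter (B ∈ ·)) d
        (hd : d ∈ t.powerset.filter (B ∈ ·)) (hcd : c ≠ d) =>
      disjoint_atomOf (Finset.mem_powerset.1 (Finset.mem_filter.1 hc).1)
        (Finset.mem_powerset.1 (Finset.mem_filter.1 hd).1) hcd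
    calc _ = ∑ c ∈ s.powerset.filter (A ∈ ·), b (atomOf s c) B := by
          refine Finset.sum_congr rfl fun c _ => ?_
          conv_rhs => rw [eq_biUnion_atomOf hB]
          exact (finitelyAdditive_biUnion (m := b (atomOf s c))
            (fun B B' h h' hd => hadd₂ _ B B' (measurableSet_atomOf hs c) h h' hd) _
            (fun d _ => measurableSet_atomOf ht d) hdisj₂).symm
      _ = b A B := by
          conv_rhs => rw [eq_biUnion_atomOf hA]
          exact (finitelyAdditive_biUnion (m := fun A => b A B)
            (fun A A' h h' hd => hadd₁ A A' B h h' (ht B hB) hd) _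
            (fun c _ => measurableSet_atomOf hs c) hdisj₁).symm
  · exact fun i _ => (integrable_const _).indicator (hmi i)

/-- A bimeasure bounded by a multiple of the product measure has a bounded density. -/
theorem exists_density_of_bimeasure (hp : Measurable p) (hq : Measurable q)
    (hρ : ∀ A B, MeasurableSet A → MeasurableSet B → ρ (p ⁻¹' A ∩ q ⁻¹' B) = μ A * ν B)
    (hadd₁ : ∀ A A' B, MeasurableSet A → MeasurableSet A' → MeasurableSet B → Disjoint A A' →
      b (A ∪ A') B = b A B + b A' B)
    (hadd₂ : ∀ A B B', MeasurableSet A → MeasurableSet B → MeasurableSet B' → Disjoint B B' →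
      b A (B ∪ B') = b A B + b A B') (hC : 0 ≤ C)
    (hb : ∀ A B, MeasurableSet A → MeasurableSet B → ‖b A B‖ ≤ C * (μ.real A * ν.real B)) :
    ∃ α : Z → ℂ, Measurable α ∧ (∀ z, ‖α z‖ ≤ C) ∧
      ∀ A B, MeasurableSet A → MeasurableSet B → ∫ z in p ⁻¹' A ∩ q ⁻¹' B, α z ∂ρ = b A B := by
  classical
  let s : Finset {A : Set X // MeasurableSet A} × Finset {B : Set Y // MeasurableSet B} →
    Finset (Set X) := fun i => i.1.image Subtype.val
  let t : Finset {A : Set X // MeasurableSet A} × Finset {B : Set Y // MeasurableSet B} →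
    Finset (Set Y) := fun i => i.2.image Subtype.val
  have hs : ∀ i, ∀ A ∈ s i, MeasurableSet A := by
    intro i A hA
    obtain ⟨A', -, rfl⟩ := Finset.mem_image.1 hA
    exact A'.2
  have ht : ∀ i, ∀ B ∈ t i, MeasurableSet B := by
    intro i A hA
    obtain ⟨A', -, rfl⟩ := Finset.mem_image.1 hA
    exact A'.2
  obtain ⟨α, hαm, hαC, hα⟩ := exists_weak_limit (ρ := ρ) atTop hC
    (fun i => measurable_stepAverage (μ := μ) (ν := ν) (b := b) hp hq (hs i) (ht i))
    (fun i => norm_stepAverage_le hC hb (hs i) (ht i))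
  refine ⟨α, hαm, hαC, fun A B hA hB => hα _ ((hp hA).inter (hq hB)) _ ?_⟩
  -- Along pairs of finite families ordered by inclusion, the integral over A × B equals `b A B`
  -- from the moment that A and B belong to the families.
  refine tendsto_const_nhds.congr' ?_
  filter_upwards [eventually_ge_atTop
    (({⟨A, hA⟩}, {⟨B, hB⟩}) : Finset {A : Set X // MeasurableSet A} ×
      Finset {B : Set Y // MeasurableSet B})] with i hi
  refine (setIntegral_stepAverage hp hq hρ hadd₁ hadd₂ hb (hs i) (ht i) ?_ ?_).symm
  · exact Finset.mem_image.2 ⟨⟨A, hA⟩, Finset.singleton_subset_iff.1 hi.1, rfl⟩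
  · exact Finset.mem_image.2 ⟨⟨B, hB⟩, Finset.singleton_subset_iff.1 hi.2, rfl⟩

end Bimeasure

/-! ### Open σ-compact subgroups. -/

section SigmaCompact

theorem _root_.IsSigmaCompact.sigmaFiniteOpen {X : Type*} [TopologicalSpace X] [MeasurableSpace X]
    {μ : Measure X} [IsLocallyFiniteMeasure μ] {S : Set X}
    (hS : IsSigmaCompact S) (ho : IsOpen S) : SigmaFiniteOpen μ S := by
  obtain ⟨K, hK, hKS⟩ := hS
  have h : ∀ n, ∃ U : Set X, K n ⊆ U ∧ IsOpen U ∧ μ U < ∞ := fun n => by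
    obtain ⟨U, h1, h2, h3⟩ := (hK n).exists_open_superset_measure_lt_top μ
    exact ⟨U, h1, h2, h3⟩
  choose U hKU hU hμ using h
  refine ⟨Set.accumulate fun n => U n ∩ S, Set.monotone_accumulate, fun n => ?_, fun n => ?_, ?_⟩
  · exact isOpen_biUnion fun m _ => (hU m).inter ho
  · refine ne_of_lt ?_
    rw [Set.accumulate_def]
    exact measure_biUnion_lt_top (Set.finite_Iic n) fun m _ =>
      (measure_mono Set.inter_subset_left).trans_lt (hμ m)
  · rw [Set.iUnion_accumulate]
    refine Set.Subset.antisymm (Set.iUnion_subset fun n => Set.inter_subset_right) fun x hx => ?_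
    obtain ⟨n, hn⟩ := Set.mem_iUnion.1 (hKS ▸ hx)
    exact Set.mem_iUnion.2 ⟨n, hKU n hn, hx⟩

theorem _root_.IsSigmaCompact.union {X : Type*} [TopologicalSpace X] {S T : Set X}
    (hS : IsSigmaCompact S) (hT : IsSigmaCompact T) : IsSigmaCompact (S ∪ T) := by
  rw [Set.union_eq_iUnion]
  exact isSigmaCompact_iUnion _ fun b => by cases b <;> assumption

theorem _root_.IsSigmaCompact.rect {X Y : Type*} [TopologicalSpace X] [TopologicalSpace Y]
    {S : Set X} {T : Set Y} (hS : IsSigmaCompact S) (hT : IsSigmaCompact T) :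
    IsSigmaCompact (BP.rect S T) := by
  obtain ⟨K, hK, rfl⟩ := hS
  obtain ⟨L, hL, rfl⟩ := hT
  have : BP.rect (⋃ n, K n) (⋃ n, L n) = ⋃ i : ℕ × ℕ, BP.rect (K i.1) (L i.2) := by
    ext p
    simp [BP.rect]
  rw [this]
  exact isSigmaCompact_iUnion_of_isCompact _ fun i => BP.isCompact_rect (hK i.1) (hL i.2)

variable {G : Type*} [Group G] [TopologicalSpace G] [IsTopologicalGroup G]

/-- An open `σ`-compact subgroup. -/
structure OpenSigmaCompact (S : Subgroup G) : Prop where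
  isOpen : IsOpen (S : Set G)
  isSigmaCompact : IsSigmaCompact (S : Set G)

/-- The subgroup generated by `T` and a compact neighbourhood of 1, obtained by symmetrising and
then repeatedly multiplying the set by itself. Each stage is σ-compact; the neighbourhood makes the
union open. -/
theorem exists_openSigmaCompact [LocallyCompactSpace G] {T : Set G} (hT : IsSigmaCompact T) :
    ∃ S : Subgroup G, OpenSigmaCompact S ∧ T ⊆ S := by
  obtain ⟨K, hK, hK1⟩ := exists_compact_mem_nhds (1 : G)
  have hinv : ∀ A : Set G, IsSigmaCompact A → IsSigmaCompact (Inv.inv '' A) := fun A hA =>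
    hA.image continuous_inv
  have hmul : ∀ A : Set G, IsSigmaCompact A →
      IsSigmaCompact ((fun p : BP G G => p.1 * p.2) '' BP.rect A A) := fun A hA =>
    (hA.rect hA).image (continuous_mul (M := G))
  let A0 : Set G := (T ∪ K) ∪ Inv.inv '' (T ∪ K)
  have hA0 : IsSigmaCompact A0 := (hT.union hK.isSigmaCompact).union
    (hinv _ (hT.union hK.isSigmaCompact))
  have h1A0 : (1 : G) ∈ A0 := Or.inl (Or.inr (mem_of_mem_nhds hK1))
  have hiA0 : ∀ x ∈ A0, x⁻¹ ∈ A0 := by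
    rintro x (hx | ⟨y, hy, rfl⟩)
    · exact Or.inr ⟨x, hx, rfl⟩
    · exact Or.inl (by rwa [inv_inv])
  let A : ℕ → Set G := fun n => Nat.rec A0 (fun _ B => (fun p : BP G G => p.1 * p.2) '' BP.rect B B) n
  have hAs : ∀ n, A (n + 1) = (fun p : BP G G => p.1 * p.2) '' BP.rect (A n) (A n) := fun n => rfl
  have hAσ : ∀ n, IsSigmaCompact (A n) := by
    intro n
    induction n with
    | zero => exact hA0
    | succ n ih => rw [hAs]; exact hmul _ ih
  have hA1 : ∀ n, (1 : G) ∈ A n := by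
    intro n
    induction n with
    | zero => exact h1A0
    | succ n ih => rw [hAs]; exact ⟨BP.mk 1 1, ⟨ih, ih⟩, one_mul 1⟩
  have hAi : ∀ n, ∀ x ∈ A n, x⁻¹ ∈ A n := by
    intro n
    induction n with
    | zero => exact hiA0
    | succ n ih =>
      rw [hAs]
      rintro _ ⟨p, hp, rfl⟩
      exact ⟨BP.mk p.2⁻¹ p.1⁻¹, ⟨ih _ hp.2, ih _ hp.1⟩, (mul_inv_rev _ _).symm⟩
  have hAm : Monotone A := monotone_nat_of_le_succ fun n x hx => by
    rw [hAs]; exact ⟨BP.mk x 1, ⟨hx, hA1 n⟩, mul_one x⟩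
  let S : Subgroup G :=
    { carrier := ⋃ n, A n
      mul_mem' := by
        intro a b ha hb
        obtain ⟨m, hm⟩ := Set.mem_iUnion.1 ha
        obtain ⟨n, hn⟩ := Set.mem_iUnion.1 hb
        refine Set.mem_iUnion.2 ⟨max m n + 1, ?_⟩
        rw [hAs]
        exact ⟨BP.mk a b, ⟨hAm (le_max_left _ _) hm, hAm (le_max_right _ _) hn⟩, rfl⟩
      one_mem' := Set.mem_iUnion.2 ⟨0, hA1 0⟩
      inv_mem' := by
        intro a ha
        obtain ⟨m, hm⟩ := Set.mem_iUnion.1 ha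
        exact Set.mem_iUnion.2 ⟨m, hAi m a hm⟩ }
  have h0S : T ∪ K ⊆ (S : Set G) := fun x hx => Set.mem_iUnion.2 ⟨0, Or.inl hx⟩
  refine ⟨S, ⟨?_, isSigmaCompact_iUnion _ hAσ⟩, fun x hx => h0S (Or.inl hx)⟩
  exact S.isOpen_of_mem_nhds (g := 1) (mem_of_superset hK1 fun x hx => h0S (Or.inr hx))

theorem isSigmaCompact_fiber {S : Subgroup G} (hS : IsSigmaCompact (S : Set G)) (q : G ⧸ S) :
    IsSigmaCompact ((QuotientGroup.mk : G → G ⧸ S) ⁻¹' {q}) := by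
  obtain ⟨g, rfl⟩ := QuotientGroup.mk_surjective q
  have : (QuotientGroup.mk : G → G ⧸ S) ⁻¹' {(g : G ⧸ S)} = (fun x => g * x) '' (S : Set G) := by
    ext x
    simp only [Set.mem_preimage, Set.mem_singleton_iff, Set.mem_image, SetLike.mem_coe]
    rw [eq_comm, QuotientGroup.eq]
    exact ⟨fun h => ⟨_, h, mul_inv_cancel_left g x⟩, by rintro ⟨y, hy, rfl⟩; simpa using hy⟩
  rw [this]
  exact hS.image (continuous_const_mul g)

theorem isOpen_fiber {S : Subgroup G} (hS : IsOpen (S : Set G)) (q : G ⧸ S) :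
    IsOpen ((QuotientGroup.mk : G → G ⧸ S) ⁻¹' {q}) := by
  have := QuotientGroup.discreteTopology hS
  exact (isOpen_discrete {q}).preimage QuotientGroup.continuous_mk

variable [MeasurableSpace G] [BorelSpace G]

/-- An open set of finite Haar measure is contained in a `σ`-compact set. -/
theorem exists_isSigmaCompact_of_isOpen [LocallyCompactSpace G] (μ : Measure G) [μ.IsHaarMeasure]
    {U : Set G} (hU : IsOpen U) (hf : μ U ≠ ∞) : ∃ T, IsSigmaCompact T ∧ U ⊆ T := by
  obtain ⟨S, hS, -⟩ := exists_openSigmaCompact (isSigmaCompact_empty (X := G))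
  let As : G ⧸ S → Set G := fun q => (QuotientGroup.mk : G → G ⧸ S) ⁻¹' {q} ∩ U
  have hAo : ∀ q, IsOpen (As q) := fun q => (isOpen_fiber hS.isOpen q).inter hU
  have : IsFiniteMeasure (μ.restrict U) := isFiniteMeasure_restrict.2 hf
  -- A finite measure charges only countably many disjoint pieces, and nonempty open sets have
  -- positive Haar measure; so `U` meets only countably many cosets.
  have hc := Measure.countable_meas_pos_of_disjoint_iUnion (μ := μ.restrict U) (As := As)
    (fun q => (hAo q).measurableSet) (fun q q' hq => Set.disjoint_left.2 fun x h1 h2 =>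
      hq (h1.1.symm.trans h2.1))
  refine ⟨⋃ q ∈ {q | 0 < μ.restrict U (As q)}, (QuotientGroup.mk : G → G ⧸ S) ⁻¹' {q},
    isSigmaCompact_biUnion hc fun q _ => isSigmaCompact_fiber hS.isSigmaCompact q, fun x hx => ?_⟩
  refine Set.mem_iUnion₂.2 ⟨QuotientGroup.mk x, ?_, rfl⟩
  have h1 : x ∈ As (QuotientGroup.mk x) := ⟨rfl, hx⟩
  rw [Set.mem_ofPred_eq, Measure.restrict_apply (hAo _).measurableSet,
    Set.inter_eq_self_of_subset_left Set.inter_subset_right]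
  exact (hAo _).measure_pos μ ⟨x, h1⟩

/-- A set of finite Haar measure is contained in a `σ`-compact set. -/
theorem exists_isSigmaCompact_of_measure_ne_top [LocallyCompactSpace G] (μ : Measure G)
    [μ.IsHaarMeasure] [μ.Regular] {A : Set G} (hf : μ A ≠ ∞) : ∃ T, IsSigmaCompact T ∧ A ⊆ T := by
  obtain ⟨U, hAU, hU, hlt⟩ := A.exists_isOpen_lt_of_lt ∞ hf.lt_top
  obtain ⟨T, hT, hUT⟩ := exists_isSigmaCompact_of_isOpen μ hU hlt.ne
  exact ⟨T, hT, hAU.trans hUT⟩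

/-- The support is the union of the sets where f ≥ 1/(n + 1), which have finite measure by Markov's
inequality. -/
theorem exists_isSigmaCompact_of_lintegral_ne_top [LocallyCompactSpace G] (μ : Measure G)
    [μ.IsHaarMeasure] [μ.Regular] {f : G → ℝ≥0∞} (hf : Measurable f) (hfin : ∫⁻ x, f x ∂μ ≠ ∞) :
    ∃ T, IsSigmaCompact T ∧ ∀ x ∉ T, f x = 0 := by
  have hA : ∀ n : ℕ, μ {x | ((n : ℝ≥0∞) + 1)⁻¹ ≤ f x} ≠ ∞ := fun n => by
    refine ne_top_of_le_ne_top ?_ (meas_ge_le_lintegral_div hf.aemeasurable ?_ ?_)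
    · exact ENNReal.div_ne_top hfin (by simp)
    · simp
    · simp
  choose T hT hAT using fun n => exists_isSigmaCompact_of_measure_ne_top μ (hA n)
  refine ⟨⋃ n, T n, isSigmaCompact_iUnion _ hT, fun x hx => ?_⟩
  by_contra h0
  obtain ⟨n, hn⟩ := ENNReal.exists_inv_nat_lt h0
  refine hx (Set.mem_iUnion.2 ⟨n, hAT n ?_⟩)
  exact (ENNReal.inv_le_inv.2 le_self_add).trans hn.le

end SigmaCompact

namespace Tonelli

set_option linter.unusedSectionVars false

variable {X Y : Type*} [TopologicalSpace X] [TopologicalSpace Y]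
  [MeasurableSpace X] [BorelSpace X] [MeasurableSpace Y] [BorelSpace Y]
  {μ : Measure X} {ν : Measure Y} {ρ ρ' : Measure (BP X Y)}

theorem unique (h : Tonelli μ ν ρ) (h' : Tonelli μ ν ρ') : ρ = ρ' :=
  Measure.ext fun E hE => (h.measure_eq E hE).trans (h'.measure_eq E hE).symm

theorem lintegral_eq' (h : Tonelli μ ν ρ) {F : BP X Y → ℝ≥0∞} (hF : AEMeasurable F ρ) :
    ∫⁻ p, F p ∂ρ = ∫⁻ x, ∫⁻ y, F (BP.mk x y) ∂ν ∂μ := by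
  rw [lintegral_congr_ae hF.ae_eq_mk, h.lintegral_eq hF.measurable_mk]
  refine lintegral_congr_ae ?_
  filter_upwards [h.ae hF.ae_eq_mk] with x hx
  exact lintegral_congr_ae (EventuallyEq.symm hx)

theorem integrable_mul (h : Tonelli μ ν ρ) {f : X → ℂ} {g : Y → ℂ} (hf : Integrable f μ)
    (hg : Integrable g ν) : Integrable (fun p : BP X Y => f p.1 * g p.2) ρ := by
  have h1 := h.quasiMeasurePreserving_fst
  have h2 := h.quasiMeasurePreserving_snd
  have haem := (hf.1.comp_quasiMeasurePreserving h1).mul (hg.1.comp_quasiMeasurePreserving h2)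
  refine ⟨haem, ?_⟩
  rw [HasFiniteIntegral, h.lintegral_eq' (F := fun p => ‖f p.1 * g p.2‖ₑ) haem.enorm]
  simp only [BP.mk_fst, BP.mk_snd, enorm_mul]
  simp_rw [lintegral_const_mul'' _ hg.1.enorm]
  rw [lintegral_mul_const'' _ hf.1.enorm]
  exact ENNReal.mul_lt_top hf.2 hg.2

end Tonelli

/-! ### Shears and permutations of coordinates on S × S and S × S × S. -/

namespace BP

set_option linter.unusedSectionVars false

variable {G : Type*} [Group G] [TopologicalSpace G] [IsTopologicalGroup G]

/-- `(y, z) ↦ (y, yz)`. -/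
def shear (G : Type*) [Group G] (p : BP G G) : BP G G := mk p.1 (p.1 * p.2)

/-- `(y, z) ↦ (y, y⁻¹z)`. -/
def unshear (G : Type*) [Group G] (p : BP G G) : BP G G :=
  mk p.1 (p.1⁻¹ * p.2)

/-- `(x, (y, z)) ↦ (x, yz)`. -/
def mulSnd (G : Type*) [Group G] (p : BP G (BP G G)) : BP G G :=
  mk p.1 (p.2.1 * p.2.2)

/-- `(x, (y, z)) ↦ (y, (z, x))`. -/
def cyc {G : Type*} (p : BP G (BP G G)) : BP G (BP G G) :=
  mk p.2.1 (mk p.2.2 p.1)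

theorem continuous_shear : Continuous (shear G) :=
  continuous_mk continuous_fst (continuous_fst.mul continuous_snd)

theorem continuous_unshear : Continuous (unshear G) :=
  continuous_mk continuous_fst (continuous_fst.inv.mul continuous_snd)

theorem continuous_mulSnd : Continuous (mulSnd G) :=
  continuous_mk continuous_fst
    ((continuous_fst.comp continuous_snd).mul (continuous_snd.comp continuous_snd))

theorem continuous_cyc : Continuous (cyc (G := G)) :=
  continuous_mk (continuous_fst.comp continuous_snd)
    (continuous_mk (continuous_snd.comp continuous_snd) continuous_fst)

end BP

section Haar

set_option linter.unusedSectionVars false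

variable {G : Type*} [Group G] [TopologicalSpace G] [IsTopologicalGroup G]
  [LocallyCompactSpace G] [T2Space G] [MeasurableSpace G] [BorelSpace G]

/-- The Haar measure of `G × G`. -/
noncomputable def haarBP2 (μ : Measure G) [IsFiniteMeasureOnCompacts μ] : Measure (BP G G) :=
  haar2 μ

/-- The Haar measure of `G × G × G`. -/
noncomputable def haarBP3 (μ : Measure G) [IsFiniteMeasureOnCompacts μ] :
    Measure (BP G (BP G G)) :=
  haar3 μ

instance (μ : Measure G) [IsFiniteMeasureOnCompacts μ] : (haarBP2 μ).Regular :=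
  regular_radonProd μ μ

instance (μ : Measure G) [IsFiniteMeasureOnCompacts μ] : (haarBP3 μ).Regular :=
  regular_radonProd (Y := BP G G) μ (haarBP2 μ)

theorem isRadonProd_haarBP2 (μ : Measure G) [IsFiniteMeasureOnCompacts μ] :
    IsRadonProd μ μ (haarBP2 μ) := fun F hF hc =>
  integral_radonProd μ μ ⟨⟨F, hF⟩, hc⟩

theorem isRadonProd_haarBP3 (μ : Measure G) [IsFiniteMeasureOnCompacts μ] :
    IsRadonProd μ (haarBP2 μ) (haarBP3 μ) := fun F hF hc =>
  integral_radonProd (Y := BP G G) μ (haarBP2 μ) ⟨⟨F, hF⟩, hc⟩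

variable {μ : Measure G} [μ.IsHaarMeasure] [μ.Regular] {S : Subgroup G}

/-- The Haar measure of `G × G`, restricted to `S × S`. -/
noncomputable abbrev haarOn2 (μ : Measure G) [IsFiniteMeasureOnCompacts μ] (S : Subgroup G) :
    Measure (BP G G) :=
  (haarBP2 μ).restrict (BP.rect S S)

/-- The Haar measure of `G × G × G`, restricted to `S × S × S`. -/
noncomputable abbrev haarOn3 (μ : Measure G) [IsFiniteMeasureOnCompacts μ] (S : Subgroup G) :
    Measure (BP G (BP G G)) :=
  (haarBP3 μ).restrict (BP.rect S (BP.rect S S))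

namespace OpenSigmaCompact

theorem measurableSet (hS : OpenSigmaCompact S) : MeasurableSet (S : Set G) := hS.isOpen.measurableSet

theorem sigmaFiniteOpen (hS : OpenSigmaCompact S) : SigmaFiniteOpen μ (S : Set G) :=
  hS.isSigmaCompact.sigmaFiniteOpen hS.isOpen

theorem sigmaFiniteOpen2 (hS : OpenSigmaCompact S) :
    SigmaFiniteOpen (haarBP2 μ) (BP.rect (S : Set G) (S : Set G)) :=
  (hS.isSigmaCompact.rect hS.isSigmaCompact).sigmaFiniteOpen (BP.isOpen_rect hS.isOpen hS.isOpen)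

theorem tonelli2 (hS : OpenSigmaCompact S) :
    Tonelli (μ.restrict S) (μ.restrict S) (haarOn2 μ S) :=
  (isRadonProd_haarBP2 μ).tonelli hS.sigmaFiniteOpen hS.sigmaFiniteOpen

theorem tonelli3 (hS : OpenSigmaCompact S) :
    Tonelli (μ.restrict S) (haarOn2 μ S) (haarOn3 μ S) :=
  (isRadonProd_haarBP3 μ).tonelli hS.sigmaFiniteOpen hS.sigmaFiniteOpen2

theorem tonelli3_swap (hS : OpenSigmaCompact S) :
    Tonelli (haarOn2 μ S) (μ.restrict S) ((haarOn3 μ S).map (BP.swap G (BP G G))) :=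
  (isRadonProd_haarBP3 μ).tonelli_swap hS.sigmaFiniteOpen hS.sigmaFiniteOpen2

theorem measurePreserving_swap (hS : OpenSigmaCompact S) :
    MeasurePreserving (BP.swap G G) (haarOn2 μ S) (haarOn2 μ S) :=
  ⟨BP.measurable_swap, ((isRadonProd_haarBP2 μ).tonelli_swap hS.sigmaFiniteOpen
    hS.sigmaFiniteOpen).unique hS.tonelli2⟩

theorem restrict_preimage_mul_left {x : G} (hx : x ∈ S) {E : Set G}
    (hE : MeasurableSet E) : μ.restrict S {y | x * y ∈ E} = μ.restrict S E := by
  have hm : MeasurableSet {y | x * y ∈ E} := (measurable_const_mul x) hE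
  rw [Measure.restrict_apply hm, Measure.restrict_apply hE, ← measure_preimage_mul μ x (E ∩ S)]
  congr 1
  ext y
  simp only [Set.mem_inter_iff, Set.mem_ofPred_eq, Set.mem_preimage, SetLike.mem_coe,
    S.mul_mem_cancel_left hx]

/-- Each section over x ∈ S is translated from the left by an element of S, so left invariance is
enough and no modular function appears. -/
theorem measurePreserving_shear (hS : OpenSigmaCompact S) :
    MeasurePreserving (BP.shear G) (haarOn2 μ S) (haarOn2 μ S) := by
  refine ⟨BP.continuous_shear.measurable, Measure.ext fun E hE => ?_⟩
  rw [Measure.map_apply BP.continuous_shear.measurable hE, hS.tonelli2.measure_eq E hE,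
    hS.tonelli2.measure_eq _ (BP.continuous_shear.measurable hE)]
  refine setLIntegral_congr_fun hS.measurableSet fun x hx => ?_
  exact restrict_preimage_mul_left hx (BP.measurable_mk_left x hE)

theorem measurePreserving_unshear (hS : OpenSigmaCompact S) :
    MeasurePreserving (BP.unshear G) (haarOn2 μ S) (haarOn2 μ S) := by
  refine ⟨BP.continuous_unshear.measurable, Measure.ext fun E hE => ?_⟩
  rw [Measure.map_apply BP.continuous_unshear.measurable hE, hS.tonelli2.measure_eq E hE,
    hS.tonelli2.measure_eq _ (BP.continuous_unshear.measurable hE)]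
  refine setLIntegral_congr_fun hS.measurableSet fun x hx => ?_
  exact restrict_preimage_mul_left (S.inv_mem hx) (BP.measurable_mk_left x hE)

theorem measurePreserving_cyc (hS : OpenSigmaCompact S) :
    MeasurePreserving (BP.cyc (G := G)) (haarOn3 μ S) (haarOn3 μ S) := by
  refine ⟨BP.continuous_cyc.measurable, Measure.ext fun E hE => ?_⟩
  let c : BP (BP G G) G → BP G (BP G G) := fun p => BP.mk p.1.1 (BP.mk p.1.2 p.2)
  have hc : Measurable c := (BP.continuous_mk (BP.continuous_fst.comp BP.continuous_fst)
    (BP.continuous_mk (BP.continuous_snd.comp BP.continuous_fst) BP.continuous_snd)).measurable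
  -- The cyclic permutation is the exchange of G with G × G followed by reassociation, so Tonelli
  -- with exchanged factors computes the same iterated integral.
  have h1 : BP.cyc (G := G) ⁻¹' E = BP.swap G (BP G G) ⁻¹' (c ⁻¹' E) := rfl
  rw [Measure.map_apply BP.continuous_cyc.measurable hE, h1,
    ← Measure.map_apply BP.measurable_swap (hc hE), hS.tonelli3_swap.measure_eq _ (hc hE),
    hS.tonelli2.lintegral_eq' (hS.tonelli3_swap.aemeasurable_section _ (hc hE)),
    hS.tonelli3.measure_eq E hE]
  refine lintegral_congr fun x => ?_
  rw [hS.tonelli2.measure_eq _ (BP.measurable_section hE x)]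
  rfl

/-- For fixed x and y the map z ↦ yz preserves μ on S, which carries null sets over. The measure
itself is not preserved, as the extra variable y contributes a factor μ(S). -/
theorem quasiMeasurePreserving_mulSnd (hS : OpenSigmaCompact S) :
    Measure.QuasiMeasurePreserving (BP.mulSnd G) (haarOn3 μ S) (haarOn2 μ S) := by
  refine ⟨BP.continuous_mulSnd.measurable, Measure.AbsolutelyContinuous.mk fun N hN h0 => ?_⟩
  have hm := BP.continuous_mulSnd.measurable hN
  rw [Measure.map_apply BP.continuous_mulSnd.measurable hN]
  refine hS.tonelli3.measure_eq_zero hm ?_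
  filter_upwards [hS.tonelli2.ae (measure_eq_zero_iff_ae_notMem.1 h0)] with x hx
  refine hS.tonelli2.measure_eq_zero (BP.measurable_section hm x) ?_
  filter_upwards [ae_restrict_mem hS.measurableSet] with y hy
  refine (restrict_preimage_mul_left hy (BP.measurable_section hN x)).trans ?_
  exact measure_eq_zero_iff_ae_notMem.2 hx

end OpenSigmaCompact

end Haar

/-! ### Convolution on an open σ-compact subgroup. -/

section Convolution

set_option linter.unusedSectionVars false

variable {G : Type*} [Group G] [TopologicalSpace G] [IsTopologicalGroup G]
  [LocallyCompactSpace G] [T2Space G] [MeasurableSpace G] [BorelSpace G]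
  {μ : Measure G} [μ.IsHaarMeasure] [μ.Regular] {S : Subgroup G} {ω : G → ℝ}

/-- Functions vanishing outside `S` which represent elements of `L¹(G, ω)`. -/
structure WeightedL1On (μ : Measure G) (ω : G → ℝ) (S : Subgroup G) (f : G → ℂ) : Prop where
  measurable : Measurable f
  integrable : Integrable (fun x => (ω x : ℂ) * f x) (μ.restrict S)
  eq_zero : ∀ x ∉ S, f x = 0

theorem integral_comp_of_measurePreserving {X Y : Type*} [MeasurableSpace X]
    [MeasurableSpace Y] {μ : Measure X} {ν : Measure Y} {e : X → Y} (he : MeasurePreserving e μ ν)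
    {F : Y → ℂ} (hF : AEStronglyMeasurable F ν) : ∫ x, F (e x) ∂μ = ∫ y, F y ∂ν := by
  rw [← he.map_eq] at hF ⊢
  exact (integral_map he.measurable.aemeasurable hF).symm

theorem WeightedL1On.setIntegral_eq_conv {g h : G → ℂ} (hg : WeightedL1On μ ω S g) (u : G) :
    ∫ y in S, g y * h (y⁻¹ * u) ∂μ = conv μ g h u :=
  setIntegral_eq_integral_of_forall_compl_eq_zero fun y hy => by rw [hg.eq_zero y hy, zero_mul]

/-- Integrating a function `β` bounded by the weight against a convolution. -/
theorem integral_mul_conv (hω : IsWeight ω) (hS : OpenSigmaCompact S) {g h : G → ℂ}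
    (hg : WeightedL1On μ ω S g) (hh : WeightedL1On μ ω S h) {β : G → ℂ} {C : ℝ}
    (hβ : AEStronglyMeasurable β (μ.restrict S)) (hβC : ∀ᵐ x ∂(μ.restrict S), ‖β x‖ ≤ C * ω x) :
    Integrable (fun u => β u * conv μ g h u) (μ.restrict S) ∧
    Integrable (fun p : BP G G => β (p.1 * p.2) * g p.1 * h p.2) (haarOn2 μ S) ∧
    ∫ p : BP G G, β (p.1 * p.2) * g p.1 * h p.2 ∂(haarOn2 μ S) =
      ∫ u in S, β u * conv μ g h u ∂μ := by
  have hT := hS.tonelli2 (μ := μ)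
  -- `W` is the integrand in the variables (y, u) with u = yz. Composed with `shear` it is the
  -- integrand over (y, z); integrated in y it gives β times the convolution.
  let W : BP G G → ℂ := fun p => β p.2 * (g p.1 * h (p.1⁻¹ * p.2))
  have hinvm : Measurable fun p : BP G G => p.1⁻¹ * p.2 :=
    (BP.continuous_fst.inv.mul BP.continuous_snd).measurable
  have hWm : AEStronglyMeasurable W (haarOn2 μ S) :=
    (hβ.comp_quasiMeasurePreserving hT.quasiMeasurePreserving_snd).mul
      ((hg.measurable.comp BP.measurable_fst).mul (hh.measurable.comp hinvm)).aestronglyMeasurable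
  have hD := (hT.integrable_mul hg.integrable hh.integrable).const_mul (C : ℂ)
  have hDu := hS.measurePreserving_unshear.integrable_comp_of_integrable hD
  -- By ω(u) ≤ ω(y) ω(y⁻¹u), `W` is dominated by the product C · (ωg)(y) · (ωh)(y⁻¹u), which is
  -- integrable because `unshear` preserves the measure.
  have hWint : Integrable W (haarOn2 μ S) := by
    refine hDu.mono hWm ?_
    filter_upwards [hT.quasiMeasurePreserving_snd.ae hβC] with p hp
    have h1 : 0 ≤ C * ω p.2 := (norm_nonneg _).trans hp
    have hC : 0 ≤ C := nonneg_of_mul_nonneg_left h1 (hω.pos _)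
    have h2 : ω p.2 ≤ ω p.1 * ω (p.1⁻¹ * p.2) := by
      simpa using hω.submul p.1 (p.1⁻¹ * p.2)
    simp only [W, Function.comp, BP.unshear, BP.mk_fst, BP.mk_snd, norm_mul, Complex.norm_real,
      Real.norm_of_nonneg (hω.pos _).le, Real.norm_of_nonneg hC]
    calc ‖β p.2‖ * (‖g p.1‖ * ‖h (p.1⁻¹ * p.2)‖)
        ≤ (C * (ω p.1 * ω (p.1⁻¹ * p.2))) * (‖g p.1‖ * ‖h (p.1⁻¹ * p.2)‖) := by
          gcongr
          exact hp.trans (mul_le_mul_of_nonneg_left h2 hC)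
      _ = _ := by ring
  have hWs := hS.measurePreserving_swap.integrable_comp_of_integrable hWint
  have hinner : ∀ u, ∫ y in S, (W ∘ BP.swap G G) (BP.mk u y) ∂μ = β u * conv μ g h u := by
    intro u
    rw [← hg.setIntegral_eq_conv u, ← integral_const_mul]
    rfl
  have hF : (fun p : BP G G => β (p.1 * p.2) * g p.1 * h p.2) = W ∘ BP.shear G := by
    ext p
    simp [W, BP.shear, mul_assoc]
  have h1 := hT.integrable_integral hWs
  have h2 := hT.integral_eq hWs
  simp_rw [hinner] at h1 h2
  refine ⟨h1, ?_, ?_⟩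
  · rw [hF]
    exact hS.measurePreserving_shear.integrable_comp_of_integrable hWint
  · rw [hF, ← h2]
    refine (integral_comp_of_measurePreserving
      hS.measurePreserving_shear hWm).trans ?_
    exact (integral_comp_of_measurePreserving
      hS.measurePreserving_swap hWm).symm

theorem integrable_weight_mul_conv (hω : IsWeight ω) (hS : OpenSigmaCompact S) {g h : G → ℂ}
    (hg : WeightedL1On μ ω S g) (hh : WeightedL1On μ ω S h) :
    Integrable (fun u => (ω u : ℂ) * conv μ g h u) (μ.restrict S) := by
  refine (integral_mul_conv hω hS hg hh (β := fun u => (ω u : ℂ)) (C := 1) ?_ ?_).1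
  · exact (Complex.continuous_ofReal.comp hω.continuous).measurable.aestronglyMeasurable
  · refine Eventually.of_forall fun x => ?_
    rw [Complex.norm_real, Real.norm_of_nonneg (hω.pos x).le, one_mul]

theorem aestronglyMeasurable_conv (hω : IsWeight ω) (hS : OpenSigmaCompact S) {g h : G → ℂ}
    (hg : WeightedL1On μ ω S g) (hh : WeightedL1On μ ω S h) :
    AEStronglyMeasurable (conv μ g h) (μ.restrict S) := by
  have h1 := (integrable_weight_mul_conv hω hS hg hh).1
  have h2 : Continuous fun u => ((ω u : ℂ))⁻¹ :=
    (Complex.continuous_ofReal.comp hω.continuous).inv₀ fun x => by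
      simpa using (hω.pos x).ne'
  refine (h2.measurable.aestronglyMeasurable.mul h1).congr (Eventually.of_forall fun u => ?_)
  have : (ω u : ℂ) ≠ 0 := by simpa using (hω.pos u).ne'
  simp [this]

theorem conv_eq_zero {g h : G → ℂ} (hg : WeightedL1On μ ω S g) (hh : WeightedL1On μ ω S h)
    {u : G} (hu : u ∉ S) : conv μ g h u = 0 := by
  rw [← hg.setIntegral_eq_conv u]
  have : ∀ y ∈ (S : Set G), g y * h (y⁻¹ * u) = 0 := fun y hy => by
    rw [hh.eq_zero _ fun hc => hu ?_, mul_zero]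
    simpa using S.mul_mem hy hc
  exact setIntegral_eq_zero_of_forall_eq_zero this

/-- `α` represents an element of `L^∞(S × S, 1/(ω × ω))`. -/
structure BoundedOn2 (μ : Measure G) [IsFiniteMeasureOnCompacts μ] (ω : G → ℝ) (S : Subgroup G)
    (C : ℝ) (α : BP G G → ℂ) : Prop where
  aestronglyMeasurable : AEStronglyMeasurable α (haarOn2 μ S)
  bound : ∀ᵐ p ∂(haarOn2 μ S), ‖α p‖ ≤ C * weight2 ω p

theorem BoundedOn2.integrable (hω : IsWeight ω) (hS : OpenSigmaCompact S) {C : ℝ} {α : BP G G → ℂ}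
    (hα : BoundedOn2 μ ω S C α) {f g : G → ℂ}
    (hfm : AEStronglyMeasurable f (μ.restrict S)) (hgm : AEStronglyMeasurable g (μ.restrict S))
    (hf : Integrable (fun x => (ω x : ℂ) * f x) (μ.restrict S))
    (hg : Integrable (fun x => (ω x : ℂ) * g x) (μ.restrict S)) :
    Integrable (fun p : BP G G => α p * f p.1 * g p.2) (haarOn2 μ S) := by
  have hT := hS.tonelli2 (μ := μ)
  refine ((hT.integrable_mul hf hg).const_mul (C : ℂ)).mono
    ((hα.aestronglyMeasurable.mul (hfm.comp_quasiMeasurePreserving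
      hT.quasiMeasurePreserving_fst)).mul (hgm.comp_quasiMeasurePreserving
      hT.quasiMeasurePreserving_snd)) ?_
  filter_upwards [hα.bound] with p hp
  have h2 : 0 < weight2 ω p := mul_pos (hω.pos _) (hω.pos _)
  have hC : 0 ≤ C := nonneg_of_mul_nonneg_left ((norm_nonneg _).trans hp) h2
  simp only [norm_mul, Complex.norm_real, Real.norm_of_nonneg (hω.pos _).le,
    Real.norm_of_nonneg hC]
  calc ‖α p‖ * ‖f p.1‖ * ‖g p.2‖ ≤ (C * (ω p.1 * ω p.2)) * ‖f p.1‖ * ‖g p.2‖ := by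
        gcongr; exact hp
    _ = _ := by ring

/-- For almost every x, `integral_mul_conv` applies to the slice β = α(x, ·) with the constant C
ω(x). -/
theorem BoundedOn2.integral_mulSnd (hω : IsWeight ω) (hS : OpenSigmaCompact S) {C : ℝ}
    {α : BP G G → ℂ} (hα : BoundedOn2 μ ω S C α) {f g h : G → ℂ} (hf : WeightedL1On μ ω S f)
    (hg : WeightedL1On μ ω S g) (hh : WeightedL1On μ ω S h) :
    Integrable (fun p : BP G (BP G G) => α (BP.mulSnd G p) * f p.1 * g p.2.1 * h p.2.2)
      (haarOn3 μ S) ∧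
    ∫ p, α (BP.mulSnd G p) * f p.1 * g p.2.1 * h p.2.2 ∂(haarOn3 μ S) =
      ∫ p : BP G G, α p * f p.1 * conv μ g h p.2 ∂(haarOn2 μ S) := by
  have hT := hS.tonelli2 (μ := μ)
  have hT3 := hS.tonelli3 (μ := μ)
  have hm : AEStronglyMeasurable (fun p : BP G (BP G G) => f p.1 * g p.2.1 * h p.2.2)
      (haarOn3 μ S) :=
    (((hf.measurable.comp BP.measurable_fst).mul
      (hg.measurable.comp (BP.measurable_fst.comp BP.measurable_snd))).mul
      (hh.measurable.comp (BP.measurable_snd.comp BP.measurable_snd))).aestronglyMeasurable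
  have hint : Integrable (fun p : BP G (BP G G) => α (BP.mulSnd G p) * f p.1 * g p.2.1 * h p.2.2)
      (haarOn3 μ S) := by
    have hbig := (hT3.integrable_mul hf.integrable
      (hT.integrable_mul hg.integrable hh.integrable)).const_mul (C : ℂ)
    have hαm := hα.aestronglyMeasurable.comp_quasiMeasurePreserving hS.quasiMeasurePreserving_mulSnd
    refine hbig.mono ((hαm.mul hm).congr (Eventually.of_forall fun p => ?_)) ?_
    · simp only [Pi.mul_apply, Function.comp]; ring
    filter_upwards [hS.quasiMeasurePreserving_mulSnd.ae hα.bound] with p hp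
    have h2 : 0 < weight2 ω (BP.mulSnd G p) := mul_pos (hω.pos _) (hω.pos _)
    have hC : 0 ≤ C := nonneg_of_mul_nonneg_left ((norm_nonneg _).trans hp) h2
    have h3 : weight2 ω (BP.mulSnd G p) ≤ ω p.1 * (ω p.2.1 * ω p.2.2) :=
      mul_le_mul_of_nonneg_left (hω.submul _ _) (hω.pos _).le
    simp only [norm_mul, Complex.norm_real, Real.norm_of_nonneg (hω.pos _).le,
      Real.norm_of_nonneg hC]
    calc ‖α (BP.mulSnd G p)‖ * ‖f p.1‖ * ‖g p.2.1‖ * ‖h p.2.2‖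
        ≤ (C * (ω p.1 * (ω p.2.1 * ω p.2.2))) * ‖f p.1‖ * ‖g p.2.1‖ * ‖h p.2.2‖ := by
          gcongr; exact hp.trans (mul_le_mul_of_nonneg_left h3 hC)
      _ = _ := by ring
  refine ⟨hint, ?_⟩
  have hint2 : Integrable (fun p : BP G G => α p * f p.1 * conv μ g h p.2) (haarOn2 μ S) :=
    hα.integrable hω hS hf.measurable.aestronglyMeasurable (aestronglyMeasurable_conv hω hS hg hh)
      hf.integrable (integrable_weight_mul_conv hω hS hg hh)
  rw [hT3.integral_eq hint, hT.integral_eq hint2]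
  refine integral_congr_ae ?_
  filter_upwards [hT.ae hα.bound, hT.aestronglyMeasurable_section hα.aestronglyMeasurable]
    with x hx hxm
  have hβ : ∀ᵐ u ∂(μ.restrict S), ‖α (BP.mk x u)‖ ≤ (C * ω x) * ω u := by
    filter_upwards [hx] with u hu
    rw [mul_assoc]
    exact hu
  have hconv := (integral_mul_conv hω hS hg hh hxm hβ).2.2
  have e1 : ∀ p : BP G G, α (BP.mulSnd G (BP.mk x p)) * f x * g p.1 * h p.2 =
      f x * (α (BP.mk x (p.1 * p.2)) * g p.1 * h p.2) := fun p => by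
    simp only [BP.mulSnd, BP.mk_fst, BP.mk_snd]; ring
  have e2 : ∀ u, α (BP.mk x u) * f x * conv μ g h u =
      f x * (α (BP.mk x u) * conv μ g h u) := fun u => by ring
  simp only [BP.mk_fst, BP.mk_snd]
  simp_rw [e1, e2]
  rw [integral_const_mul, integral_const_mul, hconv]

theorem BoundedOn2.swap (hS : OpenSigmaCompact S) {C : ℝ}
    {α : BP G G → ℂ} (hα : BoundedOn2 μ ω S C α) : BoundedOn2 μ ω S C (α ∘ BP.swap G G) := by
  have h := (hS.measurePreserving_swap (μ := μ)).quasiMeasurePreserving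
  refine ⟨hα.aestronglyMeasurable.comp_quasiMeasurePreserving h, ?_⟩
  filter_upwards [h.ae hα.bound] with p hp
  have : weight2 ω (BP.swap G G p) = weight2 ω p := mul_comm _ _
  rw [← this]
  exact hp

/-- `(x, (y, z)) ↦ α(xy, z) - α(x, yz) - α(y, zx)`. -/
def cocycleDefect (α : BP G G → ℂ) (p : BP G (BP G G)) : ℂ :=
  α (BP.mk (p.1 * p.2.1) p.2.2) - α (BP.mk p.1 (p.2.1 * p.2.2)) -
    α (BP.mk p.2.1 (p.2.2 * p.1))

/-- The defect of the cocycle identity, integrated against `f ⊗ g ⊗ h`. -/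
theorem BoundedOn2.integral_cocycleDefect (hω : IsWeight ω) (hS : OpenSigmaCompact S) {C : ℝ}
    {α : BP G G → ℂ} (hα : BoundedOn2 μ ω S C α) {f g h : G → ℂ} (hf : WeightedL1On μ ω S f)
    (hg : WeightedL1On μ ω S g) (hh : WeightedL1On μ ω S h) :
    Integrable (fun p : BP G (BP G G) => cocycleDefect α p * (f p.1 * g p.2.1 * h p.2.2))
      (haarOn3 μ S) ∧
    ∫ p, cocycleDefect α p * (f p.1 * g p.2.1 * h p.2.2) ∂(haarOn3 μ S) =
      ∫ p : BP G G, α p * conv μ f g p.1 * h p.2 ∂(haarOn2 μ S) -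
      ∫ p : BP G G, α p * f p.1 * conv μ g h p.2 ∂(haarOn2 μ S) -
      ∫ p : BP G G, α p * g p.1 * conv μ h f p.2 ∂(haarOn2 μ S) := by
  have hcyc := hS.measurePreserving_cyc (μ := μ)
  -- All three terms come from `integral_mulSnd`: α(x, yz) directly, α(y, zx) after one cyclic
  -- permutation, and α(xy, z) after two, with the variables of α exchanged.
  obtain ⟨i1, e1⟩ := (hα.swap hS).integral_mulSnd hω hS hh hf hg
  obtain ⟨i2, e2⟩ := hα.integral_mulSnd hω hS hf hg hh
  obtain ⟨i3, e3⟩ := hα.integral_mulSnd hω hS hg hh hf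
  have j1 := (hcyc.comp hcyc).integrable_comp_of_integrable i1
  have j3 := hcyc.integrable_comp_of_integrable i3
  have hfun : (fun p : BP G (BP G G) => cocycleDefect α p * (f p.1 * g p.2.1 * h p.2.2)) =
      fun p => ((fun p => (α ∘ BP.swap G G) (BP.mulSnd G p) * h p.1 * f p.2.1 * g p.2.2) ∘
        (BP.cyc ∘ BP.cyc)) p - α (BP.mulSnd G p) * f p.1 * g p.2.1 * h p.2.2 -
        ((fun p => α (BP.mulSnd G p) * g p.1 * h p.2.1 * f p.2.2) ∘ BP.cyc) p := by
    ext p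
    simp only [cocycleDefect, Function.comp, BP.cyc, BP.mulSnd, BP.mk_fst, BP.mk_snd, BP.swap_mk]
    ring
  have hswap : ∫ p : BP G G, α p * conv μ f g p.1 * h p.2 ∂(haarOn2 μ S) =
      ∫ p : BP G G, (α ∘ BP.swap G G) p * h p.1 * conv μ f g p.2 ∂(haarOn2 μ S) := by
    rw [← (hS.measurePreserving_swap (μ := μ)).integral_comp
      (BP.swap G G).measurableEmbedding]
    refine integral_congr_ae (Eventually.of_forall fun p => ?_)
    have h1 : (BP.swap G G p).1 = p.2 := rfl
    have h2 : (BP.swap G G p).2 = p.1 := rfl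
    simp only [Function.comp, h1, h2]
    ring
  rw [hfun]
  refine ⟨(j1.sub i2).sub j3, ?_⟩
  refine (integral_sub (j1.sub i2) j3).trans ?_
  refine (congrArg (· - _) (integral_sub j1 i2)).trans ?_
  rw [e2, hswap, ← e1, ← e3]
  congr 1
  · congr 1
    exact integral_comp_of_measurePreserving (hcyc.comp hcyc) i1.1
  · exact integral_comp_of_measurePreserving hcyc i3.1

end Convolution

/-! ### Local properties on σ-compact sets. -/

section LocallyAESigmaCompact

variable {X : Type*} [TopologicalSpace X] [MeasurableSpace X] {ν : Measure X}

theorem ae_restrict_of_locAE {T : Set X} (hT : IsSigmaCompact T) {p : X → Prop}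
    (h : ∀ᶠ x in locAE ν, p x) : ∀ᵐ x ∂(ν.restrict T), p x := by
  obtain ⟨K, hK, rfl⟩ := hT
  exact (ae_restrict_iUnion_iff _ _).2 fun n => eventually_locAE.1 h _ (hK n)

theorem LocMeasurable.aestronglyMeasurable_restrict {T : Set X} (hT : IsSigmaCompact T) {f : X → ℂ}
    (h : LocMeasurable ν f) : AEStronglyMeasurable f (ν.restrict T) := by
  obtain ⟨K, hK, rfl⟩ := hT
  exact aestronglyMeasurable_iUnion_iff.2 fun n => h _ (hK n)

end LocallyAESigmaCompact

/-! ### L¹(G, ω) and its pairing with L^∞(G, 1/ω). -/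

section L1

set_option linter.unusedSectionVars false

variable {G : Type*} [Group G] [TopologicalSpace G] [IsTopologicalGroup G]
  [LocallyCompactSpace G] [T2Space G] [MeasurableSpace G] [BorelSpace G]
  {μ : Measure G} [μ.IsHaarMeasure] [μ.Regular] {S : Subgroup G} {ω : G → ℝ}

theorem IsWeight.measurable (hω : IsWeight ω) : Measurable ω := hω.continuous.measurable

theorem IsWeight.ae_withDensity_iff (hω : IsWeight ω) {p : G → Prop} :
    (∀ᵐ x ∂(μ.withDensity fun x => ENNReal.ofReal (ω x)), p x) ↔ ∀ᵐ x ∂μ, p x := by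
  rw [MeasureTheory.ae_withDensity_iff hω.measurable.ennreal_ofReal]
  refine eventually_congr (Eventually.of_forall fun x => ?_)
  simp [hω.pos x]

theorem IsWeight.integrable_withDensity_iff (hω : IsWeight ω) {f : G → ℂ} :
    Integrable f (μ.withDensity fun x => ENNReal.ofReal (ω x)) ↔
      Integrable (fun x => (ω x : ℂ) * f x) μ := by
  rw [integrable_withDensity_iff_integrable_smul' hω.measurable.ennreal_ofReal
    (Eventually.of_forall fun x => ENNReal.ofReal_lt_top)]
  simp_rw [ENNReal.toReal_ofReal (hω.pos _).le, Complex.real_smul]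

theorem L1.measurable (f : L1 μ ω) : Measurable f := (Lp.stronglyMeasurable f).measurable

theorem L1.integrable (hω : IsWeight ω) (f : L1 μ ω) : Integrable (fun x => (ω x : ℂ) * f x) μ :=
  hω.integrable_withDensity_iff.1 (L1.integrable_coeFn f)

theorem L1.norm_eq (hω : IsWeight ω) (f : L1 μ ω) : ‖f‖ = ∫ x, ‖(ω x : ℂ) * f x‖ ∂μ := by
  rw [MeasureTheory.L1.norm_eq_integral_norm, integral_withDensity_eq_integral_toReal_smul
    hω.measurable.ennreal_ofReal (Eventually.of_forall fun x => ENNReal.ofReal_lt_top)]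
  refine integral_congr_ae (Eventually.of_forall fun x => ?_)
  simp [ENNReal.toReal_ofReal (hω.pos x).le, abs_of_pos (hω.pos x)]

theorem L1.exists_isSigmaCompact (hω : IsWeight ω) (f : L1 μ ω) :
    ∃ T, IsSigmaCompact T ∧ ∀ x ∉ T, f x = 0 := by
  obtain ⟨T, hT, hfT⟩ := exists_isSigmaCompact_of_lintegral_ne_top μ
    (f := fun x => ‖(ω x : ℂ) * f x‖ₑ)
    ((Complex.measurable_ofReal.comp hω.measurable).mul (L1.measurable f)).enorm
    (L1.integrable hω f).2.ne
  refine ⟨T, hT, fun x hx => ?_⟩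
  simpa [(hω.pos x).ne'] using hfT x hx

/-- This is the reduction to the σ-finite case: the functions at hand vanish off one S, where Fubini
is available. The set `T` lets S also contain a compact set under study. -/
theorem L1.exists_subgroup (hω : IsWeight ω) {ι : Type*} [Countable ι] (f : ι → L1 μ ω)
    {T : Set G} (hT : IsSigmaCompact T) :
    ∃ S : Subgroup G, OpenSigmaCompact S ∧ T ⊆ S ∧ ∀ i, WeightedL1On μ ω S (f i) := by
  choose T' hT' hf using fun i => L1.exists_isSigmaCompact hω (f i)
  obtain ⟨S, hS, hTS⟩ := exists_openSigmaCompact (hT.union (isSigmaCompact_iUnion T' hT'))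
  refine ⟨S, hS, Set.subset_union_left.trans hTS, fun i => ⟨L1.measurable _,
    (L1.integrable hω _).integrableOn, fun x hx => hf i x fun hx' => hx (hTS ?_)⟩⟩
  exact Or.inr (Set.mem_iUnion.2 ⟨i, hx'⟩)

theorem WeightedL1On.integrable_of_forall {f : G → ℂ}
    (hf : Integrable (fun x => (ω x : ℂ) * f x) (μ.restrict S)) (h0 : ∀ x ∉ S, f x = 0) :
    Integrable (fun x => (ω x : ℂ) * f x) μ :=
  (integrableOn_iff_integrable_of_support_subset fun x hx => by
    by_contra hxS
    exact hx (by simp [h0 x hxS])).1 hf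

/-- Submultiplicativity of ω keeps the convolution in L¹(G, ω), so the value 0 in `mulL1` is never
used. -/
theorem coeFn_mulL1 (hω : IsWeight ω) (f g : L1 μ ω) : mulL1 μ ω f g =ᵐ[μ] conv μ f g := by
  obtain ⟨S, hS, -, hfg⟩ := L1.exists_subgroup hω ![f, g] isSigmaCompact_empty
  have hf : WeightedL1On μ ω S f := hfg 0
  have hg : WeightedL1On μ ω S g := hfg 1
  have hmem : MemLp (conv μ f g) 1 (μ.withDensity fun x => ENNReal.ofReal (ω x)) :=
    memLp_one_iff_integrable.2 (hω.integrable_withDensity_iff.2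
      (WeightedL1On.integrable_of_forall (integrable_weight_mul_conv hω hS hf hg)
        fun x hx => conv_eq_zero hf hg hx))
  rw [mulL1, dif_pos hmem]
  exact hω.ae_withDensity_iff.1 hmem.coeFn_toLp

theorem L1.coeFn_add (hω : IsWeight ω) (f g : L1 μ ω) :
    ⇑(f + g) =ᵐ[μ] ⇑f + ⇑g := hω.ae_withDensity_iff.1 (Lp.coeFn_add f g)

theorem L1.coeFn_smul (hω : IsWeight ω) (c : ℂ) (f : L1 μ ω) :
    ⇑(c • f) =ᵐ[μ] c • ⇑f := hω.ae_withDensity_iff.1 (Lp.coeFn_smul c f)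

variable {hω : IsWeight ω}

/-- F is controlled only on compact sets, but g vanishes off a σ-compact S, on which local bounds
and local measurability are global. -/
theorem pairing_aux (g : L1 μ ω) {F : G → ℂ} {C : ℝ} (hF : LocMeasurable μ F)
    (hC : ∀ᶠ x in locAE μ, ‖F x‖ ≤ C * ω x) (hω : IsWeight ω) :
    Integrable (fun x => g x * F x) μ ∧ ‖∫ x, g x * F x ∂μ‖ ≤ C * ‖g‖ := by
  obtain ⟨S, hS, -, hg⟩ := L1.exists_subgroup hω ![g] isSigmaCompact_empty
  have hg : WeightedL1On μ ω S g := hg 0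
  have hbound : ∀ᵐ x ∂(μ.restrict S), ‖g x * F x‖ ≤ C * ‖(ω x : ℂ) * g x‖ := by
    filter_upwards [ae_restrict_of_locAE hS.isSigmaCompact hC] with x hx
    rw [norm_mul, norm_mul, Complex.norm_real, Real.norm_of_nonneg (hω.pos x).le]
    calc ‖g x‖ * ‖F x‖ ≤ ‖g x‖ * (C * ω x) := by gcongr
      _ = _ := by ring
  have hint : Integrable (fun x => g x * F x) (μ.restrict S) := by
    refine (hg.integrable.norm.const_mul C).mono' ?_ hbound
    exact hg.measurable.aestronglyMeasurable.mul
      (hF.aestronglyMeasurable_restrict hS.isSigmaCompact)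
  have h0 : ∀ x ∉ (S : Set G), g x * F x = 0 := fun x hx => by rw [hg.eq_zero x hx, zero_mul]
  constructor
  · refine (integrableOn_iff_integrable_of_support_subset fun x hx => ?_).1 hint
    by_contra hxS
    exact hx (h0 x hxS)
  · have h1 : ∫ x in S, ‖(ω x : ℂ) * g x‖ ∂μ = ∫ x, ‖(ω x : ℂ) * g x‖ ∂μ :=
      setIntegral_eq_integral_of_forall_compl_eq_zero fun x hx => by
        rw [hg.eq_zero x hx, mul_zero, norm_zero]
    rw [← setIntegral_eq_integral_of_forall_compl_eq_zero h0, L1.norm_eq hω, ← h1,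
      ← integral_const_mul]
    exact norm_integral_le_of_norm_le (hg.integrable.norm.const_mul C) hbound

theorem integrable_pairing (g : L1 μ ω) (φ : LInf μ ω hω) :
    Integrable (fun x => g x * rep φ x) μ :=
  (pairing_aux g (memLInftyInv_rep φ).1 (rep_le_norm φ) hω).1

theorem norm_pairing_le (g : L1 μ ω) (φ : LInf μ ω hω) : ‖pairing g φ‖ ≤ ‖φ‖ * ‖g‖ :=
  (pairing_aux g (memLInftyInv_rep φ).1 (rep_le_norm φ) hω).2

/-- The pairing only depends on the values of the second argument locally almost everywhere. -/
theorem pairing_congr (g : L1 μ ω) {F F' : G → ℂ} (h : F =ᶠ[locAE μ] F') (hω : IsWeight ω) :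
    ∫ x, g x * F x ∂μ = ∫ x, g x * F' x ∂μ := by
  obtain ⟨S, hS, -, hg⟩ := L1.exists_subgroup hω ![g] isSigmaCompact_empty
  have hg : WeightedL1On μ ω S g := hg 0
  rw [← setIntegral_eq_integral_of_forall_compl_eq_zero (s := (S : Set G)) (f := fun x => g x * F x)
      (fun x hx => by rw [hg.eq_zero x hx, zero_mul]),
    ← setIntegral_eq_integral_of_forall_compl_eq_zero (s := (S : Set G)) (f := fun x => g x * F' x)
      (fun x hx => by rw [hg.eq_zero x hx, zero_mul])]
  refine integral_congr_ae ?_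
  filter_upwards [ae_restrict_of_locAE hS.isSigmaCompact h] with x hx
  rw [hx]

theorem pairing_add_left (g g' : L1 μ ω) (φ : LInf μ ω hω) :
    pairing (g + g') φ = pairing g φ + pairing g' φ := by
  unfold pairing
  rw [← integral_add (integrable_pairing g φ) (integrable_pairing g' φ)]
  refine integral_congr_ae ?_
  filter_upwards [L1.coeFn_add hω g g'] with x hx
  rw [hx, Pi.add_apply, add_mul]

theorem pairing_smul_left (c : ℂ) (g : L1 μ ω) (φ : LInf μ ω hω) :
    pairing (c • g) φ = c * pairing g φ := by
  unfold pairing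
  rw [← integral_const_mul]
  refine integral_congr_ae ?_
  filter_upwards [L1.coeFn_smul hω c g] with x hx
  rw [hx, Pi.smul_apply, smul_eq_mul, mul_assoc]

theorem pairing_add_right (g : L1 μ ω) (φ ψ : LInf μ ω hω) :
    pairing g (φ + ψ) = pairing g φ + pairing g ψ := by
  unfold pairing
  rw [← integral_add (integrable_pairing g φ) (integrable_pairing g ψ),
    pairing_congr g (rep_add φ ψ) hω]
  simp only [Pi.add_apply, mul_add]

theorem pairing_smul_right (c : ℂ) (g : L1 μ ω) (φ : LInf μ ω hω) :
    pairing g (c • φ) = c * pairing g φ := by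
  unfold pairing
  rw [← integral_const_mul, pairing_congr g (rep_smul c φ) hω]
  refine integral_congr_ae (Eventually.of_forall fun x => ?_)
  simp only [Pi.smul_apply, smul_eq_mul]
  ring

/-- The bounded bilinear form `(f, g) ↦ ⟨g, D(f)⟩`. -/
noncomputable def pairingCLM (D : L1 μ ω →L[ℂ] LInf μ ω hω) : L1 μ ω →L[ℂ] L1 μ ω →L[ℂ] ℂ :=
  LinearMap.mkContinuous₂
    (LinearMap.mk₂ ℂ (fun f g => pairing g (D f))
      (fun f f' g => by rw [map_add, pairing_add_right])
      (fun c f g => by rw [map_smul, pairing_smul_right, smul_eq_mul])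
      (fun f g g' => pairing_add_left g g' (D f))
      (fun c f g => pairing_smul_left c g (D f))) ‖D‖
    (fun f g => (norm_pairing_le g (D f)).trans
      (mul_le_mul_of_nonneg_right (D.le_opNorm f) (norm_nonneg g)))

@[simp] theorem pairingCLM_apply (D : L1 μ ω →L[ℂ] LInf μ ω hω) (f g : L1 μ ω) :
    pairingCLM D f g = pairing g (D f) := rfl

theorem norm_pairing_apply_le (D : L1 μ ω →L[ℂ] LInf μ ω hω) (f g : L1 μ ω) :
    ‖pairing g (D f)‖ ≤ ‖D‖ * ‖f‖ * ‖g‖ :=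
  (norm_pairing_le g (D f)).trans
    (mul_le_mul_of_nonneg_right (D.le_opNorm f) (norm_nonneg g))

theorem withDensity_lt_top_of_isCompact (hω : IsWeight ω) {K A : Set G} (hK : IsCompact K)
    (hA : A ⊆ K) : (μ.withDensity fun x => ENNReal.ofReal (ω x)) A ≠ ∞ := by
  have h1 : IntegrableOn ω K μ := hω.continuous.continuousOn.integrableOn_compact hK
  refine ne_top_of_le_ne_top ?_ (measure_mono hA)
  rw [withDensity_apply _ hK.measurableSet]
  refine ne_top_of_le_ne_top h1.2.ne (lintegral_mono fun x => Real.ofReal_le_enorm _)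

/-- The indicator function of a relatively compact Borel set, in `L¹(G, ω)`. -/
noncomputable def indL1 (μ : Measure G) (ω : G → ℝ) {A : Set G} (hA : MeasurableSet A)
    (hf : (μ.withDensity fun x => ENNReal.ofReal (ω x)) A ≠ ∞) : L1 μ ω :=
  indicatorConstLp 1 hA hf (1 : ℂ)

theorem coeFn_indL1 (hω : IsWeight ω) {A : Set G} (hA : MeasurableSet A)
    (hf : (μ.withDensity fun x => ENNReal.ofReal (ω x)) A ≠ ∞) :
    indL1 μ ω hA hf =ᵐ[μ] A.indicator fun _ => 1 :=
  hω.ae_withDensity_iff.1 indicatorConstLp_coeFn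

/-- Indicator functions of Borel subsets of a compact K belong to L¹(G, ω) and determine a function
on K almost everywhere. -/
theorem LInf.ext {φ ψ : LInf μ ω hω} (h : ∀ g : L1 μ ω, pairing g φ = pairing g ψ) : φ = ψ := by
  apply Subtype.ext
  rw [← coe_rep φ, ← coe_rep ψ]
  refine Germ.coe_eq.2 (eventually_locAE.2 fun K hK => ?_)
  have hint : ∀ φ : LInf μ ω hω, IntegrableOn (rep φ) K μ := by
    intro φ
    have h1 : IntegrableOn ω K μ := hω.continuous.continuousOn.integrableOn_compact hK
    exact (h1.const_mul ‖φ‖).mono' ((memLInftyInv_rep φ).1 K hK)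
      (eventually_locAE.1 (rep_le_norm φ) K hK)
  refine (hint φ).ae_eq_of_forall_setIntegral_eq _ _ (hint ψ) fun A hA _ => ?_
  have hAK := hA.inter hK.measurableSet
  have h2 := h (indL1 μ ω hAK (withDensity_lt_top_of_isCompact hω hK Set.inter_subset_right))
  have h3 : ∀ φ : LInf μ ω hω, pairing (indL1 μ ω hAK
      (withDensity_lt_top_of_isCompact hω hK Set.inter_subset_right)) φ =
      ∫ x in A, rep φ x ∂(μ.restrict K) := by
    intro φ
    rw [Measure.restrict_restrict hA, ← integral_indicator hAK]
    refine integral_congr_ae ?_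
    filter_upwards [coeFn_indL1 hω hAK
      (withDensity_lt_top_of_isCompact hω hK Set.inter_subset_right)] with x hx
    rw [hx]
    by_cases hxA : x ∈ A ∩ K <;> simp [hxA]
  rwa [h3, h3] at h2

end L1

/-! ### Operators given by kernels, and the derivation defect. -/

section Kernel

set_option linter.unusedSectionVars false

variable {G : Type*} [Group G] [TopologicalSpace G] [IsTopologicalGroup G]
  [LocallyCompactSpace G] [T2Space G] [MeasurableSpace G] [BorelSpace G]
  {μ : Measure G} [μ.IsHaarMeasure] [μ.Regular] {S : Subgroup G} {ω : G → ℝ}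

theorem MemLInftyInv.exists_boundedOn2 (hω : IsWeight ω) {α : BP G G → ℂ}
    (hα : MemLInftyInv (haarBP2 μ) (weight2 ω) α) :
    ∃ C, 0 ≤ C ∧ ∀ S : Subgroup G, OpenSigmaCompact S → BoundedOn2 μ ω S C α := by
  obtain ⟨hm, C, hC⟩ := hα
  refine ⟨max C 0, le_max_right _ _, fun S hS => ⟨hm.aestronglyMeasurable_restrict
    (hS.isSigmaCompact.rect hS.isSigmaCompact), ?_⟩⟩
  filter_upwards [ae_restrict_of_locAE (hS.isSigmaCompact.rect hS.isSigmaCompact) hC] with p hp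
  exact hp.trans (mul_le_mul_of_nonneg_right (le_max_left _ _)
    (mul_pos (hω.pos _) (hω.pos _)).le)

variable {C : ℝ} {α : BP G G → ℂ} {f g : G → ℂ}

theorem WeightedL1On.mul_eq_zero (hf : WeightedL1On μ ω S f) (hg : WeightedL1On μ ω S g)
    {p : BP G G} (hp : p ∉ BP.rect (S : Set G) (S : Set G)) : α p * f p.1 * g p.2 = 0 := by
  by_cases h : p.1 ∈ S
  · rw [hg.eq_zero p.2 fun h' => hp ⟨h, h'⟩, mul_zero]
  · rw [hf.eq_zero p.1 h, mul_zero, zero_mul]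

theorem BoundedOn2.integrable_haarBP2 (hω : IsWeight ω) (hS : OpenSigmaCompact S)
    (hα : BoundedOn2 μ ω S C α) (hf : WeightedL1On μ ω S f) (hg : WeightedL1On μ ω S g) :
    Integrable (fun p : BP G G => α p * f p.1 * g p.2) (haarBP2 μ) := by
  refine (integrableOn_iff_integrable_of_support_subset fun x hx => ?_).1
    (hα.integrable hω hS hf.measurable.aestronglyMeasurable hg.measurable.aestronglyMeasurable
      hf.integrable hg.integrable)
  by_contra hxS
  exact hx (hf.mul_eq_zero hg hxS)

theorem WeightedL1On.setIntegral_mul (hf : WeightedL1On μ ω S f) (hg : WeightedL1On μ ω S g) :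
    ∫ p : BP G G, α p * f p.1 * g p.2 ∂(haarOn2 μ S) =
      ∫ p : BP G G, α p * f p.1 * g p.2 ∂(haarBP2 μ) :=
  setIntegral_eq_integral_of_forall_compl_eq_zero fun _ hp => hf.mul_eq_zero hg hp

/-- `Tonelli` freezes the first variable, whereas y is frozen here; hence the passage through the
swapped kernel. -/
theorem BoundedOn2.ae_slice (hω : IsWeight ω) (hS : OpenSigmaCompact S)
    (hα : BoundedOn2 μ ω S C α) {f : L1 μ ω} (hf : WeightedL1On μ ω S f) :
    ∀ᵐ y ∂(μ.restrict S), Integrable (fun x => α (BP.mk x y) * f x) μ ∧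
      ‖∫ x, α (BP.mk x y) * f x ∂μ‖ ≤ (C * ‖f‖) * ω y := by
  have hT := hS.tonelli2 (μ := μ)
  have hα' := hα.swap hS
  filter_upwards [hT.ae hα'.bound, hT.aestronglyMeasurable_section hα'.aestronglyMeasurable]
    with y hy hym
  simp only [Function.comp, BP.swap_mk] at hy hym
  have hbound : ∀ᵐ x ∂(μ.restrict S), ‖α (BP.mk x y) * f x‖ ≤ C * ω y * ‖(ω x : ℂ) * f x‖ := by
    filter_upwards [hy] with x hx
    rw [norm_mul, norm_mul, Complex.norm_real, Real.norm_of_nonneg (hω.pos x).le]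
    calc ‖α (BP.mk x y)‖ * ‖f x‖ ≤ (C * (ω y * ω x)) * ‖f x‖ := by gcongr; exact hx
      _ = _ := by ring
  have hint : Integrable (fun x => α (BP.mk x y) * f x) (μ.restrict S) :=
    (hf.integrable.norm.const_mul (C * ω y)).mono'
      (hym.mul hf.measurable.aestronglyMeasurable) hbound
  have h0 : ∀ x ∉ (S : Set G), α (BP.mk x y) * f x = 0 := fun x hx => by
    rw [hf.eq_zero x hx, mul_zero]
  constructor
  · refine (integrableOn_iff_integrable_of_support_subset fun x hx => ?_).1 hint
    by_contra hxS
    exact hx (h0 x hxS)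
  · have h1 : ∫ x in S, ‖(ω x : ℂ) * f x‖ ∂μ = ‖f‖ := by
      rw [L1.norm_eq hω]
      exact setIntegral_eq_integral_of_forall_compl_eq_zero fun x hx => by
        rw [hf.eq_zero x hx, mul_zero, norm_zero]
    rw [← setIntegral_eq_integral_of_forall_compl_eq_zero h0]
    refine (norm_integral_le_of_norm_le (hf.integrable.norm.const_mul (C * ω y)) hbound).trans ?_
    rw [integral_const_mul, h1]
    exact le_of_eq (by ring)

theorem BoundedOn2.integral_slice (hω : IsWeight ω) (hS : OpenSigmaCompact S)
    (hα : BoundedOn2 μ ω S C α) (hf : WeightedL1On μ ω S f) (hg : WeightedL1On μ ω S g) :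
    Integrable (fun y => g y * ∫ x, α (BP.mk x y) * f x ∂μ) (μ.restrict S) ∧
    ∫ p : BP G G, α p * f p.1 * g p.2 ∂(haarOn2 μ S) =
      ∫ y in S, g y * ∫ x, α (BP.mk x y) * f x ∂μ ∂μ := by
  have hT := hS.tonelli2 (μ := μ)
  have hint := hα.integrable hω hS hf.measurable.aestronglyMeasurable
    hg.measurable.aestronglyMeasurable hf.integrable hg.integrable
  have hints := hS.measurePreserving_swap.integrable_comp_of_integrable hint
  have hinner : ∀ y, ∫ x in S, ((fun p : BP G G => α p * f p.1 * g p.2) ∘ BP.swap G G)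
      (BP.mk y x) ∂μ = g y * ∫ x, α (BP.mk x y) * f x ∂μ := by
    intro y
    rw [← setIntegral_eq_integral_of_forall_compl_eq_zero (s := (S : Set G))
      (f := fun x => α (BP.mk x y) * f x) (fun x hx => by rw [hf.eq_zero x hx, mul_zero]),
      ← integral_const_mul]
    refine integral_congr_ae (Eventually.of_forall fun x => ?_)
    simp only [Function.comp, BP.swap_mk, BP.mk_fst, BP.mk_snd]
    ring
  have h1 := hT.integrable_integral hints
  have h2 := hT.integral_eq hints
  simp_rw [hinner] at h1 h2
  refine ⟨h1, ?_⟩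
  rw [← h2]
  exact (integral_comp_of_measurePreserving hS.measurePreserving_swap hint.1).symm

theorem weightedL1On_indicator (hω : IsWeight ω) {A K : Set G} (hA : MeasurableSet A)
    (hK : IsCompact K) (hAK : A ⊆ K) (hAS : A ⊆ S) :
    WeightedL1On μ ω S (A.indicator fun _ => 1) := by
  refine ⟨measurable_const.indicator hA, ?_, fun x hx => Set.indicator_of_notMem
    (fun h => hx (hAS h)) _⟩
  have h1 : IntegrableOn (fun x => (ω x : ℂ)) A μ :=
    ((Complex.continuous_ofReal.comp hω.continuous).continuousOn.integrableOn_compact hK).mono_set hAK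
  have h2 : (fun x => (ω x : ℂ) * A.indicator (fun _ => (1 : ℂ)) x) =
      A.indicator fun x => (ω x : ℂ) := by
    ext x
    by_cases hx : x ∈ A <;> simp [hx]
  rw [h2]
  exact ((integrable_indicator_iff hA).2 h1).integrableOn

/-- The functions `y ↦ ∫ α(x, y) f(x) dx`, for `f ∈ L¹(G, ω)`, belong to `L^∞(G, 1/ω)`. -/
theorem memLInftyInv_slice (hω : IsWeight ω)
    (hα : ∀ S : Subgroup G, OpenSigmaCompact S → BoundedOn2 μ ω S C α) (f : L1 μ ω) :
    LocMeasurable μ (fun y => ∫ x, α (BP.mk x y) * f x ∂μ) ∧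
      ∀ᶠ y in locAE μ, ‖∫ x, α (BP.mk x y) * f x ∂μ‖ ≤ (C * ‖f‖) * ω y := by
  constructor
  · intro K hK
    obtain ⟨S, hS, hKS, hf⟩ := L1.exists_subgroup hω ![f] hK.isSigmaCompact
    -- The test function g is the indicator of K, so integrability of g times the slice integral
    -- gives measurability of the latter on K.
    have h1 := ((hα S hS).integral_slice hω hS (hf 0)
      (weightedL1On_indicator hω hK.measurableSet hK le_rfl hKS)).1.1.mono_measure
      (Measure.restrict_mono hKS le_rfl)
    refine h1.congr ?_
    filter_upwards [ae_restrict_mem hK.measurableSet] with y hy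
    simp [hy]
  · refine eventually_locAE.2 fun K hK => ?_
    obtain ⟨S, hS, hKS, hf⟩ := L1.exists_subgroup hω ![f] hK.isSigmaCompact
    filter_upwards [ae_mono (Measure.restrict_mono hKS le_rfl)
      ((hα S hS).ae_slice hω hS (hf 0))] with y hy
    exact hy.2

/-- The operator `f ↦ ∫ α(x, ·) f(x) dx` from `L¹(G, ω)` to `L^∞(G, 1/ω)`. -/
noncomputable def kernelOperator (hω : IsWeight ω)
    (hα : ∀ S : Subgroup G, OpenSigmaCompact S → BoundedOn2 μ ω S C α) (hC : 0 ≤ C) :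
    L1 μ ω →L[ℂ] LInf μ ω hω :=
  LinearMap.mkContinuous
    { toFun := fun f => ⟨((fun y => ∫ x, α (BP.mk x y) * f x ∂μ : G → ℂ) : Germ (locAE μ) ℂ), _,
        ⟨(memLInftyInv_slice hω hα f).1, _, (memLInftyInv_slice hω hα f).2⟩, rfl⟩
      -- Additivity holds only where both slices are integrable, hence only locally almost
      -- everywhere; homogeneity holds at every y.
      map_add' := fun f f' => by
        refine Subtype.ext (Germ.coe_eq.2 (eventually_locAE.2 fun K hK => ?_))
        obtain ⟨S, hS, hKS, hf⟩ := L1.exists_subgroup hω ![f, f'] hK.isSigmaCompact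
        filter_upwards [ae_mono (Measure.restrict_mono hKS le_rfl)
          ((hα S hS).ae_slice hω hS (hf 0)), ae_mono (Measure.restrict_mono hKS le_rfl)
          ((hα S hS).ae_slice hω hS (hf 1))] with y hy hy'
        refine Eq.trans ?_ (integral_add hy.1 hy'.1)
        refine integral_congr_ae ?_
        filter_upwards [L1.coeFn_add hω f f'] with x hx
        rw [hx, Pi.add_apply, mul_add]
      map_smul' := fun c f => by
        refine Subtype.ext (Germ.coe_eq.2 (Eventually.of_forall fun y => ?_))
        refine Eq.trans ?_ (integral_const_mul c _)
        refine integral_congr_ae ?_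
        filter_upwards [L1.coeFn_smul hω c f] with x hx
        rw [hx, Pi.smul_apply, smul_eq_mul]
        ring } C
    (fun f => by
      refine norm_le_of_bound _ (mul_nonneg hC (norm_nonneg f)) ?_
      have h := (memLInftyInv_slice hω hα f).2
      have h' : rep (⟨_, _, ⟨(memLInftyInv_slice hω hα f).1, _, h⟩, rfl⟩ : LInf μ ω hω)
          =ᶠ[locAE μ] fun y => ∫ x, α (BP.mk x y) * f x ∂μ := Germ.coe_eq.1 (coe_rep _)
      exact (h'.and h).mono fun x hx => (congrArg norm hx.1).le.trans hx.2)

theorem rep_kernelOperator (hω : IsWeight ω)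
    (hα : ∀ S : Subgroup G, OpenSigmaCompact S → BoundedOn2 μ ω S C α) (hC : 0 ≤ C) (f : L1 μ ω) :
    rep (kernelOperator hω hα hC f) =ᶠ[locAE μ] fun y => ∫ x, α (BP.mk x y) * f x ∂μ :=
  Germ.coe_eq.1 (coe_rep _)

theorem integrable_kernel (hω : IsWeight ω)
    (hα : ∀ S : Subgroup G, OpenSigmaCompact S → BoundedOn2 μ ω S C α) (f g : L1 μ ω) :
    Integrable (fun p : BP G G => α p * f p.1 * g p.2) (haarBP2 μ) := by
  obtain ⟨S, hS, -, hfg⟩ := L1.exists_subgroup hω ![f, g] isSigmaCompact_empty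
  exact (hα S hS).integrable_haarBP2 hω hS (hfg 0) (hfg 1)

theorem pairing_kernelOperator (hω : IsWeight ω)
    (hα : ∀ S : Subgroup G, OpenSigmaCompact S → BoundedOn2 μ ω S C α) (hC : 0 ≤ C)
    (f g : L1 μ ω) : pairing g (kernelOperator hω hα hC f) =
      ∫ p : BP G G, α p * f p.1 * g p.2 ∂(haarBP2 μ) := by
  obtain ⟨S, hS, -, hfg⟩ := L1.exists_subgroup hω ![f, g] isSigmaCompact_empty
  have hf : WeightedL1On μ ω S f := hfg 0
  have hg : WeightedL1On μ ω S g := hfg 1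
  rw [← hf.setIntegral_mul hg, ((hα S hS).integral_slice hω hS hf hg).2, pairing,
    pairing_congr g (rep_kernelOperator hω hα hC f) hω]
  exact (setIntegral_eq_integral_of_forall_compl_eq_zero fun x hx => by
    rw [hg.eq_zero x hx, zero_mul]).symm

variable {hω : IsWeight ω}

/-- The failure of the derivation identity is the integral of the failure of the cocycle
identity. -/
theorem Represents.derivation_defect {D : L1 μ ω →L[ℂ] LInf μ ω hω}
    (hα : ∀ S : Subgroup G, OpenSigmaCompact S → BoundedOn2 μ ω S C α)
    (hD : Represents α D) (f g h : L1 μ ω) {T : Set G} (hT : IsSigmaCompact T) :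
    ∃ S : Subgroup G, OpenSigmaCompact S ∧ T ⊆ S ∧
      Integrable (fun p : BP G (BP G G) => cocycleDefect α p * (f p.1 * g p.2.1 * h p.2.2))
        (haarOn3 μ S) ∧
      ∫ p, cocycleDefect α p * (f p.1 * g p.2.1 * h p.2.2) ∂(haarOn3 μ S) =
        pairing h (D (mulL1 μ ω f g)) - pairing (mulL1 μ ω g h) (D f) -
          pairing (mulL1 μ ω h f) (D g) := by
  -- The three products are included because their representatives are only almost everywhere equal
  -- to the convolutions, and they too must vanish off S.
  obtain ⟨S, hS, hTS, hi⟩ := L1.exists_subgroup hω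
    ![f, g, h, mulL1 μ ω f g, mulL1 μ ω g h, mulL1 μ ω h f] hT
  have hf : WeightedL1On μ ω S f := hi 0
  have hg : WeightedL1On μ ω S g := hi 1
  have hh : WeightedL1On μ ω S h := hi 2
  have hfg : WeightedL1On μ ω S (mulL1 μ ω f g) := hi 3
  have hgh : WeightedL1On μ ω S (mulL1 μ ω g h) := hi 4
  have hhf : WeightedL1On μ ω S (mulL1 μ ω h f) := hi 5
  have hrep : ∀ a b : L1 μ ω, WeightedL1On μ ω S a → WeightedL1On μ ω S b →
      pairing b (D a) = ∫ p : BP G G, α p * a p.1 * b p.2 ∂(haarOn2 μ S) := fun a b ha hb =>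
    (hD a b).2.trans (ha.setIntegral_mul hb).symm
  have hT := hS.tonelli2 (μ := μ)
  have hfst : ∀ a b : L1 μ ω, ∀ᵐ p : BP G G ∂(haarOn2 μ S),
      mulL1 μ ω a b p.1 = conv μ a b p.1 := fun a b =>
    hT.quasiMeasurePreserving_fst.ae (ae_restrict_of_ae (coeFn_mulL1 hω a b))
  have hsnd : ∀ a b : L1 μ ω, ∀ᵐ p : BP G G ∂(haarOn2 μ S),
      mulL1 μ ω a b p.2 = conv μ a b p.2 := fun a b =>
    hT.quasiMeasurePreserving_snd.ae (ae_restrict_of_ae (coeFn_mulL1 hω a b))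
  obtain ⟨h1, h2⟩ := (hα S hS).integral_cocycleDefect hω hS hf hg hh
  refine ⟨S, hS, hTS, h1, ?_⟩
  rw [h2, hrep _ _ hfg hh, hrep _ _ hf hgh, hrep _ _ hg hhf]
  congr 1
  · congr 1
    · refine integral_congr_ae ?_
      filter_upwards [hfst f g] with p hp
      rw [hp]
    · refine integral_congr_ae ?_
      filter_upwards [hsnd g h] with p hp
      rw [hp]
  · refine integral_congr_ae ?_
    filter_upwards [hsnd h f] with p hp
    rw [hp]

theorem Represents.isDerivation {D : L1 μ ω →L[ℂ] LInf μ ω hω}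
    (hα : ∀ S : Subgroup G, OpenSigmaCompact S → BoundedOn2 μ ω S C α)
    (hD : Represents α D) (hcyc : ∀ᶠ p in locAE (haarBP3 μ), cocycleDefect α p = 0) :
    IsDerivation D := by
  intro f g h
  obtain ⟨S, hS, -, -, h2⟩ := hD.derivation_defect hα f g h isSigmaCompact_empty
  have hσ := hS.isSigmaCompact.rect (hS.isSigmaCompact.rect hS.isSigmaCompact)
  have h3 : ∫ p, cocycleDefect α p * (f p.1 * g p.2.1 * h p.2.2) ∂(haarOn3 μ S) = 0 := by
    refine integral_eq_zero_of_ae ?_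
    filter_upwards [ae_restrict_of_locAE hσ hcyc] with p hp
    rw [hp, zero_mul]
    rfl
  rw [h3] at h2
  linear_combination -h2

theorem isCyclicCocycle_iff {α : G × G → ℂ} :
    IsCyclicCocycle μ α ↔ ∀ᶠ p in locAE (haarBP3 μ), cocycleDefect α p = 0 := by
  refine eventually_congr (Eventually.of_forall fun p => ?_)
  unfold cocycleDefect
  rw [sub_sub, sub_eq_zero]
  rfl

/-- The derivation with a given cyclic cocycle as its kernel. -/
theorem existsUnique_derivation {α : G × G → ℂ} (hα : MemLInftyInv (haar2 μ) (weight2 ω) α)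
    (hcyc : IsCyclicCocycle μ α) :
    ∃! D : L1 μ ω →L[ℂ] LInf μ ω hω, IsDerivation D ∧ Represents α D := by
  obtain ⟨C, hC, hα'⟩ := MemLInftyInv.exists_boundedOn2 (μ := μ) hω hα
  have hrep : Represents α (kernelOperator hω hα' hC) := fun f g =>
    ⟨integrable_kernel hω hα' f g, pairing_kernelOperator hω hα' hC f g⟩
  refine ⟨kernelOperator hω hα' hC,
    ⟨hrep.isDerivation hα' (isCyclicCocycle_iff.1 hcyc), hrep⟩, fun D hD => ?_⟩
  ext1 f
  exact LInf.ext fun g => (hD.2 f g).2.trans (hrep f g).2.symm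

end Kernel

/-! ### Bases of relatively compact open rectangles. -/

section Basis

set_option linter.unusedSectionVars false

/-- The open sets with compact closure. -/
def relCompactOpens (X : Type*) [TopologicalSpace X] : Set (Set X) :=
  {A | IsOpen A ∧ IsCompact (closure A)}

theorem isTopologicalBasis_relCompactOpens (X : Type*) [TopologicalSpace X] [T2Space X]
    [LocallyCompactSpace X] : TopologicalSpace.IsTopologicalBasis (relCompactOpens X) := by
  refine TopologicalSpace.isTopologicalBasis_of_isOpen_of_nhds (fun u hu => hu.1) fun a u ha hu => ?_
  obtain ⟨K, haK, hKu, hK⟩ := local_compact_nhds (hu.mem_nhds ha)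
  exact ⟨interior K, ⟨isOpen_interior, hK.closure_of_subset interior_subset⟩,
    mem_interior_iff_mem_nhds.2 haK, interior_subset.trans hKu⟩

theorem relCompactOpens_inter {X : Type*} [TopologicalSpace X] :
    ∀ A ∈ relCompactOpens X, ∀ B ∈ relCompactOpens X, A ∩ B ∈ relCompactOpens X :=
  fun _ hA _ hB => ⟨hA.1.inter hB.1, hA.2.of_isClosed_subset isClosed_closure
    (closure_mono Set.inter_subset_left)⟩

variable {X Y : Type*} [TopologicalSpace X] [TopologicalSpace Y] {𝓐 : Set (Set X)}
  {𝓑 : Set (Set Y)}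

theorem isTopologicalBasis_rect (hA : TopologicalSpace.IsTopologicalBasis 𝓐)
    (hB : TopologicalSpace.IsTopologicalBasis 𝓑) :
    TopologicalSpace.IsTopologicalBasis (Set.image2 BP.rect 𝓐 𝓑) := hA.prod hB

theorem image2_rect_inter (hA : ∀ A ∈ 𝓐, ∀ A' ∈ 𝓐, A ∩ A' ∈ 𝓐)
    (hB : ∀ B ∈ 𝓑, ∀ B' ∈ 𝓑, B ∩ B' ∈ 𝓑) :
    ∀ R ∈ Set.image2 BP.rect 𝓐 𝓑, ∀ R' ∈ Set.image2 BP.rect 𝓐 𝓑,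
      R ∩ R' ∈ Set.image2 BP.rect 𝓐 𝓑 := by
  rintro _ ⟨A, hA1, B, hB1, rfl⟩ _ ⟨A', hA1', B', hB1', rfl⟩
  refine ⟨A ∩ A', hA _ hA1 _ hA1', B ∩ B', hB _ hB1 _ hB1', ?_⟩
  ext p
  simp only [BP.rect, Set.mem_inter_iff, Set.mem_ofPred_eq]
  tauto

theorem integral_of_ae_eq_indicator {Z : Type*} [MeasurableSpace Z] {ρ : Measure Z} {R B : Set Z}
    (hB : MeasurableSet B) (hBR : B ⊆ R) {F γ : Z → ℂ} (hF : Integrable F (ρ.restrict R))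
    (h : F =ᵐ[ρ.restrict R] B.indicator γ) :
    IntegrableOn γ B ρ ∧ ∫ z in B, γ z ∂ρ = ∫ z in R, F z ∂ρ := by
  have h1 := (integrable_indicator_iff hB).1 (hF.congr h)
  rw [IntegrableOn, Measure.restrict_restrict hB, Set.inter_eq_self_of_subset_left hBR] at h1
  refine ⟨h1, ?_⟩
  rw [integral_congr_ae h, integral_indicator hB, Measure.restrict_restrict hB,
    Set.inter_eq_self_of_subset_left hBR]

end Basis

/-! ### Uniqueness of the kernel and its cocycle identity. -/

section Uniqueness

set_option linter.unusedSectionVars false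

variable {G : Type*} [Group G] [TopologicalSpace G] [IsTopologicalGroup G]
  [LocallyCompactSpace G] [T2Space G] [MeasurableSpace G] [BorelSpace G]
  {μ : Measure G} [μ.IsHaarMeasure] [μ.Regular] {S : Subgroup G} {ω : G → ℝ}

theorem ae_indL1_mul (hω : IsWeight ω) (hS : OpenSigmaCompact S) (γ : BP G G → ℂ)
    {A B : Set G} (hA : MeasurableSet A) (hB : MeasurableSet B)
    (hA' : (μ.withDensity fun x => ENNReal.ofReal (ω x)) A ≠ ∞)
    (hB' : (μ.withDensity fun x => ENNReal.ofReal (ω x)) B ≠ ∞) :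
    (fun p : BP G G => γ p * indL1 μ ω hA hA' p.1 * indL1 μ ω hB hB' p.2) =ᵐ[haarOn2 μ S]
      (BP.rect A B).indicator γ := by
  have hT := hS.tonelli2 (μ := μ)
  filter_upwards [hT.quasiMeasurePreserving_fst.ae (ae_restrict_of_ae (coeFn_indL1 hω hA hA')),
    hT.quasiMeasurePreserving_snd.ae (ae_restrict_of_ae (coeFn_indL1 hω hB hB'))] with p h1 h2
  rw [h1, h2]
  by_cases hp1 : p.1 ∈ A <;> by_cases hp2 : p.2 ∈ B <;>
    simp [Set.indicator, BP.rect, hp1, hp2]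

theorem setIntegral_rect (hω : IsWeight ω) {C : ℝ} {γ : BP G G → ℂ}
    (hγ : ∀ S : Subgroup G, OpenSigmaCompact S → BoundedOn2 μ ω S C γ) {A B K L : Set G}
    (hA : MeasurableSet A) (hB : MeasurableSet B) (hK : IsCompact K) (hL : IsCompact L)
    (hAK : A ⊆ K) (hBL : B ⊆ L) :
    IntegrableOn γ (BP.rect A B) (haarBP2 μ) ∧
    ∫ p in BP.rect A B, γ p ∂(haarBP2 μ) =
      ∫ p : BP G G, γ p * indL1 μ ω hA (withDensity_lt_top_of_isCompact hω hK hAK) p.1 *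
        indL1 μ ω hB (withDensity_lt_top_of_isCompact hω hL hBL) p.2 ∂(haarBP2 μ) := by
  have hA' := withDensity_lt_top_of_isCompact (μ := μ) hω hK hAK
  have hB' := withDensity_lt_top_of_isCompact (μ := μ) hω hL hBL
  obtain ⟨S, hS, hTS, hi⟩ := L1.exists_subgroup hω ![indL1 μ ω hA hA', indL1 μ ω hB hB']
    (hK.isSigmaCompact.union hL.isSigmaCompact)
  have hf : WeightedL1On μ ω S (indL1 μ ω hA hA') := hi 0
  have hg : WeightedL1On μ ω S (indL1 μ ω hB hB') := hi 1
  have hsub : BP.rect A B ⊆ BP.rect (S : Set G) (S : Set G) := fun p hp =>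
    ⟨hTS (Or.inl (hAK hp.1)), hTS (Or.inr (hBL hp.2))⟩
  have hint := (hγ S hS).integrable_haarBP2 hω hS hf hg
  have h := integral_of_ae_eq_indicator (ρ := haarBP2 μ) (BP.measurableSet_rect hA hB) hsub
    hint.integrableOn (ae_indL1_mul hω hS γ hA hB hA' hB')
  exact ⟨h.1, h.2.trans (hf.setIntegral_mul hg)⟩

/-- Indicators of rectangles are products of elements of L¹(G, ω). Rectangles need not generate the
Borel sets of G × G, so the conclusion rests on open rectangles as a basis of the topology, and on
regularity. -/
theorem locAE_eq_zero_of_integral_eq_zero (hω : IsWeight ω) {C : ℝ} {γ : BP G G → ℂ}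
    (hγ : ∀ S : Subgroup G, OpenSigmaCompact S → BoundedOn2 μ ω S C γ)
    (h0 : ∀ f g : L1 μ ω, ∫ p : BP G G, γ p * f p.1 * g p.2 ∂(haarBP2 μ) = 0) :
    ∀ᶠ p in locAE (haarBP2 μ), γ p = 0 := by
  have hb := isTopologicalBasis_relCompactOpens G
  refine ae_eq_zero_of_forall_basis (isTopologicalBasis_rect hb hb)
    (image2_rect_inter relCompactOpens_inter relCompactOpens_inter) ?_ ?_
  · rintro _ ⟨A, hA, B, hB, rfl⟩
    exact (setIntegral_rect hω hγ hA.1.measurableSet hB.1.measurableSet hA.2 hB.2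
      subset_closure subset_closure).1
  · rintro _ ⟨A, hA, B, hB, rfl⟩
    exact (setIntegral_rect hω hγ hA.1.measurableSet hB.1.measurableSet hA.2 hB.2
      subset_closure subset_closure).2.trans (h0 _ _)

variable {hω : IsWeight ω}

theorem Represents.locAE_eq {D : L1 μ ω →L[ℂ] LInf μ ω hω} {α β : G × G → ℂ}
    (hα : MemLInftyInv (haar2 μ) (weight2 ω) α) (hβ : MemLInftyInv (haar2 μ) (weight2 ω) β)
    (hαD : Represents α D) (hβD : Represents β D) : β =ᶠ[locAE (haar2 μ)] α := by
  obtain ⟨C, -, hα'⟩ := MemLInftyInv.exists_boundedOn2 (μ := μ) hω hα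
  obtain ⟨C', -, hβ'⟩ := MemLInftyInv.exists_boundedOn2 (μ := μ) hω hβ
  have hγ : ∀ S : Subgroup G, OpenSigmaCompact S →
      BoundedOn2 μ ω S (C' + C) (fun p => β p - α p) := by
    intro S hS
    refine ⟨(hβ' S hS).1.sub (hα' S hS).1, ?_⟩
    filter_upwards [(hβ' S hS).2, (hα' S hS).2] with p h1 h2
    rw [add_mul]
    exact (norm_sub_le _ _).trans (add_le_add h1 h2)
  have h := locAE_eq_zero_of_integral_eq_zero hω hγ fun f g => by
    have h1 := hαD f g
    have h2 := hβD f g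
    have h3 : (fun p : BP G G => (β p - α p) * f p.1 * g p.2) =
        fun p => β p * f p.1 * g p.2 - α p * f p.1 * g p.2 := by
      ext p; ring
    rw [h3]
    refine (integral_sub h2.1 h1.1).trans ?_
    rw [sub_eq_zero]
    exact h2.2.symm.trans h1.2
  exact h.mono fun p hp => sub_eq_zero.1 hp

/-- The kernel of a derivation is a cyclic cocycle. -/
theorem Represents.isCyclicCocycle {D : L1 μ ω →L[ℂ] LInf μ ω hω} {C : ℝ} {α : BP G G → ℂ}
    (hα : ∀ S : Subgroup G, OpenSigmaCompact S → BoundedOn2 μ ω S C α)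
    (hαD : Represents α D) (hD : IsDerivation D) :
    ∀ᶠ p in locAE (haarBP3 μ), cocycleDefect α p = 0 := by
  have hb := isTopologicalBasis_relCompactOpens G
  -- The integral of the defect over A × B × E is the failure of the derivation identity for the
  -- three indicator functions.
  have key : ∀ A ∈ relCompactOpens G, ∀ B ∈ relCompactOpens G, ∀ E ∈ relCompactOpens G,
      IntegrableOn (cocycleDefect α) (BP.rect A (BP.rect B E)) (haarBP3 μ) ∧
      ∫ p in BP.rect A (BP.rect B E), cocycleDefect α p ∂(haarBP3 μ) = 0 := by
    intro A hA B hB E hE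
    obtain ⟨S, hS, hTS, h1, h2⟩ := hαD.derivation_defect hα
      (indL1 μ ω hA.1.measurableSet (withDensity_lt_top_of_isCompact hω hA.2 subset_closure))
      (indL1 μ ω hB.1.measurableSet (withDensity_lt_top_of_isCompact hω hB.2 subset_closure))
      (indL1 μ ω hE.1.measurableSet (withDensity_lt_top_of_isCompact hω hE.2 subset_closure))
      (hA.2.isSigmaCompact.union (hB.2.isSigmaCompact.union hE.2.isSigmaCompact))
    have hT := hS.tonelli2 (μ := μ)
    have hT3 := hS.tonelli3 (μ := μ)
    have hsub : BP.rect A (BP.rect B E) ⊆ BP.rect (S : Set G) (BP.rect (S : Set G) (S : Set G)) :=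
      fun p hp => ⟨hTS (Or.inl (subset_closure hp.1)),
        hTS (Or.inr (Or.inl (subset_closure hp.2.1))),
        hTS (Or.inr (Or.inr (subset_closure hp.2.2)))⟩
    have h := integral_of_ae_eq_indicator (ρ := haarBP3 μ) (γ := cocycleDefect α)
      (BP.measurableSet_rect hA.1.measurableSet
        (BP.measurableSet_rect hB.1.measurableSet hE.1.measurableSet)) hsub h1 (by
        filter_upwards [hT3.quasiMeasurePreserving_fst.ae (ae_restrict_of_ae
            (coeFn_indL1 hω hA.1.measurableSet
              (withDensity_lt_top_of_isCompact hω hA.2 subset_closure))),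
          hT3.quasiMeasurePreserving_snd.ae (hT.quasiMeasurePreserving_fst.ae (ae_restrict_of_ae
            (coeFn_indL1 hω hB.1.measurableSet
              (withDensity_lt_top_of_isCompact hω hB.2 subset_closure)))),
          hT3.quasiMeasurePreserving_snd.ae (hT.quasiMeasurePreserving_snd.ae (ae_restrict_of_ae
            (coeFn_indL1 hω hE.1.measurableSet
              (withDensity_lt_top_of_isCompact hω hE.2 subset_closure))))] with p e1 e2 e3
        rw [e1, e2, e3]
        by_cases hp1 : p.1 ∈ A <;> by_cases hp2 : p.2.1 ∈ B <;> by_cases hp3 : p.2.2 ∈ E <;>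
          simp [Set.indicator, BP.rect, hp1, hp2, hp3])
    refine ⟨h.1, h.2.trans (h2.trans ?_)⟩
    rw [hD]
    ring
  refine ae_eq_zero_of_forall_basis (isTopologicalBasis_rect hb (isTopologicalBasis_rect hb hb))
    (image2_rect_inter relCompactOpens_inter
      (image2_rect_inter relCompactOpens_inter relCompactOpens_inter)) ?_ ?_
  · rintro _ ⟨A, hA, _, ⟨B, hB, E, hE, rfl⟩, rfl⟩
    exact (key A hA B hB E hE).1
  · rintro _ ⟨A, hA, _, ⟨B, hB, E, hE, rfl⟩, rfl⟩
    exact (key A hA B hB E hE).2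

end Uniqueness

/-! ### A partition of G into small Borel pieces. -/

section Partition

set_option linter.unusedSectionVars false

variable {G : Type*} [Group G] [TopologicalSpace G] [IsTopologicalGroup G]
  [LocallyCompactSpace G] [T2Space G] [MeasurableSpace G] [BorelSpace G]

/-- A partition, given by an index map, into relatively compact Borel sets, such that every
`σ`-compact set meets only countably many of its members. -/
structure IsBorelPartition {I : Type*} (i : G → I) : Prop where
  measurableSet : ∀ j, MeasurableSet (i ⁻¹' {j})
  subset_compact : ∀ j, ∃ K, IsCompact K ∧ i ⁻¹' {j} ⊆ K
  countable : ∀ T, IsSigmaCompact T → (i '' T).Countable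

/-- Each coset of an open σ-compact subgroup is a countable union of compact sets; a point is
indexed by its coset and the first of these sets to contain it. The quotient is discrete, so a
σ-compact set meets only countably many cosets. -/
theorem exists_isBorelPartition (G : Type*) [Group G] [TopologicalSpace G] [IsTopologicalGroup G]
    [LocallyCompactSpace G] [T2Space G] [MeasurableSpace G] [BorelSpace G] :
    ∃ (S : Subgroup G) (i : G → (G ⧸ S) × ℕ), IsBorelPartition i := by
  classical
  obtain ⟨S, hS, -⟩ := exists_openSigmaCompact (isSigmaCompact_empty (X := G))
  choose K hK hKq using fun q : G ⧸ S => isSigmaCompact_fiber hS.isSigmaCompact q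
  have hex : ∀ x : G, ∃ n, x ∈ K (QuotientGroup.mk x) n := fun x => by
    have : x ∈ ⋃ n, K (QuotientGroup.mk x) n := by rw [hKq]; rfl
    exact Set.mem_iUnion.1 this
  refine ⟨S, fun x => (QuotientGroup.mk x, Nat.find (hex x)), ?_, ?_, ?_⟩
  · rintro ⟨q, n⟩
    have : (fun x => ((QuotientGroup.mk x : G ⧸ S), Nat.find (hex x))) ⁻¹' {(q, n)} =
        K q n \ ⋃ m ∈ Finset.range n, K q m := by
      ext x
      simp only [Set.mem_preimage, Set.mem_singleton_iff, Prod.mk.injEq, Set.mem_sdiff,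
        Set.mem_iUnion, Finset.mem_range, exists_prop, not_exists, not_and]
      constructor
      · rintro ⟨rfl, h⟩
        obtain ⟨h1, h2⟩ := (Nat.find_eq_iff _).1 h
        exact ⟨h1, h2⟩
      · rintro ⟨h1, h2⟩
        have hq : QuotientGroup.mk x = q := by
          have : x ∈ (QuotientGroup.mk : G → G ⧸ S) ⁻¹' {q} := by
            rw [← hKq]; exact Set.mem_iUnion.2 ⟨n, h1⟩
          exact this
        subst hq
        exact ⟨rfl, (Nat.find_eq_iff _).2 ⟨h1, h2⟩⟩
    rw [this]
    exact (hK q n).measurableSet.diff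
      (Finset.measurableSet_biUnion _ fun m _ => (hK q m).measurableSet)
  · rintro ⟨q, n⟩
    refine ⟨K q n, hK q n, ?_⟩
    intro x hx
    obtain ⟨rfl, h⟩ := Prod.mk.inj (Set.mem_singleton_iff.1 hx)
    exact ((Nat.find_eq_iff _).1 h).1
  · intro T hT
    have : DiscreteTopology (G ⧸ S) := QuotientGroup.discreteTopology hS.isOpen
    obtain ⟨L, hL, hLT⟩ := hT.image (QuotientGroup.continuous_mk (N := S))
    have hc : ((QuotientGroup.mk : G → G ⧸ S) '' T).Countable := by
      rw [← hLT]
      exact Set.countable_iUnion fun n => (hL n).finite_of_discrete.countable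
    refine (hc.prod (Set.countable_univ (α := ℕ))).mono ?_
    rintro _ ⟨x, hx, rfl⟩
    exact ⟨⟨x, hx, rfl⟩, Set.mem_univ _⟩

variable {μ : Measure G} [μ.IsHaarMeasure] [μ.Regular] {ω : G → ℝ} {I : Type*} {i : G → I}

theorem tendsto_measure_diff_zero {X : Type*} [MeasurableSpace X] {ν : Measure X} {A : Set X}
    {B : ℕ → Set X} (hA : MeasurableSet A) (hfin : ν A ≠ ∞) (hB : ∀ n, MeasurableSet (B n))
    (hmono : Monotone B) (hAB : A = ⋃ n, B n) :
    Tendsto (fun n => ν (symmDiff (B n) A)) atTop (𝓝 0) := by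
  have h1 : ∀ n, symmDiff (B n) A = A \ B n := fun n => by
    have : B n ⊆ A := hAB ▸ Set.subset_iUnion B n
    rw [Set.symmDiff_def, Set.sdiff_eq_empty.2 this, Set.empty_union]
  simp_rw [h1]
  have h2 := tendsto_measure_iInter_atTop (μ := ν) (s := fun n => A \ B n)
    (fun n => (hA.diff (hB n)).nullMeasurableSet)
    (fun a b hab => Set.sdiff_subset_sdiff_right (hmono hab))
    ⟨0, ne_top_of_le_ne_top hfin (measure_mono Set.sdiff_subset)⟩
  have h3 : ⋂ n, A \ B n = ∅ := by
    rw [← Set.sdiff_iUnion, ← hAB, Set.sdiff_self]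
  rwa [h3, measure_empty] at h2

/-- A bounded functional on `L¹(G, ω)` which vanishes on the indicator functions of the Borel
subsets of the members of a partition is zero. -/
theorem IsBorelPartition.functional_eq_zero (hi : IsBorelPartition i) (hω : IsWeight ω)
    (T : L1 μ ω →L[ℂ] ℂ)
    (hT : ∀ j (A : Set G) (hA : MeasurableSet A)
      (hf : (μ.withDensity fun x => ENNReal.ofReal (ω x)) A ≠ ∞),
      A ⊆ i ⁻¹' {j} → T (indL1 μ ω hA hf) = 0) : T = 0 := by
  classical
  set ν := μ.withDensity fun x => ENNReal.ofReal (ω x) with hν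
  -- A set of finite weighted measure lies in a σ-compact set, hence meets countably many pieces.
  -- Its intersections `B n` with finitely many pieces are killed by `T`, and their indicators
  -- converge in L¹ to that of A.
  have hind : ∀ (A : Set G) (hA : MeasurableSet A) (hf : ν A ≠ ∞), T (indL1 μ ω hA hf) = 0 := by
    intro A hA hf
    obtain ⟨L, hL, hAL⟩ : ∃ L, IsSigmaCompact L ∧ A ⊆ L := by
      obtain ⟨L, hL, h0⟩ := exists_isSigmaCompact_of_lintegral_ne_top μ
        (f := A.indicator fun x => ENNReal.ofReal (ω x))
        (hω.measurable.ennreal_ofReal.indicator hA) (by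
          rw [lintegral_indicator hA, ← withDensity_apply _ hA]; exact hf)
      refine ⟨L, hL, fun x hx => ?_⟩
      by_contra hxL
      have := h0 x hxL
      rw [Set.indicator_of_mem hx, ENNReal.ofReal_eq_zero] at this
      exact absurd this (hω.pos x).not_ge
    rcases A.eq_empty_or_nonempty with rfl | hne
    · have : indL1 μ ω hA hf = 0 := indicatorConstLp_empty
      rw [this, map_zero]
    have hJ := hi.countable L hL
    obtain ⟨e, he⟩ := hJ.exists_eq_range ((hne.mono hAL).image i)
    let B : ℕ → Set G := fun n => A ∩ ⋃ k ∈ Finset.range n, i ⁻¹' {e k}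
    have hBm : ∀ n, MeasurableSet (B n) := fun n =>
      hA.inter (Finset.measurableSet_biUnion _ fun k _ => hi.measurableSet _)
    have hBf : ∀ n, ν (B n) ≠ ∞ := fun n =>
      ne_top_of_le_ne_top hf (measure_mono Set.inter_subset_left)
    have hBmono : Monotone B := fun a b hab => Set.inter_subset_inter_right _
      (Set.biUnion_subset_biUnion_left fun k hk =>
        Finset.mem_range.2 ((Finset.mem_range.1 hk).trans_le hab))
    have hBA : A = ⋃ n, B n := by
      refine Set.Subset.antisymm (fun x hx => ?_) (Set.iUnion_subset fun n => Set.inter_subset_left)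
      have : i x ∈ Set.range e := he ▸ Set.mem_image_of_mem i (hAL hx)
      obtain ⟨k, hk⟩ := this
      exact Set.mem_iUnion.2 ⟨k + 1, hx, Set.mem_iUnion₂.2 ⟨k, by simp, hk.symm⟩⟩
    have hB0 : ∀ n, T (indL1 μ ω (hBm n) (hBf n)) = 0 := by
      intro n
      induction n with
      | zero =>
        have h0 : B 0 = ∅ := by simp [B]
        have : indL1 μ ω (hBm 0) (hBf 0) = 0 := by
          unfold indL1
          simp only [h0]
          exact indicatorConstLp_empty
        rw [this, map_zero]
      | succ n ih =>
        -- The enumeration `e` may repeat pieces, so `B n` is removed to keep the union disjoint.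
        have hP : MeasurableSet ((A ∩ i ⁻¹' {e n}) \ B n) :=
          (hA.inter (hi.measurableSet _)).diff (hBm n)
        have hPf : ν ((A ∩ i ⁻¹' {e n}) \ B n) ≠ ∞ := ne_top_of_le_ne_top hf
          (measure_mono (Set.sdiff_subset.trans Set.inter_subset_left))
        have hsucc : B (n + 1) = B n ∪ ((A ∩ i ⁻¹' {e n}) \ B n) := by
          rw [Set.union_sdiff_self, ← Set.inter_union_distrib_left]
          change A ∩ (⋃ k ∈ Finset.range (n + 1), i ⁻¹' {e k}) = _
          rw [Finset.range_add_one, Finset.set_biUnion_insert, Set.union_comm]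
        have : indL1 μ ω (hBm (n + 1)) (hBf (n + 1)) =
            indL1 μ ω (hBm n) (hBf n) + indL1 μ ω hP hPf := by
          unfold indL1
          rw [← indicatorConstLp_disjoint_union (hBm n) hP (hBf n) hPf Set.disjoint_sdiff_right]
          simp only [hsucc]
        rw [this, map_add, ih, hT (e n) _ hP hPf (Set.sdiff_subset.trans Set.inter_subset_right),
          add_zero]
    have hlim : Tendsto (fun n => indL1 μ ω (hBm n) (hBf n)) atTop (𝓝 (indL1 μ ω hA hf)) :=
      tendsto_indicatorConstLp_set ENNReal.one_ne_top
        (tendsto_measure_diff_zero hA hf hBm hBmono hBA)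
    have h1 := (T.continuous.tendsto _).comp hlim
    simp only [Function.comp_def, hB0] at h1
    exact tendsto_nhds_unique h1 tendsto_const_nhds
  ext f
  rw [zero_apply]
  refine Lp.induction ENNReal.one_ne_top (motive := fun f : L1 μ ω => T f = 0) ?_ ?_ ?_ f
  · intro c A hA hf
    have : (Lp.simpleFunc.indicatorConst 1 hA hf.ne c : Lp ℂ 1 ν) = c • indL1 μ ω hA hf.ne := by
      rw [Lp.simpleFunc.coe_indicatorConst]
      refine Lp.ext ?_
      filter_upwards [indicatorConstLp_coeFn (p := 1) (hs := hA) (hμs := hf.ne) (c := c),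
        Lp.coeFn_smul c (indL1 μ ω hA hf.ne),
        indicatorConstLp_coeFn (p := 1) (hs := hA) (hμs := hf.ne) (c := (1 : ℂ))] with x h1 h2 h3
      rw [h1, h2, Pi.smul_apply, indL1, h3]
      by_cases hx : x ∈ A <;> simp [hx]
    rw [this, map_smul, hind A hA hf.ne, smul_zero]
  · intro f g hf hg _ h1 h2
    rw [map_add, h1, h2, add_zero]
  · exact isClosed_eq T.continuous continuous_const

end Partition

/-! ### Existence of the kernel. -/

section Existence

set_option linter.unusedSectionVars false

variable {G : Type*} [Group G] [TopologicalSpace G] [IsTopologicalGroup G]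
  [LocallyCompactSpace G] [T2Space G] [MeasurableSpace G] [BorelSpace G]
  {μ : Measure G} [μ.IsHaarMeasure] [μ.Regular] {ω : G → ℝ}

theorem measurable_weight2 (hω : IsWeight ω) :
    Measurable (fun p : BP G G => weight2 ω p) :=
  (hω.measurable.comp BP.measurable_fst).mul (hω.measurable.comp BP.measurable_snd)

theorem withDensity_weight2_rect (hω : IsWeight ω) {A B K L : Set G} (hA : MeasurableSet A)
    (hB : MeasurableSet B) (hK : IsCompact K) (hL : IsCompact L) (hAK : A ⊆ K) (hBL : B ⊆ L) :
    ((haarBP2 μ).withDensity fun p => ENNReal.ofReal (weight2 ω p)) (BP.rect A B) =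
      (μ.withDensity fun x => ENNReal.ofReal (ω x)) A *
        (μ.withDensity fun x => ENNReal.ofReal (ω x)) B := by
  obtain ⟨S, hS, hTS⟩ := exists_openSigmaCompact (hK.isSigmaCompact.union hL.isSigmaCompact)
  have hT := hS.tonelli2 (μ := μ)
  have hsub : BP.rect A B ⊆ BP.rect (S : Set G) (S : Set G) := fun p hp =>
    ⟨hTS (Or.inl (hAK hp.1)), hTS (Or.inr (hBL hp.2))⟩
  have hAS : A ⊆ S := fun x hx => hTS (Or.inl (hAK hx))
  have hBS : B ⊆ S := fun x hx => hTS (Or.inr (hBL hx))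
  have hR := BP.measurableSet_rect hA hB
  have h1 := hT.lintegral_mul (hω.measurable.ennreal_ofReal.indicator hA)
    (hω.measurable.ennreal_ofReal.indicator hB)
  have h2 : ∀ p : BP G G, A.indicator (fun x => ENNReal.ofReal (ω x)) p.1 *
      B.indicator (fun x => ENNReal.ofReal (ω x)) p.2 =
      (BP.rect A B).indicator (fun p => ENNReal.ofReal (weight2 ω p)) p := by
    intro p
    by_cases hp1 : p.1 ∈ A <;> by_cases hp2 : p.2 ∈ B <;>
      simp [Set.indicator, BP.rect, hp1, hp2, weight2, ENNReal.ofReal_mul (hω.pos _).le]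
  simp_rw [h2] at h1
  rw [lintegral_indicator hR, Measure.restrict_restrict hR,
    Set.inter_eq_self_of_subset_left hsub, lintegral_indicator hA, Measure.restrict_restrict hA,
    Set.inter_eq_self_of_subset_left hAS, lintegral_indicator hB, Measure.restrict_restrict hB,
    Set.inter_eq_self_of_subset_left hBS] at h1
  rw [withDensity_apply _ hR, withDensity_apply _ hA, withDensity_apply _ hB]
  exact h1

theorem norm_indL1 {A : Set G} (hA : MeasurableSet A)
    (hf : (μ.withDensity fun x => ENNReal.ofReal (ω x)) A ≠ ∞) :
    ‖indL1 μ ω hA hf‖ = (μ.withDensity fun x => ENNReal.ofReal (ω x)).real A := by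
  unfold indL1
  rw [norm_indicatorConstLp one_ne_zero ENNReal.one_ne_top]
  simp

theorem indL1_union {A A' : Set G} (hA : MeasurableSet A) (hA' : MeasurableSet A')
    (hf : (μ.withDensity fun x => ENNReal.ofReal (ω x)) A ≠ ∞)
    (hf' : (μ.withDensity fun x => ENNReal.ofReal (ω x)) A' ≠ ∞) (hd : Disjoint A A')
    (hAA : MeasurableSet (A ∪ A'))
    (hff : (μ.withDensity fun x => ENNReal.ofReal (ω x)) (A ∪ A') ≠ ∞) :
    indL1 μ ω hAA hff = indL1 μ ω hA hf + indL1 μ ω hA' hf' :=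
  indicatorConstLp_disjoint_union hA hA' hf hf' hd (1 : ℂ)

variable {hω : IsWeight ω}

/-- The kernel of an operator from `L¹(G, ω)` to `L^∞(G, 1/ω)` on a relatively compact
rectangle. -/
theorem exists_kernel_on_rect (D : L1 μ ω →L[ℂ] LInf μ ω hω) {P Q K L : Set G}
    (hP : MeasurableSet P) (hQ : MeasurableSet Q) (hK : IsCompact K) (hL : IsCompact L)
    (hPK : P ⊆ K) (hQL : Q ⊆ L) :
    ∃ α : BP G G → ℂ, Measurable α ∧ (∀ p, ‖α p‖ ≤ ‖D‖) ∧
      ∀ (A B : Set G) (hA : MeasurableSet A) (hB : MeasurableSet B)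
        (hAf : (μ.withDensity fun x => ENNReal.ofReal (ω x)) A ≠ ∞)
        (hBf : (μ.withDensity fun x => ENNReal.ofReal (ω x)) B ≠ ∞), A ⊆ P → B ⊆ Q →
        ∫ p in BP.rect A B, (weight2 ω p : ℂ) * α p ∂(haarBP2 μ) =
          pairing (indL1 μ ω hB hBf) (D (indL1 μ ω hA hAf)) := by
  classical
  set ν := μ.withDensity fun x => ENNReal.ofReal (ω x) with hν
  -- For the weighted measures ‖1_A‖ ‖1_B‖ is the measure of A × B, so the bimeasure is dominated
  -- with the constant ‖D‖.
  set ρ := (haarBP2 μ).withDensity fun p => ENNReal.ofReal (weight2 ω p) with hρ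
  have hPf : ν P ≠ ∞ := withDensity_lt_top_of_isCompact hω hK hPK
  have hQf : ν Q ≠ ∞ := withDensity_lt_top_of_isCompact hω hL hQL
  have hAf : ∀ A : Set G, ν (A ∩ P) ≠ ∞ := fun A =>
    ne_top_of_le_ne_top hPf (measure_mono Set.inter_subset_right)
  have hBf : ∀ B : Set G, ν (B ∩ Q) ≠ ∞ := fun B =>
    ne_top_of_le_ne_top hQf (measure_mono Set.inter_subset_right)
  -- Cutting with P and Q puts the indicators of all Borel sets in L¹(G, ω); the value on other sets
  -- is immaterial.
  let b : Set G → Set G → ℂ := fun A B =>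
    if h : MeasurableSet A ∧ MeasurableSet B then
      pairing (indL1 μ ω (h.2.inter hQ) (hBf B)) (D (indL1 μ ω (h.1.inter hP) (hAf A)))
    else 0
  have hb : ∀ A B (hA : MeasurableSet A) (hB : MeasurableSet B), b A B =
      pairing (indL1 μ ω (hB.inter hQ) (hBf B)) (D (indL1 μ ω (hA.inter hP) (hAf A))) :=
    fun A B hA hB => dif_pos ⟨hA, hB⟩
  have : IsFiniteMeasure (ν.restrict P) := isFiniteMeasure_restrict.2 hPf
  have : IsFiniteMeasure (ν.restrict Q) := isFiniteMeasure_restrict.2 hQf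
  have hrect : ∀ A B, MeasurableSet A → MeasurableSet B →
      (ρ.restrict (BP.rect P Q)) ((fun p : BP G G => p.1) ⁻¹' A ∩ (fun p : BP G G => p.2) ⁻¹' B) =
        ν.restrict P A * ν.restrict Q B := by
    intro A B hA hB
    have h1 : (fun p : BP G G => p.1) ⁻¹' A ∩ (fun p : BP G G => p.2) ⁻¹' B ∩ BP.rect P Q =
        BP.rect (A ∩ P) (B ∩ Q) := by
      ext p
      simp only [BP.rect, Set.mem_inter_iff, Set.mem_preimage, Set.mem_ofPred_eq]
      tauto
    rw [Measure.restrict_apply ((BP.measurable_fst hA).inter (BP.measurable_snd hB)), h1,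
      Measure.restrict_apply hA, Measure.restrict_apply hB]
    exact withDensity_weight2_rect hω (hA.inter hP) (hB.inter hQ) hK hL
      (Set.inter_subset_right.trans hPK) (Set.inter_subset_right.trans hQL)
  have : IsFiniteMeasure (ρ.restrict (BP.rect P Q)) := by
    refine ⟨?_⟩
    have h1 := hrect Set.univ Set.univ MeasurableSet.univ MeasurableSet.univ
    rw [Set.preimage_univ, Set.preimage_univ, Set.univ_inter] at h1
    rw [h1]
    exact ENNReal.mul_lt_top (measure_lt_top _ _) (measure_lt_top _ _)
  obtain ⟨α, hαm, hαD, hα⟩ := exists_density_of_bimeasure (μ := ν.restrict P) (ν := ν.restrict Q)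
    (ρ := ρ.restrict (BP.rect P Q)) (b := b) (C := ‖D‖) BP.measurable_fst BP.measurable_snd hrect
    (by
      intro A A' B hA hA' hB hd
      rw [hb _ _ (hA.union hA') hB, hb _ _ hA hB, hb _ _ hA' hB, ← pairing_add_right, ← map_add,
        ← indL1_union (hA.inter hP) (hA'.inter hP) (hAf A) (hAf A')
          (hd.mono Set.inter_subset_left Set.inter_subset_left)
          ((hA.inter hP).union (hA'.inter hP)) (by rw [← Set.union_inter_distrib_right]; exact hAf _)]
      simp only [Set.union_inter_distrib_right])
    (by
      intro A B B' hA hB hB' hd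
      rw [hb _ _ hA (hB.union hB'), hb _ _ hA hB, hb _ _ hA hB', ← pairing_add_left,
        ← indL1_union (hB.inter hQ) (hB'.inter hQ) (hBf B) (hBf B')
          (hd.mono Set.inter_subset_left Set.inter_subset_left)
          ((hB.inter hQ).union (hB'.inter hQ)) (by rw [← Set.union_inter_distrib_right]; exact hBf _)]
      simp only [Set.union_inter_distrib_right])
    (norm_nonneg D)
    (by
      intro A B hA hB
      rw [hb _ _ hA hB]
      refine (norm_pairing_apply_le D _ _).trans (le_of_eq ?_)
      rw [norm_indL1, norm_indL1, measureReal_restrict_apply hA, measureReal_restrict_apply hB,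
        mul_assoc])
  refine ⟨α, hαm, hαD, fun A B hA hB hA' hB' hAP hBQ => ?_⟩
  have h1 := hα A B hA hB
  rw [hb _ _ hA hB] at h1
  have h2 : (fun p : BP G G => p.1) ⁻¹' A ∩ (fun p : BP G G => p.2) ⁻¹' B = BP.rect A B := rfl
  have h3 : BP.rect A B ⊆ BP.rect P Q := fun p hp => ⟨hAP hp.1, hBQ hp.2⟩
  have hR := BP.measurableSet_rect hA hB
  rw [h2, Measure.restrict_restrict hR, Set.inter_eq_self_of_subset_left h3, hρ,
    restrict_withDensity hR, integral_withDensity_eq_integral_toReal_smul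
      (measurable_weight2 hω).ennreal_ofReal (Eventually.of_forall fun _ => ENNReal.ofReal_lt_top)]
    at h1
  simp only [Set.inter_eq_self_of_subset_left hAP, Set.inter_eq_self_of_subset_left hBQ] at h1
  rw [← h1]
  refine integral_congr_ae (Eventually.of_forall fun p => ?_)
  simp only [ENNReal.toReal_ofReal (mul_pos (hω.pos p.1) (hω.pos p.2)).le, Complex.real_smul,
    weight2]

/-- `functional_eq_zero` is applied twice to the difference of the bilinear forms: in f with g an
indicator function, then in g with f arbitrary. -/
theorem ContinuousLinearMap.ext_of_indL1 {I : Type*} {i : G → I} (hi : IsBorelPartition i)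
    {D D' : L1 μ ω →L[ℂ] LInf μ ω hω}
    (h : ∀ j k (A B : Set G) (hA : MeasurableSet A) (hB : MeasurableSet B)
      (hAf : (μ.withDensity fun x => ENNReal.ofReal (ω x)) A ≠ ∞)
      (hBf : (μ.withDensity fun x => ENNReal.ofReal (ω x)) B ≠ ∞), A ⊆ i ⁻¹' {j} →
      B ⊆ i ⁻¹' {k} → pairing (indL1 μ ω hB hBf) (D (indL1 μ ω hA hAf)) =
        pairing (indL1 μ ω hB hBf) (D' (indL1 μ ω hA hAf))) : D = D' := by
  let Φ := pairingCLM D - pairingCLM D'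
  have h1 : ∀ k (B : Set G) (hB : MeasurableSet B)
      (hBf : (μ.withDensity fun x => ENNReal.ofReal (ω x)) B ≠ ∞), B ⊆ i ⁻¹' {k} →
      Φ.flip (indL1 μ ω hB hBf) = 0 := fun k B hB hBf hBk =>
    hi.functional_eq_zero hω _ fun j A hA hAf hAj => sub_eq_zero.2
      (h j k A B hA hB hAf hBf hAj hBk)
  ext1 f
  refine LInf.ext fun g => sub_eq_zero.1 ?_
  have h2 : Φ f = 0 := hi.functional_eq_zero hω _ fun k B hB hBf hBk => by
    have := congrArg (fun T : L1 μ ω →L[ℂ] ℂ => T f) (h1 k B hB hBf hBk)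
    simpa using this
  have h3 := congrArg (fun T : L1 μ ω →L[ℂ] ℂ => T g) h2
  exact h3

/-- Every bounded operator from `L¹(G, ω)` to `L^∞(G, 1/ω)` has a kernel. -/
theorem exists_kernel (D : L1 μ ω →L[ℂ] LInf μ ω hω) :
    ∃ α : BP G G → ℂ, MemLInftyInv (haarBP2 μ) (weight2 ω) α ∧ Represents α D := by
  obtain ⟨S, i, hi⟩ := exists_isBorelPartition G
  choose K hK hiK using hi.subset_compact
  choose a ham haD ha using fun j k => exists_kernel_on_rect D (hi.measurableSet j)
    (hi.measurableSet k) (hK j) (hK k) (hiK j) (hiK k)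
  -- The weight converts densities for the weighted measure into densities for the Haar measure.
  let α : BP G G → ℂ := fun p => (weight2 ω p : ℂ) * a (i p.1) (i p.2) p
  have hw : ∀ p : BP G G, 0 < weight2 ω p := fun p => mul_pos (hω.pos _) (hω.pos _)
  have hαb : ∀ p, ‖α p‖ ≤ ‖D‖ * weight2 ω p := by
    intro p
    rw [norm_mul, Complex.norm_real, Real.norm_of_nonneg (hw p).le, mul_comm]
    exact mul_le_mul_of_nonneg_right (haD _ _ p) (hw p).le
  have hrect : ∀ j k, MeasurableSet (BP.rect (i ⁻¹' {j}) (i ⁻¹' {k})) := fun j k =>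
    BP.measurableSet_rect (hi.measurableSet j) (hi.measurableSet k)
  have hαeq : ∀ j k, ∀ p ∈ BP.rect (i ⁻¹' {j}) (i ⁻¹' {k}),
      (weight2 ω p : ℂ) * a j k p = α p := by
    rintro _ _ p ⟨rfl, rfl⟩
    rfl
  -- There may be uncountably many rectangles, so only local measurability is available: a compact
  -- set meets countably many of them.
  have hαm : LocMeasurable (haarBP2 μ) α := by
    intro L hL
    have hJ := (hi.countable _ (hL.image BP.continuous_fst).isSigmaCompact).prod
      (hi.countable _ (hL.image BP.continuous_snd).isSigmaCompact)
    set J := (i '' ((fun p : BP G G => p.1) '' L)) ×ˢ (i '' ((fun p : BP G G => p.2) '' L))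
    have : Countable J := hJ.to_subtype
    have hLsub : L ⊆ ⋃ jk : J, BP.rect (i ⁻¹' {jk.1.1}) (i ⁻¹' {jk.1.2}) := fun p hp =>
      Set.mem_iUnion.2 ⟨⟨(i p.1, i p.2), ⟨p.1, ⟨p, hp, rfl⟩, rfl⟩, ⟨p.2, ⟨p, hp, rfl⟩, rfl⟩⟩,
        rfl, rfl⟩
    refine AEStronglyMeasurable.mono_measure ?_ (Measure.restrict_mono hLsub le_rfl)
    refine aestronglyMeasurable_iUnion_iff.2 fun jk => ?_
    have hm : Measurable fun p : BP G G => (weight2 ω p : ℂ) * a jk.1.1 jk.1.2 p :=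
      (Complex.measurable_ofReal.comp (measurable_weight2 hω)).mul (ham _ _)
    refine hm.aestronglyMeasurable.congr ?_
    filter_upwards [ae_restrict_mem (hrect _ _)] with p hp
    exact hαeq _ _ p hp
  have hα : MemLInftyInv (haarBP2 μ) (weight2 ω) α :=
    ⟨hαm, ‖D‖, Eventually.of_forall hαb⟩
  have hα' : ∀ S : Subgroup G, OpenSigmaCompact S → BoundedOn2 μ ω S ‖D‖ α := fun S hS =>
    ⟨hαm.aestronglyMeasurable_restrict (hS.isSigmaCompact.rect hS.isSigmaCompact),
      Eventually.of_forall hαb⟩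
  -- Both operators agree on indicators of subsets of single pieces, where the glued kernel is one
  -- of the local densities.
  have hDD : D = kernelOperator hω hα' (norm_nonneg D) := by
    refine ContinuousLinearMap.ext_of_indL1 hi fun j k A B hA hB hAf hBf hAj hBk => ?_
    rw [pairing_kernelOperator, ← ha j k A B hA hB hAf hBf hAj hBk]
    refine Eq.trans ?_ (setIntegral_rect hω hα' hA hB (hK j) (hK k) (hAj.trans (hiK j))
      (hBk.trans (hiK k))).2
    exact setIntegral_congr_fun (BP.measurableSet_rect hA hB) fun p hp =>
      hαeq j k p ⟨hAj hp.1, hBk hp.2⟩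
  refine ⟨α, hα, ?_⟩
  rw [hDD]
  exact fun f g => ⟨integrable_kernel hω hα' f g, pairing_kernelOperator hω hα' _ f g⟩

end Existence

end Beurling

theorem mainTheorem3 {G : Type*} [Group G] [TopologicalSpace G] [IsTopologicalGroup G]
    [LocallyCompactSpace G] [T2Space G] [MeasurableSpace G] [BorelSpace G]
    (μ : MeasureTheory.Measure G) [μ.IsHaarMeasure] [μ.Regular]
    (ω : G → ℝ) (hω : Beurling.IsWeight ω) :
    (∀ D : Beurling.L1 μ ω →L[ℂ] Beurling.LInf μ ω hω, Beurling.IsDerivation D →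
      ∃ α : G × G → ℂ,
        (Beurling.MemLInftyInv (Beurling.haar2 μ) (Beurling.weight2 ω) α ∧
          Beurling.IsCyclicCocycle μ α ∧ Beurling.Represents α D) ∧
        ∀ β : G × G → ℂ,
          Beurling.MemLInftyInv (Beurling.haar2 μ) (Beurling.weight2 ω) β →
          Beurling.Represents β D → β =ᶠ[Beurling.locAE (Beurling.haar2 μ)] α) ∧
    (∀ α : G × G → ℂ,
      Beurling.MemLInftyInv (Beurling.haar2 μ) (Beurling.weight2 ω) α →
      Beurling.IsCyclicCocycle μ α →
      ∃! D : Beurling.L1 μ ω →L[ℂ] Beurling.LInf μ ω hω,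
        Beurling.IsDerivation D ∧ Beurling.Represents α D) := by
  refine ⟨fun D hD => ?_, fun α hα hcyc => Beurling.existsUnique_derivation hα hcyc⟩
  obtain ⟨α, hα, hrep⟩ := Beurling.exists_kernel D
  obtain ⟨C, -, hα'⟩ := Beurling.MemLInftyInv.exists_boundedOn2 hω hα
  exact ⟨α, ⟨hα, Beurling.isCyclicCocycle_iff.2 (hrep.isCyclicCocycle hα' hD), hrep⟩,
    fun β hβ hβD => Beurling.Represents.locAE_eq hα hβ hrep hβD⟩
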